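/- Conventions. A surface $M$ is a connected smooth 2-manifold (Hausdorff, second countable) without boundary, with a smooth Riemannian metric $g$. Curves are parametrized by $[0,1]$. A *regular closed curve* on $M$ based at $p$ is a $C^1$ curve $\gamma:[0,1]\to M$ with nowhere vanishing velocity, $\gamma(0)=\gamma(1)=p$, whose velocities at $0$ and $1$ have the same direction (are positive multiples of each other). Two such curves are *regularly homotopic fixing the base point* if they are joined by a family $(\sigma_t)_{0\le t\le 1}$ of regular closed curves based at $p$ such that $\sigma_t(u)$ and its velocity $\partial_u\sigma_t(u)$ are continuous in $(t,u)$. A *conformally euclidean structure* on $M$ is a realization of the universal cover of $M$ as a simply connected open subset $\widetilde M\subset\mathbb E^2$ of the euclidean plane, with smooth covering projection $p_M:\widetilde M\to M$, such that the metric $\widetilde g=p_M^*g$ is conformal to the euclidean metric. It is *tame* if (1) any two points of $\widetilde M$ are joined by a unique shortest geodesic of $(\widetilde M,\widetilde g)$ (a geodesic whose length is minimal among the geodesics joining the two points, unique up to parametrization), and (2) for every compact $K\subset\widetilde M$ there is a $C^1$ map $f:\mathbb E^2\to\widetilde M$ with everywhere injective differential and $f|_K=\mathrm{id}$. For a regular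 $C^1$ curve $c:[0,1]\to\mathbb E^2$ an *angle function* is a continuous $\theta_c:[0,1]\to\mathbb R$ with $c'/|c'|=(\cos\theta_c,\sin\theta_c)$. Put $$i_c=\frac{\theta_c(1)-\theta_c(0)}{2\pi},\qquad j_c=\frac{\theta_c(1)+\theta_c(0)}{2\pi};$$ $i_c$ does not depend on the choice of $\theta_c$, and $j_c$ is well defined modulo $2$. Let $\gamma$ be a regular closed curve based at $p$, let $\widetilde p\in\widetilde M$ with $p_M(\widetilde p)=p$, let $\widetilde\gamma$ be the lift of $\gamma$ with $\widetilde\gamma(0)=\widetilde p$, and let $T$ be the deck transformation with $T(\widetilde p)=\widetilde\gamma(1)$. Then $\gamma$ is *orientation preserving* or *orientation reversing* according as $T$ preserves or reverses the orientation of the plane. If $[\gamma]\neq 1$ in $\pi_1(M,p)$, let $\widetilde\delta$ be the shortest geodesic in $\widetilde M$ from $\widetilde p$ to $\widetilde\gamma(1)$, let $\widehat\delta$ be the lift of $\delta=p_M\circ\widetilde\delta$ with $\widehat\delta(0)=\widetilde\delta(1)$, and let $\chi$ be the real number with $\chi\equiv\theta_{\widehat\delta}(0)-\theta_{\widetilde\delta}(1)\pmod{2\pi}$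 and $-\pi<\chi<\pi$. The *based winding number* of $\gamma$ is $$w_{\widetilde p}(\gamma)=\begin{cases} i_{\widetilde\gamma}\in\mathbb Z & \text{if } [\gamma]=1,\\[2pt] i_{\widetilde\gamma}-i_{\widetilde\delta}-\dfrac{\chi}{2\pi}\in\mathbb Z & \text{if } [\gamma]\ne 1 \text{ and } \gamma \text{ is orientation preserving},\\[2pt] \Bigl(j_{\widetilde\gamma}-j_{\widetilde\delta}-\dfrac{\chi}{2\pi}\Bigr)+2\mathbb Z\in\mathbb Z/2\mathbb Z & \text{if } \gamma \text{ is orientation reversing}.\end{cases}$$ **Theorem.** Let $M$ be a surface with a tame conformally euclidean structure $\widetilde M\subset\mathbb E^2$, let $p\in M$, and fix a point $\widetilde p\in\widetilde M$ over $p$. Then the based winding number $w_{\widetilde p}(\gamma)$ of every regular closed curve $\gamma$ based at $p$ is well defined (it exists in $\mathbb Z$, respectively $\mathbb Z/2\mathbb Z$, and is independent of the choices made). Moreover, for any two regular closed curves $\gamma_1,\gamma_2$ on $M$ based at $p$, the following are equivalent: 1. $\gamma_1$ and $\gamma_2$ are regularly homotopic fixing the base point; 2. $[\gamma_1]=[\gamma_2]\in\pi_1(M,p)$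 and $w_{\widetilde p}(\gamma_1)=w_{\widetilde p}(\gamma_2)$. -/

import Mathlib

open Set Bundle
open scoped Manifold ContDiff Topology

noncomputable section

namespace BasedWinding

/-! ## Regular closed curves on a surface

A surface is a smooth manifold modelled on `EuclideanSpace ℝ (Fin 2)`. Curves are parametrized by the
interval `[0,1]`; they are written as functions on `ℝ` of which only the values on `[0,1]` matter. -/

section Curves

variable {M : Type*} [TopologicalSpace M] [ChartedSpace (EuclideanSpace ℝ (Fin 2)) M]

/-- The velocity vector of a curve `γ : [0,1] → M` at the time `u` (one-sided at the ends). -/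
def velocity (γ : ℝ → M) (u : ℝ) : TangentSpace (𝓡 2) (γ u) :=
  mfderivWithin 𝓘(ℝ, ℝ) (𝓡 2) γ (Icc 0 1) u (1 : ℝ)

/-- A regular closed curve on `M` with base point `p`: a `C¹` curve `γ : [0,1] → M` with nowhere
vanishing velocity, with `γ 0 = γ 1 = p`, and such that the velocity vectors at the two ends have
the same direction, that is, differ by a positive factor. -/
structure RegularClosedCurve (p : M) where
  /-- The underlying map; only its values on `[0,1]` matter. -/
  toFun : ℝ → M
  contMDiffOn : ContMDiffOn 𝓘(ℝ, ℝ) (𝓡 2) 1 toFun (Icc 0 1)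
  velocity_ne_zero : ∀ u ∈ Icc (0 : ℝ) 1, velocity toFun u ≠ 0
  source : toFun 0 = p
  target : toFun 1 = p
  direction_eq : ∃ c : ℝ, 0 < c ∧
    (⟨toFun 1, velocity toFun 1⟩ : TangentBundle (𝓡 2) M) = ⟨toFun 0, c • velocity toFun 0⟩

/-- A regular closed curve, as a continuous loop at its base point. -/
def RegularClosedCurve.toPath {p : M} (γ : RegularClosedCurve p) : Path p p where
  toFun t := γ.toFun t
  continuous_toFun := γ.contMDiffOn.continuousOn.comp_continuous continuous_subtype_val
    (fun t => t.2)
  source' := γ.source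
  target' := γ.target

/-- The element of the fundamental group represented by a regular closed curve. -/
def RegularClosedCurve.homotopyClass {p : M} (γ : RegularClosedCurve p) : FundamentalGroup M p :=
  FundamentalGroup.fromPath (Path.Homotopic.Quotient.mk γ.toPath)

/-- Two regular closed curves with base point `p` are regularly homotopic fixing the base point
if they are joined by a family `σ t`, `t ∈ [0,1]`, of regular closed curves with base point `p` such
that the position `σ t u` and the velocity at `u` of `σ t` are continuous in `(t, u)`. -/
def RegularlyHomotopicFixingBasePoint [IsManifold (𝓡 2) ∞ M] {p : M} (γ₁ γ₂ : RegularClosedCurve p) : Prop :=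
  ∃ σ : unitInterval → RegularClosedCurve p,
    ContinuousOn
      (fun q : unitInterval × ℝ =>
        (⟨(σ q.1).toFun q.2, velocity (σ q.1).toFun q.2⟩ : TangentBundle (𝓡 2) M))
      (univ ×ˢ Icc (0 : ℝ) 1) ∧
    EqOn (σ 0).toFun γ₁.toFun (Icc 0 1) ∧
    EqOn (σ 1).toFun γ₂.toFun (Icc 0 1)

end Curves

/-! ## Curves in the plane: directions, angle functions, `i`- and `j`-indices

The euclidean plane is `ℂ` with its real inner product; the direction `(cos θ, sin θ)` is
`exp (i θ)`. -/

/-- The velocity of a plane curve parametrized by `[0,1]`. -/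
def planeVelocity (c : ℝ → ℂ) (u : ℝ) : ℂ := derivWithin c (Icc 0 1) u

/-- The direction of a plane curve. -/
def planeDirection (c : ℝ → ℂ) (u : ℝ) : ℂ := planeVelocity c u / (‖planeVelocity c u‖ : ℂ)

/-- `θ` is an angle function for the plane curve `c : [0,1] → ℂ`. -/
def IsAngleFunction (c : ℝ → ℂ) (θ : ℝ → ℝ) : Prop :=
  ContinuousOn θ (Icc 0 1) ∧
    ∀ u ∈ Icc (0 : ℝ) 1, planeDirection c u = Complex.exp ((θ u : ℂ) * Complex.I)

/-- The `i`-index of a plane curve with angle function `θ`. -/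
def iIndex (θ : ℝ → ℝ) : ℝ := (θ 1 - θ 0) / (2 * Real.pi)

/-- The `j`-index of a plane curve with angle function `θ` (well defined modulo `2`). -/
def jIndex (θ : ℝ → ℝ) : ℝ := (θ 1 + θ 0) / (2 * Real.pi)

/-! ## Geodesics of a Riemannian metric on an open subset of the plane -/

/-- `c : [0,1] → U` is a geodesic, parametrized proportionally to arc length, of the Riemannian
metric `G` on the open subset `U` of the plane. This is the geodesic equation in the global
coordinates of `U`,
`d/dt (∑ⱼ Gᵢⱼ cⱼ') = (1/2) ∑ⱼₖ (∂ᵢ Gⱼₖ) cⱼ' cₖ'` for all `i`,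
written without indices (`w` is the `i`-th coordinate vector). -/
def IsGeodesic (U : Set ℂ) (G : ℂ → ℂ → ℂ → ℝ) (c : ℝ → ℂ) : Prop :=
  ContDiffOn ℝ 2 c (Icc 0 1) ∧ MapsTo c (Icc 0 1) U ∧
    ∀ t ∈ Icc (0 : ℝ) 1, ∀ w : ℂ,
      derivWithin (fun s => G (c s) (planeVelocity c s) w) (Icc 0 1) t =
        (1 / 2) * fderiv ℝ (fun x => G x (planeVelocity c t) (planeVelocity c t)) (c t) w

/-- The length of a curve with respect to the Riemannian metric `G`. -/
def curveLength (G : ℂ → ℂ → ℂ → ℝ) (c : ℝ → ℂ) : ℝ :=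
  ∫ t in (0 : ℝ)..1, √(G (c t) (planeVelocity c t) (planeVelocity c t))

/-- `c` is a geodesic in `U` from `x` to `y`. -/
def IsGeodesicFromTo (U : Set ℂ) (G : ℂ → ℂ → ℂ → ℝ) (x y : ℂ) (c : ℝ → ℂ) : Prop :=
  IsGeodesic U G c ∧ c 0 = x ∧ c 1 = y

/-- `c` is a shortest geodesic in `U` from `x` to `y`. -/
def IsShortestGeodesic (U : Set ℂ) (G : ℂ → ℂ → ℂ → ℝ) (x y : ℂ) (c : ℝ → ℂ) : Prop :=
  IsGeodesicFromTo U G x y c ∧ ∀ c', IsGeodesicFromTo U G x y c' → curveLength G c ≤ curveLength G c'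

/-! ## Conformally euclidean structures -/

variable {M : Type*} [TopologicalSpace M] [ChartedSpace (EuclideanSpace ℝ (Fin 2)) M]
  [IsManifold (𝓡 2) ∞ M]

/-- A conformally euclidean structure on the Riemannian surface `(M, g)`: the universal cover of `M`
realized as an open subset `cover` of the plane, with a smooth covering projection onto `M` which is
conformal for the metric of `M` and the euclidean metric of the plane (equivalently, the inclusion
of `cover`, with the metric induced from `M`, into the plane is conformal). -/
structure ConformallyEuclideanStructure
    (g : ContMDiffRiemannianMetric (𝓡 2) ∞ (EuclideanSpace ℝ (Fin 2))
      (fun x : M => TangentSpace (𝓡 2) x)) where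
  /-- The universal cover, as a subset of the plane. -/
  cover : Set ℂ
  isOpen_cover : IsOpen cover
  simplyConnected : SimplyConnectedSpace cover
  /-- The covering projection; only its values on `cover` matter. -/
  proj : ℂ → M
  contMDiffOn_proj : ContMDiffOn 𝓘(ℝ, ℂ) (𝓡 2) ∞ proj cover
  isCoveringMap_proj : IsCoveringMap (cover.domRestrict proj)
  surjOn_proj : SurjOn proj cover univ
  conformal : ∀ x ∈ cover, ∃ k : ℝ, 0 < k ∧ ∀ v w : ℂ,
    g.inner (proj x) (mfderiv 𝓘(ℝ, ℂ) (𝓡 2) proj x v) (mfderiv 𝓘(ℝ, ℂ) (𝓡 2) proj x w) =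
      k * inner ℝ v w

namespace ConformallyEuclideanStructure

variable {g : ContMDiffRiemannianMetric (𝓡 2) ∞ (EuclideanSpace ℝ (Fin 2))
  (fun x : M => TangentSpace (𝓡 2) x)} (S : ConformallyEuclideanStructure g)

/-- The Riemannian metric on the universal cover induced from that of `M`. -/
def metric (x v w : ℂ) : ℝ :=
  g.inner (S.proj x) (mfderiv 𝓘(ℝ, ℂ) (𝓡 2) S.proj x v) (mfderiv 𝓘(ℝ, ℂ) (𝓡 2) S.proj x w)

/-- Tameness: (1) any two points of the universal cover are joined by a unique shortest geodesic;
(2) for every compact subset `K` of the universal cover there is a regular map (a `C¹` map with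
everywhere injective differential) from the plane into the universal cover which is the identity
on `K`. -/
structure IsTame : Prop where
  existsUnique_shortest : ∀ x ∈ S.cover, ∀ y ∈ S.cover,
    ∃ c, IsShortestGeodesic S.cover S.metric x y c ∧
      ∀ c', IsShortestGeodesic S.cover S.metric x y c' → EqOn c' c (Icc 0 1)
  exists_regularMap : ∀ K : Set ℂ, IsCompact K → K ⊆ S.cover →
    ∃ f : ℂ → ℂ, ContDiff ℝ 1 f ∧ (∀ x, Function.Injective (fderiv ℝ f x)) ∧
      (∀ x, f x ∈ S.cover) ∧ EqOn f id K

/-- `c : [0,1] → cover` is a lift, with initial point `x`, of the curve `γ : [0,1] → M`. -/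
def IsLift (x : ℂ) (γ : ℝ → M) (c : ℝ → ℂ) : Prop :=
  ContinuousOn c (Icc 0 1) ∧ MapsTo c (Icc 0 1) S.cover ∧
    (∀ t ∈ Icc (0 : ℝ) 1, S.proj (c t) = γ t) ∧ c 0 = x

/-- `T` restricts to a deck transformation of the universal cover. -/
def IsDeckTransformation (T : ℂ → ℂ) : Prop :=
  BijOn T S.cover S.cover ∧ ContinuousOn T S.cover ∧ ∀ x ∈ S.cover, S.proj (T x) = S.proj x

/-- Some (in fact, the unique) deck transformation sending `x` to `y` preserves the orientation
of the plane. -/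
def SameOrientation (x y : ℂ) : Prop :=
  ∃ T : ℂ → ℂ, S.IsDeckTransformation T ∧ T x = y ∧ ∀ z ∈ S.cover, 0 < (fderiv ℝ T z).det

/-- Some (in fact, the unique) deck transformation sending `x` to `y` reverses the orientation
of the plane. -/
def OppositeOrientation (x y : ℂ) : Prop :=
  ∃ T : ℂ → ℂ, S.IsDeckTransformation T ∧ T x = y ∧ ∀ z ∈ S.cover, (fderiv ℝ T z).det < 0

/-- `χ` is the external angle of `δ = proj ∘ c` at its base point, where `c` is a geodesic with angle
function `θ`: if `c'` is the lift of `δ` starting at the terminal point of `c`, with angle function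
`θ'`, then `χ ≡ θ' 0 - θ 1` modulo `2π` and `-π < χ < π`. -/
def IsExternalAngle (c : ℝ → ℂ) (θ : ℝ → ℝ) (χ : ℝ) : Prop :=
  ∃ (c' : ℝ → ℂ) (θ' : ℝ → ℝ), S.IsLift (c 1) (fun t => S.proj (c t)) c' ∧ IsAngleFunction c' θ' ∧
    (∃ k : ℤ, χ = θ' 0 - θ 1 + 2 * Real.pi * k) ∧ -Real.pi < χ ∧ χ < Real.pi

variable {p : M}

/-- `w` is the based winding number of the regular closed curve `γ`, with respect to the lift `x` of
the base point. It is an integer if `γ` is orientation preserving (the left summand), and an integer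
modulo `2` if `γ` is orientation reversing (the right summand). Here `c` is the lift of `γ` with
initial point `x`, and `d` is the shortest geodesic from `x` to the terminal point of `c`. -/
inductive IsBasedWindingNumber (x : ℂ) (γ : RegularClosedCurve p) : ℤ ⊕ ZMod 2 → Prop
  | nullHomotopic (n : ℤ) (c : ℝ → ℂ) (θ : ℝ → ℝ)
      (hγ : γ.homotopyClass = 1)
      (hc : S.IsLift x γ.toFun c) (hθ : IsAngleFunction c θ)
      (hn : iIndex θ = n) :
      IsBasedWindingNumber x γ (Sum.inl n)
  | orientationPreserving (n : ℤ) (c d : ℝ → ℂ) (θ η : ℝ → ℝ) (χ : ℝ)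
      (hγ : γ.homotopyClass ≠ 1)
      (hc : S.IsLift x γ.toFun c) (hθ : IsAngleFunction c θ)
      (hε : S.SameOrientation x (c 1))
      (hd : IsShortestGeodesic S.cover S.metric x (c 1) d) (hη : IsAngleFunction d η)
      (hχ : S.IsExternalAngle d η χ)
      (hn : iIndex θ - iIndex η - χ / (2 * Real.pi) = n) :
      IsBasedWindingNumber x γ (Sum.inl n)
  | orientationReversing (n : ℤ) (c d : ℝ → ℂ) (θ η : ℝ → ℝ) (χ : ℝ)
      (hc : S.IsLift x γ.toFun c) (hθ : IsAngleFunction c θ)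
      (hε : S.OppositeOrientation x (c 1))
      (hd : IsShortestGeodesic S.cover S.metric x (c 1) d) (hη : IsAngleFunction d η)
      (hχ : S.IsExternalAngle d η χ)
      (hn : jIndex θ - jIndex η - χ / (2 * Real.pi) = n) :
      IsBasedWindingNumber x γ (Sum.inr (n : ZMod 2))

/-- The based winding number of the regular closed curve `γ`, with respect to the lift `x` of the
base point. -/
def basedWindingNumber (x : ℂ) (γ : RegularClosedCurve p) : ℤ ⊕ ZMod 2 :=
  Classical.epsilon (S.IsBasedWindingNumber x γ)

end ConformallyEuclideanStructure

end BasedWinding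

end

/-! The universal cover embeds in the plane, so a regular closed curve is studied through its lift
`c : [0,1] → ℂ` starting at the chosen point `x` over the base point. Its end point `y` determines
the homotopy class of the curve and a deck transformation `T` with `T x = y`. The curve closes up
with equal directions exactly when `c' 1` is a positive multiple of `dT (c' 0)`. Since `T` is an
isometry of a metric conformal to the euclidean one, `dT` at `x` is `v ↦ a v` or `v ↦ a v̄`
(`IsDeckTransformation.exists_mul`), so on angles the closing condition reads
`θ 1 ≡ α + θ 0` or `θ 1 ≡ α - θ 0` modulo `2π`: the difference, respectively the sum, of the end
angles is constrained to a coset of `2πℤ`.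

*The winding number exists and is unique.* The geodesic `d` from `x` to `y` is a reference curve,
and `T ∘ d` is the lift of its projection which starts at `y`. The angle `χ` from `d' 1` to
`dT (d' 0)` is not `π`: otherwise `T ∘ d` would be `d` run backwards, by the uniqueness of
geodesics, and `T` would fix the midpoint of `d` (`exists_isExternalAngle`). Adding `χ` to the end
angle of `d` gives another solution of the closing condition, so the number in the definition is an
integer. Up to a constant and the factor `2π` it is the difference of the end angles of `c`, or
their sum modulo `4π` (`basedWindingNumber_eq_iff_of_pos`, `basedWindingNumber_eq_iff_of_neg`).

*Invariance.* A regular homotopy lifts to the cover with fixed end points, and has a continuous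
family of angle functions; the integer in the closing condition is constant
(`RegularlyHomotopicFixingBasePoint.invariants`).

*Completeness.* If two curves have equal invariants, their lifts have the same end points, and the
angle functions can be chosen with equal differences, or equal sums, of the end angles. Their convex
combinations then satisfy the closing condition throughout. To keep the displacement
`∫ R exp (i θ)` constant, each arc is first deformed so that its angle makes a full turn forward on
a small interval; a nonnegative speed added there contributes any prescribed complex number to the
integral (`joinedIn_velocityFields_of_hasAngle`). This is a regular homotopy in the plane with fixed
end points and controlled end velocities. A regular map of the plane into the cover that is the
identity on both lifts and near their end points moves it into the cover, from where it
projects to the surface (`regularlyHomotopic_of_joinedIn`). -/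

noncomputable section

namespace BasedWinding

/-! ### Velocity fields of plane arcs and their deformations -/

/-- The velocities of regular plane arcs `[0,1] → ℂ` with displacement `v` whose velocities at the
two ends are related by `B`. A velocity is extended to `ℝ`, where only its values on `[0,1]`
matter; the nonvanishing is required everywhere for convenience. -/
def velocityFields (v : ℂ) (B : ℂ → ℂ → Prop) : Set C(ℝ, ℂ) :=
  {V | (∀ u, V u ≠ 0) ∧ ∫ u in (0 : ℝ)..1, V u = v ∧ B (V 0) (V 1)}

/-- `θ` is a globally continuous angle of the nonvanishing field `V`. -/
def HasAngle (V : C(ℝ, ℂ)) (θ : C(ℝ, ℝ)) : Prop :=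
  ∀ u, V u = ‖V u‖ * Complex.exp (θ u * Complex.I)

lemma joinedIn_velocityFields {v : ℂ} {B : ℂ → ℂ → Prop} {V W : C(ℝ, ℂ)} (H : ℝ → ℝ → ℂ)
    (hH : Continuous fun q : ℝ × ℝ => H q.1 q.2) (h0 : ∀ u, H 0 u = V u) (h1 : ∀ u, H 1 u = W u)
    (hne : ∀ t ∈ Icc (0 : ℝ) 1, ∀ u, H t u ≠ 0)
    (hint : ∀ t ∈ Icc (0 : ℝ) 1, ∫ u in (0 : ℝ)..1, H t u = v)
    (hB : ∀ t ∈ Icc (0 : ℝ) 1, B (H t 0) (H t 1)) :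
    JoinedIn (velocityFields v B) V W := by
  let F : C(ℝ × ℝ, ℂ) := ⟨fun q => H q.1 q.2, hH⟩
  refine JoinedIn.ofLine (f := fun t => F.curry t) F.curry.continuous.continuousOn ?_ ?_ ?_
  · ext u; exact h0 u
  · ext u; exact h1 u
  · rintro _ ⟨t, ht, rfl⟩
    exact ⟨hne t ht, hint t ht, hB t ht⟩

lemma integral_eq_of_zero_off {E : Type*} [NormedAddCommGroup E] [NormedSpace ℝ E]
    {f : ℝ → E} {a b : ℝ} (ha : 0 ≤ a) (hb : b ≤ 1)
    (h : ∀ u, (u ≤ a ∨ b ≤ u) → f u = 0) :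
    ∫ u in (0 : ℝ)..1, f u = ∫ u in a..b, f u := by
  have key : Function.support f ⊆ Ioc a b := fun u hu => by
    by_contra hcon
    rw [mem_Ioc, not_and_or, not_lt, not_le] at hcon
    exact hu (h u (hcon.imp id le_of_lt))
  rw [intervalIntegral.integral_eq_integral_of_support_subset key,
    intervalIntegral.integral_eq_integral_of_support_subset
      (key.trans (Ioc_subset_Ioc ha hb))]

/-- The oscillation of the angle, `π sin (2πτ)` for `τ = (u - 1/2)/δ ∈ [-1/2, 1/2]` and zero
elsewhere. It is odd about `u = 1/2`, and on `τ ∈ [-1/4, 1/4]` it makes a full turn, increasing from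
`-π` to `π`. -/
def wiggle (δ u : ℝ) : ℝ :=
  Real.pi * Real.sin (2 * Real.pi * max (-(1 / 2)) (min (1 / 2) ((u - 1 / 2) / δ)))

/-- The derivative of `wiggle` on its full turn, extended by zero. -/
def wiggleRate (δ u : ℝ) : ℝ :=
  2 * Real.pi ^ 2 / δ * Real.cos (2 * Real.pi * max (-(1 / 4)) (min (1 / 4) ((u - 1 / 2) / δ)))

/-- A bump supported beside the support of `wiggle`, on `δ/2 ≤ u - 1/2 ≤ δ`. -/
def sideBump (δ u : ℝ) : ℝ := max 0 (((u - 1 / 2) / δ - 1 / 2) * (1 - (u - 1 / 2) / δ))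

/-- A bump with value `1` for `|u - 1/2| ≤ δ`, supported in `|u - 1/2| ≤ 2δ`. -/
def plateau (δ u : ℝ) : ℝ := max 0 (min 1 (2 - |(u - 1 / 2) / δ|))

@[fun_prop] lemma continuous_wiggle (δ : ℝ) : Continuous (wiggle δ) := by
  unfold wiggle; fun_prop

@[fun_prop] lemma continuous_wiggleRate (δ : ℝ) : Continuous (wiggleRate δ) := by
  unfold wiggleRate; fun_prop

@[fun_prop] lemma continuous_sideBump (δ : ℝ) : Continuous (sideBump δ) := by
  unfold sideBump; fun_prop

@[fun_prop] lemma continuous_plateau (δ : ℝ) : Continuous (plateau δ) := by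
  unfold plateau; fun_prop

lemma wiggle_eq_zero {δ u : ℝ} (hδ : 0 < δ) (h : δ / 2 ≤ |u - 1 / 2|) : wiggle δ u = 0 := by
  unfold wiggle
  rcases le_abs.1 h with h | h
  · have : 1 / 2 ≤ (u - 1 / 2) / δ := by rw [le_div_iff₀ hδ]; linarith
    rw [min_eq_left this, max_eq_right (by norm_num),
      show 2 * Real.pi * (1 / 2) = Real.pi by ring]
    simp
  · have : (u - 1 / 2) / δ ≤ -(1 / 2) := by rw [div_le_iff₀ hδ]; linarith
    rw [min_eq_right (by linarith), max_eq_left this,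
      show 2 * Real.pi * (-(1 / 2)) = -Real.pi by ring]
    simp

lemma wiggle_eq {δ u : ℝ} (hδ : 0 < δ) (h : |u - 1 / 2| ≤ δ / 2) :
    wiggle δ u = Real.pi * Real.sin (2 * Real.pi * ((u - 1 / 2) / δ)) := by
  obtain ⟨h1, h2⟩ := abs_le.1 h
  unfold wiggle
  rw [min_eq_right (by rw [div_le_iff₀ hδ]; linarith),
    max_eq_right (by rw [le_div_iff₀ hδ]; linarith)]

lemma wiggle_reflect {δ : ℝ} (u : ℝ) : wiggle δ (1 - u) = -wiggle δ u := by
  unfold wiggle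
  rw [← mul_neg, ← Real.sin_neg, ← mul_neg, show (1 - u - 1 / 2) / δ = -((u - 1 / 2) / δ) by ring]
  congr 3
  rw [← neg_neg (min _ (-((u - 1 / 2) / δ))), ← max_neg_neg, neg_neg, ← neg_neg (max (-(1/2)) (-_)),
    ← min_neg_neg, neg_neg, neg_neg, min_max_distrib_left]
  congr 1
  rw [min_eq_right]; norm_num

lemma wiggleRate_nonneg {δ : ℝ} (hδ : 0 < δ) (u : ℝ) : 0 ≤ wiggleRate δ u := by
  unfold wiggleRate
  refine mul_nonneg (by positivity) (Real.cos_nonneg_of_mem_Icc ⟨?_, ?_⟩)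
  · have : -(1 / 4) ≤ max (-(1 / 4)) (min (1 / 4) ((u - 1 / 2) / δ)) := le_max_left _ _
    nlinarith [Real.pi_pos]
  · have : max (-(1 / 4)) (min (1 / 4) ((u - 1 / 2) / δ)) ≤ 1 / 4 :=
      max_le (by norm_num) (min_le_left _ _)
    nlinarith [Real.pi_pos]

lemma wiggleRate_eq_zero {δ u : ℝ} (hδ : 0 < δ) (h : δ / 4 ≤ |u - 1 / 2|) :
    wiggleRate δ u = 0 := by
  unfold wiggleRate
  rcases le_abs.1 h with h | h
  · have : 1 / 4 ≤ (u - 1 / 2) / δ := by rw [le_div_iff₀ hδ]; linarith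
    rw [min_eq_left this, max_eq_right (by norm_num),
      show 2 * Real.pi * (1 / 4) = Real.pi / 2 by ring]
    simp
  · have : (u - 1 / 2) / δ ≤ -(1 / 4) := by rw [div_le_iff₀ hδ]; linarith
    rw [min_eq_right (by linarith), max_eq_left this,
      show 2 * Real.pi * (-(1 / 4)) = -(Real.pi / 2) by ring]
    simp

lemma wiggleRate_eq {δ u : ℝ} (hδ : 0 < δ) (h : |u - 1 / 2| ≤ δ / 4) :
    wiggleRate δ u = 2 * Real.pi ^ 2 / δ * Real.cos (2 * Real.pi * ((u - 1 / 2) / δ)) := by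
  obtain ⟨h1, h2⟩ := abs_le.1 h
  unfold wiggleRate
  rw [min_eq_right (by rw [div_le_iff₀ hδ]; linarith),
    max_eq_right (by rw [le_div_iff₀ hδ]; linarith)]

lemma sideBump_nonneg (δ u : ℝ) : 0 ≤ sideBump δ u := le_max_left _ _

lemma sideBump_eq_zero {δ u : ℝ} (hδ : 0 < δ) (h : u ≤ 1 / 2 + δ / 2 ∨ 1 / 2 + δ ≤ u) :
    sideBump δ u = 0 := by
  unfold sideBump
  refine max_eq_left ?_
  rcases h with h | h
  · have : (u - 1 / 2) / δ ≤ 1 / 2 := by rw [div_le_iff₀ hδ]; linarith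
    exact mul_nonpos_of_nonpos_of_nonneg (by linarith) (by linarith)
  · have : 1 ≤ (u - 1 / 2) / δ := by rw [le_div_iff₀ hδ]; linarith
    exact mul_nonpos_of_nonneg_of_nonpos (by linarith) (by linarith)

lemma integral_sideBump_pos {δ : ℝ} (hδ : 0 < δ) (hδ' : δ ≤ 1 / 4) :
    0 < ∫ u in (0 : ℝ)..1, sideBump δ u := by
  refine intervalIntegral.integral_pos one_pos (by fun_prop) (fun u _ => sideBump_nonneg δ u)
    ⟨1 / 2 + 3 / 4 * δ, ⟨by linarith, by linarith⟩, ?_⟩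
  unfold sideBump
  have : (1 / 2 + 3 / 4 * δ - 1 / 2) / δ = 3 / 4 := by field_simp; ring
  rw [this]; norm_num

lemma plateau_mem (δ u : ℝ) : plateau δ u ∈ Icc (0 : ℝ) 1 :=
  ⟨le_max_left _ _, max_le zero_le_one (min_le_left _ _)⟩

lemma plateau_eq_one {δ u : ℝ} (hδ : 0 < δ) (h : |u - 1 / 2| ≤ δ) : plateau δ u = 1 := by
  unfold plateau
  have : |(u - 1 / 2) / δ| ≤ 1 := by rw [abs_div, abs_of_pos hδ, div_le_one hδ]; exact h
  rw [min_eq_left (by linarith), max_eq_right zero_le_one]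

lemma plateau_eq_zero {δ u : ℝ} (hδ : 0 < δ) (h : 2 * δ ≤ |u - 1 / 2|) : plateau δ u = 0 := by
  unfold plateau
  have : 2 ≤ |(u - 1 / 2) / δ| := by rw [abs_div, abs_of_pos hδ, le_div_iff₀ hδ]; exact h
  exact max_eq_left ((min_le_right _ _).trans (by linarith))

lemma HasAngle.mul {V : C(ℝ, ℂ)} {θ : C(ℝ, ℝ)} (h : HasAngle V θ) {W : C(ℝ, ℂ)} {η : C(ℝ, ℝ)}
    (hW : ∀ u, ∃ r : ℝ, 0 ≤ r ∧ W u = V u * (r * Complex.exp (η u * Complex.I))) :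
    HasAngle W (θ + η) := by
  intro u
  obtain ⟨r, hr, hW⟩ := hW u
  have h1 : ‖W u‖ = ‖V u‖ * r := by
    rw [hW, norm_mul, norm_mul, Complex.norm_exp_ofReal_mul_I, Complex.norm_real,
      Real.norm_of_nonneg hr, mul_one]
  rw [h1, hW]
  conv_lhs => rw [h u]
  simp only [ContinuousMap.add_apply]
  push_cast
  rw [add_mul, Complex.exp_add]
  ring

/-- An arc can be deformed, near its midpoint, to one which contains a segment: the velocity is
replaced by its mean there. The velocities involved stay in a half-plane. -/
lemma exists_joinedIn_straight {v : ℂ} {B : ℂ → ℂ → Prop} {V : C(ℝ, ℂ)} {θ : C(ℝ, ℝ)}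
    (hV : V ∈ velocityFields v B) (hθ : HasAngle V θ) {δ : ℝ} (hδ : 0 < δ) (hδ' : δ ≤ 1 / 4)
    (hJ : ∀ a b, |a - 1 / 2| ≤ 2 * δ → |b - 1 / 2| ≤ 2 * δ →
      0 < (V a * (starRingEnd ℂ) (V b)).re) :
    ∃ (W : C(ℝ, ℂ)) (η : C(ℝ, ℝ)) (C : ℂ), JoinedIn (velocityFields v B) V W ∧ HasAngle W η ∧
      η 0 = θ 0 ∧ η 1 = θ 1 ∧ ∀ u, |u - 1 / 2| ≤ δ → W u = C := by
  obtain ⟨hne, hint, hB⟩ := hV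
  have hm : 0 < ∫ u in (0 : ℝ)..1, plateau δ u :=
    intervalIntegral.integral_pos one_pos (by fun_prop) (fun u _ => (plateau_mem δ u).1)
      ⟨1 / 2, by norm_num, by rw [plateau_eq_one hδ (by simpa using hδ.le)]; exact one_pos⟩
  set m := ∫ u in (0 : ℝ)..1, plateau δ u with hm_def
  set C : ℂ := (∫ u in (0 : ℝ)..1, plateau δ u * V u) / m with hC
  have hmC : (m : ℂ) ≠ 0 := by exact_mod_cast hm.ne'
  have hC_re : ∀ b, |b - 1 / 2| ≤ 2 * δ → 0 < (C * (starRingEnd ℂ) (V b)).re := by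
    intro b hb
    have h1 : (C * (starRingEnd ℂ) (V b)) =
        ((∫ u in (0 : ℝ)..1, plateau δ u * V u * (starRingEnd ℂ) (V b))) / m := by
      rw [intervalIntegral.integral_mul_const, hC]; ring
    have h2 : (∫ u in (0 : ℝ)..1, plateau δ u * V u * (starRingEnd ℂ) (V b)).re =
        ∫ u in (0 : ℝ)..1, plateau δ u * (V u * (starRingEnd ℂ) (V b)).re := by
      rw [← Complex.reCLM_apply, ← ContinuousLinearMap.intervalIntegral_comp_comm]
      · refine intervalIntegral.integral_congr fun u _ => ?_
        simp only [Complex.reCLM_apply, mul_assoc, Complex.re_ofReal_mul]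
      · exact Continuous.intervalIntegrable (by fun_prop) _ _
    rw [h1, Complex.div_ofReal_re, h2]
    refine div_pos (intervalIntegral.integral_pos one_pos (by fun_prop) (fun u _ => ?_)
      ⟨1 / 2, by norm_num, ?_⟩) hm
    · rcases le_total |u - 1 / 2| (2 * δ) with h | h
      · exact mul_nonneg (plateau_mem δ u).1 (hJ u b h hb).le
      · rw [plateau_eq_zero hδ h, zero_mul]
    · rw [plateau_eq_one hδ (by simpa using hδ.le), one_mul]
      exact hJ _ _ (by simpa using hδ.le) hb
  have hQ : ∀ s ∈ Icc (0 : ℝ) 1, ∀ u, 0 < (1 + s * plateau δ u * (C / V u - 1) : ℂ).re := by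
    intro s hs u
    rcases le_total |u - 1 / 2| (2 * δ) with h | h
    · have h1 : 0 < (C / V u).re := by
        rw [div_eq_mul_inv, Complex.inv_def, ← mul_assoc, Complex.re_mul_ofReal]
        exact mul_pos (hC_re u h) (inv_pos.2 (Complex.normSq_pos.2 (hne u)))
      have h2 : (1 + s * plateau δ u * (C / V u - 1) : ℂ).re =
          1 - s * plateau δ u + s * plateau δ u * (C / V u).re := by
        rw [show (1 + s * plateau δ u * (C / V u - 1) : ℂ) =
          1 + ((s * plateau δ u : ℝ) : ℂ) * (C / V u - 1) by push_cast; ring]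
        rw [Complex.add_re, Complex.re_ofReal_mul, Complex.sub_re, Complex.one_re]; ring
      rw [h2]
      obtain ⟨hp0, hp1⟩ := plateau_mem δ u
      have h3 : s * plateau δ u ≤ 1 := mul_le_one₀ hs.2 hp0 hp1
      have h4 : 0 ≤ s * plateau δ u := mul_nonneg hs.1 hp0
      rcases h4.eq_or_lt with h5 | h5
      · rw [← h5]; norm_num
      · have := mul_pos h5 h1
        linarith
    · rw [plateau_eq_zero hδ h]; simp
  let H : ℝ → ℝ → ℂ := fun s u => V u + s * plateau δ u * (C - V u)
  have hHQ : ∀ s u, H s u = V u * (1 + s * plateau δ u * (C / V u - 1)) := fun s u => by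
    have := hne u
    simp only [H]; field_simp
  have hends : ∀ s, H s 0 = V 0 ∧ H s 1 = V 1 := fun s => by
    constructor <;> simp only [H] <;> rw [plateau_eq_zero hδ] <;> norm_num <;> linarith
  have hQc : Continuous fun u => (1 + (1 : ℝ) * plateau δ u * (C / V u - 1) : ℂ) := by
    have : Continuous fun u => C / V u := continuous_const.div V.continuous hne
    fun_prop
  let η : C(ℝ, ℝ) := θ + ⟨fun u => Complex.arg (1 + (1 : ℝ) * plateau δ u * (C / V u - 1)),
    continuous_iff_continuousAt.2 fun u => (Complex.continuousAt_arg
      (Or.inl (hQ 1 (by simp) u))).comp (f := fun u => (1 + (1 : ℝ) * plateau δ u * (C / V u - 1) : ℂ))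
        hQc.continuousAt⟩
  refine ⟨⟨H 1, by simp only [H]; fun_prop⟩, η, C, joinedIn_velocityFields H (by simp only [H]; fun_prop)
    (fun u => by simp [H]) (fun u => rfl) ?_ ?_ ?_, ?_, ?_, ?_, ?_⟩
  · intro s hs u
    rw [hHQ]
    refine mul_ne_zero (hne u) fun h => ?_
    have := hQ s hs u
    rw [h] at this; simp at this
  · intro s hs
    have e1 : ∀ u, H s u = V u + s * (plateau δ u * C - plateau δ u * V u) := fun u => by
      simp only [H]; ring
    simp_rw [e1]
    rw [intervalIntegral.integral_add, intervalIntegral.integral_const_mul,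
      intervalIntegral.integral_sub, intervalIntegral.integral_mul_const,
      intervalIntegral.integral_ofReal, ← hm_def, hC, hint, mul_div_cancel₀ _ hmC]
    · ring
    all_goals exact Continuous.intervalIntegrable (by fun_prop) _ _
  · intro s _
    rw [(hends s).1, (hends s).2]; exact hB
  · refine hθ.mul fun u => ⟨_, norm_nonneg (1 + (1 : ℝ) * plateau δ u * (C / V u - 1) : ℂ), ?_⟩
    simp only [ContinuousMap.coe_mk, hHQ]
    rw [Complex.norm_mul_exp_arg_mul_I]
  · simp only [η, ContinuousMap.add_apply, ContinuousMap.coe_mk]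
    rw [plateau_eq_zero hδ]
    · simp
    · norm_num; linarith
  · simp only [η, ContinuousMap.add_apply, ContinuousMap.coe_mk]
    rw [plateau_eq_zero hδ]
    · simp
    · norm_num; linarith
  · intro u hu
    simp [H, plateau_eq_one hδ hu]

/-- A segment can be deformed to an arc whose angle oscillates as `wiggle`. By symmetry the
displacement stays parallel to the segment, and it is kept constant by lengthening the part of the
segment beside the oscillation. -/
lemma exists_joinedIn_wiggle {v : ℂ} {B : ℂ → ℂ → Prop} {V : C(ℝ, ℂ)} {θ : C(ℝ, ℝ)}
    (hV : V ∈ velocityFields v B) (hθ : HasAngle V θ) {δ : ℝ} (hδ : 0 < δ) (hδ' : δ ≤ 1 / 4) {C : ℂ}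
    (hC : ∀ u, |u - 1 / 2| ≤ δ → V u = C) :
    ∃ (W : C(ℝ, ℂ)) (η : C(ℝ, ℝ)), JoinedIn (velocityFields v B) V W ∧ HasAngle W η ∧
      ∀ u, η u = θ u + wiggle δ u := by
  obtain ⟨hne, hint, hB⟩ := hV
  set m := ∫ u in (0 : ℝ)..1, sideBump δ u with hm_def
  have hm : 0 < m := integral_sideBump_pos hδ hδ'
  let κ : ℝ → ℝ := fun s => (∫ u in (0 : ℝ)..1, (1 - Real.cos (s * wiggle δ u))) / m
  have hκc : Continuous κ := by
    refine Continuous.div_const ?_ _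
    exact intervalIntegral.continuous_parametric_intervalIntegral_of_continuous'
      (f := fun s u => 1 - Real.cos (s * wiggle δ u)) (by unfold Function.uncurry; fun_prop) 0 1
  have hκ0 : ∀ s, 0 ≤ κ s := fun s => div_nonneg (intervalIntegral.integral_nonneg zero_le_one
    fun u _ => sub_nonneg.2 (Real.cos_le_one _)) hm.le
  let H : ℝ → ℝ → ℂ := fun s u =>
    V u * ((1 + κ s * sideBump δ u : ℝ) * Complex.exp ((s * wiggle δ u : ℝ) * Complex.I))
  have hends : ∀ s, H s 0 = V 0 ∧ H s 1 = V 1 := fun s => by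
    constructor <;> simp only [H] <;> rw [sideBump_eq_zero hδ, wiggle_eq_zero hδ] <;> norm_num <;>
      first | linarith | (left; linarith) | (right; linarith)
  have hpos : ∀ s u, 0 < 1 + κ s * sideBump δ u := fun s u =>
    add_pos_of_pos_of_nonneg one_pos (mul_nonneg (hκ0 s) (sideBump_nonneg δ u))
  have hsin : ∀ s, ∫ u in (0 : ℝ)..1, Real.sin (s * wiggle δ u) = 0 := fun s => by
    have h1 := intervalIntegral.integral_comp_sub_left (a := 0) (b := 1)
      (fun u => Real.sin (s * wiggle δ u)) 1
    simp only [wiggle_reflect, mul_neg, Real.sin_neg, intervalIntegral.integral_neg, sub_self,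
      sub_zero] at h1
    linarith
  refine ⟨⟨H 1, by simp only [H]; fun_prop⟩, θ + ⟨wiggle δ, by fun_prop⟩,
    joinedIn_velocityFields H (by simp only [H]; fun_prop) (fun u => ?_) (fun u => rfl) ?_ ?_ ?_,
    hθ.mul fun u => ⟨_, (hpos 1 u).le, ?_⟩, fun u => rfl⟩
  · have : κ 0 = 0 := by simp [κ]
    simp [H, this]
  · intro s _ u
    exact mul_ne_zero (hne u) (mul_ne_zero (by exact_mod_cast (hpos s u).ne') (Complex.exp_ne_zero _))
  · intro s _
    have e1 : ∀ u, H s u = V u + C * ((((Real.cos (s * wiggle δ u) - 1) + κ s * sideBump δ u : ℝ) : ℂ)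
        + ((Real.sin (s * wiggle δ u) : ℝ) : ℂ) * Complex.I) := fun u => by
      simp only [H]
      rcases le_total |u - 1 / 2| δ with h | h
      · rcases le_total |u - 1 / 2| (δ / 2) with h2 | h2
        · rw [sideBump_eq_zero hδ (Or.inl (by linarith [(abs_le.1 h2).2])), hC u h,
            Complex.exp_mul_I]
          push_cast; ring
        · rw [wiggle_eq_zero hδ h2, hC u h]
          simp; ring
      · rw [wiggle_eq_zero hδ (by linarith), sideBump_eq_zero hδ]
        · simp
        · rcases le_abs.1 h with h | h
          · right; linarith
          · left; linarith
    simp_rw [e1]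
    rw [intervalIntegral.integral_add, intervalIntegral.integral_const_mul,
      intervalIntegral.integral_add, intervalIntegral.integral_mul_const,
      intervalIntegral.integral_ofReal, intervalIntegral.integral_ofReal, hsin,
      intervalIntegral.integral_add, intervalIntegral.integral_const_mul, ← hm_def, hint]
    · have : κ s * m = - ∫ u in (0 : ℝ)..1, (Real.cos (s * wiggle δ u) - 1) := by
        rw [← intervalIntegral.integral_neg]
        simp only [κ, neg_sub]
        exact div_mul_cancel₀ _ hm.ne'
      rw [this]; simp
    all_goals exact Continuous.intervalIntegrable (by fun_prop) _ _
  · intro s _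
    rw [(hends s).1, (hends s).2]; exact hB
  · simp [H]

/-- Every complex number is the integral of the unit vectors with angle `wiggle` against a
nonnegative speed that depends continuously on the number and is supported on the full turn. -/
lemma integral_wiggle_turn {δ : ℝ} (hδ : 0 < δ) (hδ' : δ ≤ 1 / 4) (z : ℂ) :
    ∫ u in (0 : ℝ)..1, ((‖z‖ + ((starRingEnd ℂ) z * Complex.exp (wiggle δ u * Complex.I)).re) / Real.pi
      * wiggleRate δ u : ℝ) * Complex.exp (wiggle δ u * Complex.I) = z := by
  rw [integral_eq_of_zero_off (a := 1 / 2 - δ / 4) (b := 1 / 2 + δ / 4) (by linarith) (by linarith)]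
  swap
  · intro u hu
    rw [wiggleRate_eq_zero hδ]
    · simp
    · rcases hu with hu | hu
      · exact le_abs.2 (Or.inr (by linarith))
      · exact le_abs.2 (Or.inl (by linarith))
  -- the primitive `F ∘ φ`, with `F' y = (‖z‖ + Re (z̄ exp (iy))) exp (iy) / π`
  let φ : ℝ → ℝ := fun u => Real.pi * Real.sin (2 * Real.pi * ((u - 1 / 2) / δ))
  let F : ℝ → ℂ := fun y => (‖z‖ * (Complex.exp (y * Complex.I) / Complex.I) + z / 2 * y +
    (starRingEnd ℂ) z / 2 * (Complex.exp (2 * (y * Complex.I)) / (2 * Complex.I))) / Real.pi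
  have hφ : ∀ u, HasDerivAt φ (2 * Real.pi ^ 2 / δ * Real.cos (2 * Real.pi * ((u - 1 / 2) / δ))) u := by
    intro u
    have h1 : HasDerivAt (fun u : ℝ => 2 * Real.pi * ((u - 1 / 2) / δ)) (2 * Real.pi * (1 / δ)) u :=
      (((hasDerivAt_id u).sub_const _).div_const _).const_mul _
    convert! (h1.sin.const_mul Real.pi) using 1
    ring
  have hF : ∀ y : ℝ, HasDerivAt F ((‖z‖ + ((starRingEnd ℂ) z * Complex.exp (y * Complex.I)).re) / Real.pi
      * Complex.exp (y * Complex.I)) y := by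
    intro y
    have h0 : HasDerivAt (fun y : ℝ => (y : ℂ)) 1 y := Complex.ofRealCLM.hasDerivAt
    have h1 : HasDerivAt (fun y : ℝ => (y : ℂ) * Complex.I) (1 * Complex.I) y := h0.mul_const _
    have h2 := ((((h1.cexp.div_const Complex.I).const_mul (‖z‖ : ℂ)).add (h0.const_mul (z / 2))).add
      (((h1.const_mul 2).cexp.div_const (2 * Complex.I)).const_mul ((starRingEnd ℂ) z / 2))).div_const
        (Real.pi : ℂ)
    convert! h2 using 1
    have hre : ((((starRingEnd ℂ) z * Complex.exp (y * Complex.I)).re : ℝ) : ℂ) =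
        ((starRingEnd ℂ) z * Complex.exp (y * Complex.I) + z * Complex.exp (-(y * Complex.I))) / 2 := by
      rw [Complex.re_eq_add_conj, map_mul, Complex.conj_conj, ← Complex.exp_conj, map_mul,
        Complex.conj_I, Complex.conj_ofReal, mul_neg]
    have hpi : (Real.pi : ℂ) ≠ 0 := by exact_mod_cast Real.pi_ne_zero
    have hI := Complex.I_ne_zero
    rw [hre, two_mul, Complex.exp_add, Complex.exp_neg]
    have := Complex.exp_ne_zero (y * Complex.I)
    field_simp
    ring
  have key : ∀ u ∈ uIcc (1 / 2 - δ / 4) (1 / 2 + δ / 4), HasDerivAt (F ∘ φ)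
      (((‖z‖ + ((starRingEnd ℂ) z * Complex.exp (wiggle δ u * Complex.I)).re) / Real.pi
      * wiggleRate δ u : ℝ) * Complex.exp (wiggle δ u * Complex.I)) u := by
    intro u hu
    rw [uIcc_of_le (by linarith)] at hu
    have hu' : |u - 1 / 2| ≤ δ / 4 := abs_le.2 ⟨by linarith [hu.1], by linarith [hu.2]⟩
    rw [wiggle_eq hδ (by linarith), wiggleRate_eq hδ hu']
    convert! (hF (φ u)).scomp u (hφ u) using 1
    simp only [φ]
    push_cast [Complex.real_smul]
    ring
  rw [intervalIntegral.integral_eq_sub_of_hasDerivAt key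
    (Continuous.intervalIntegrable (by fun_prop) _ _)]
  have e1 : φ (1 / 2 + δ / 4) = Real.pi := by
    simp only [φ]
    rw [show 2 * Real.pi * ((1 / 2 + δ / 4 - 1 / 2) / δ) = Real.pi / 2 by field_simp; ring]
    simp
  have e2 : φ (1 / 2 - δ / 4) = -Real.pi := by
    simp only [φ]
    rw [show 2 * Real.pi * ((1 / 2 - δ / 4 - 1 / 2) / δ) = -(Real.pi / 2) by field_simp; ring]
    simp
  have hpi : (Real.pi : ℂ) ≠ 0 := by exact_mod_cast Real.pi_ne_zero
  simp only [Function.comp, e1, e2, F]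
  push_cast
  rw [show 2 * (-(Real.pi : ℂ) * Complex.I) = -(2 * Real.pi * Complex.I) by ring,
    show 2 * ((Real.pi : ℂ) * Complex.I) = 2 * Real.pi * Complex.I by ring, neg_mul,
    Complex.exp_neg, Complex.exp_neg, Complex.exp_two_pi_mul_I, Complex.exp_pi_mul_I]
  field_simp
  ring

/-- Two arcs whose angles oscillate as `wiggle` near the midpoint are joined by interpolating the
angles: the velocities make a full turn there, so that the displacement can be corrected by a
positive change of speed. -/
lemma joinedIn_of_wiggle {v : ℂ} {B : ℂ → ℂ → Prop} {V₁ V₂ : C(ℝ, ℂ)} {θ₁ θ₂ : C(ℝ, ℝ)}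
    (hV₁ : V₁ ∈ velocityFields v B) (hV₂ : V₂ ∈ velocityFields v B)
    (hθ₁ : HasAngle V₁ θ₁) (hθ₂ : HasAngle V₂ θ₂) {δ : ℝ} (hδ : 0 < δ) (hδ' : δ ≤ 1 / 4)
    {ψ₁ ψ₂ : ℝ} (hψ₁ : ∀ u, |u - 1 / 2| ≤ δ → θ₁ u = ψ₁ + wiggle δ u)
    (hψ₂ : ∀ u, |u - 1 / 2| ≤ δ → θ₂ u = ψ₂ + wiggle δ u)
    (hB : ∀ t ∈ Icc (0 : ℝ) 1, ∀ r s : ℝ, 0 < r → 0 < s →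
      B (r * Complex.exp (((1 - t) * θ₁ 0 + t * θ₂ 0 : ℝ) * Complex.I))
        (s * Complex.exp (((1 - t) * θ₁ 1 + t * θ₂ 1 : ℝ) * Complex.I))) :
    JoinedIn (velocityFields v B) V₁ V₂ := by
  let Θ : ℝ → ℝ → ℝ := fun t u => (1 - t) * θ₁ u + t * θ₂ u
  let R : ℝ → ℝ → ℝ := fun t u => (1 - t) * ‖V₁ u‖ + t * ‖V₂ u‖
  -- the defect of the displacement when angles and speeds are interpolated
  let e : ℝ → ℂ := fun t => v - ∫ u in (0 : ℝ)..1, R t u * Complex.exp (Θ t u * Complex.I)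
  have hec : Continuous e := by
    refine continuous_const.sub ?_
    exact intervalIntegral.continuous_parametric_intervalIntegral_of_continuous'
      (f := fun t u => (R t u * Complex.exp (Θ t u * Complex.I) : ℂ))
      (by simp only [R, Θ]; fun_prop) 0 1
  let z : ℝ → ℂ := fun t => e t * Complex.exp (-(((1 - t) * ψ₁ + t * ψ₂ : ℝ) * Complex.I))
  have hzc : Continuous z := by simp only [z]; fun_prop
  -- the additional speed on the full turn which makes up for the defect
  let ρ : ℝ → ℝ → ℝ := fun t u => (‖z t‖ + ((starRingEnd ℂ) (z t) *
    Complex.exp (wiggle δ u * Complex.I)).re) / Real.pi * wiggleRate δ u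
  have hρ : ∀ t u, 0 ≤ ρ t u := fun t u => by
    refine mul_nonneg (div_nonneg ?_ Real.pi_pos.le) (wiggleRate_nonneg hδ u)
    have h1 := (abs_le.1 (Complex.abs_re_le_norm ((starRingEnd ℂ) (z t) *
      Complex.exp (wiggle δ u * Complex.I)))).1
    rw [norm_mul, Complex.norm_exp_ofReal_mul_I, RCLike.norm_conj] at h1
    linarith
  have hR : ∀ t ∈ Icc (0 : ℝ) 1, ∀ u, 0 < R t u := fun t ht u => by
    have h1 := norm_pos_iff.2 (hV₁.1 u)
    have h2 := norm_pos_iff.2 (hV₂.1 u)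
    simp only [R]
    rcases ht.1.eq_or_lt with h | h
    · rw [← h]; simpa using h1
    · have := mul_pos h h2
      have := mul_nonneg (sub_nonneg.2 ht.2) h1.le
      linarith
  let H : ℝ → ℝ → ℂ := fun t u => ((R t u + ρ t u : ℝ) : ℂ) * Complex.exp (Θ t u * Complex.I)
  have hpos : ∀ t ∈ Icc (0 : ℝ) 1, ∀ u, 0 < R t u + ρ t u := fun t ht u =>
    add_pos_of_pos_of_nonneg (hR t ht u) (hρ t u)
  have he0 : z 0 = 0 := by
    have : ∀ u, (R 0 u : ℂ) * Complex.exp (Θ 0 u * Complex.I) = V₁ u := fun u => by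
      simp only [R, Θ]; simp; rw [← hθ₁ u]
    simp only [z, e, this]
    rw [hV₁.2.1, sub_self, zero_mul]
  have he1 : z 1 = 0 := by
    have : ∀ u, (R 1 u : ℂ) * Complex.exp (Θ 1 u * Complex.I) = V₂ u := fun u => by
      simp only [R, Θ]; simp; rw [← hθ₂ u]
    simp only [z, e, this]
    rw [hV₂.2.1, sub_self, zero_mul]
  refine joinedIn_velocityFields H ?_ ?_ ?_ ?_ ?_ ?_
  · simp only [H, R, ρ, Θ]
    fun_prop
  · intro u
    simp only [H, ρ, he0, R, Θ]
    simp; rw [← hθ₁ u]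
  · intro u
    simp only [H, ρ, he1, R, Θ]
    simp; rw [← hθ₂ u]
  · intro t ht u
    exact mul_ne_zero (by exact_mod_cast (hpos t ht u).ne') (Complex.exp_ne_zero _)
  · intro t ht
    have e1 : ∀ u, H t u = R t u * Complex.exp (Θ t u * Complex.I) +
        Complex.exp (((1 - t) * ψ₁ + t * ψ₂ : ℝ) * Complex.I) *
          ((ρ t u : ℝ) * Complex.exp (wiggle δ u * Complex.I)) := fun u => by
      simp only [H]
      push_cast
      rw [add_mul]
      congr 1
      rcases le_total |u - 1 / 2| δ with h | h
      · simp only [Θ, hψ₁ u h, hψ₂ u h]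
        rw [mul_left_comm, ← Complex.exp_add]
        congr 2
        push_cast; ring
      · have : ρ t u = 0 := by
          simp only [ρ]; rw [wiggleRate_eq_zero hδ (by linarith), mul_zero]
        rw [this]; simp
    simp_rw [e1]
    rw [intervalIntegral.integral_add, intervalIntegral.integral_const_mul]
    · simp only [ρ]
      rw [integral_wiggle_turn hδ hδ' (z t)]
      simp only [z]
      rw [mul_left_comm, ← Complex.exp_add, add_neg_cancel, Complex.exp_zero, mul_one]
      simp only [e]
      ring
    · exact Continuous.intervalIntegrable (by simp only [R, Θ]; fun_prop) _ _
    · exact Continuous.intervalIntegrable (by simp only [ρ]; fun_prop) _ _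
  · intro t ht
    exact hB t ht _ _ (hpos t ht 0) (hpos t ht 1)

/-- Continuous functions with the same values of `exp (i ·)` on a connected set differ there by a
constant multiple of `2π`. -/
lemma exists_int_of_exp_eq {X : Type*} [TopologicalSpace X] {s : Set X} (hs : IsPreconnected s)
    {f g : X → ℝ} (hf : ContinuousOn f s) (hg : ContinuousOn g s)
    (h : ∀ x ∈ s, Complex.exp (f x * Complex.I) = Complex.exp (g x * Complex.I)) :
    ∃ k : ℤ, ∀ x ∈ s, f x = g x + 2 * Real.pi * k := by
  have : DiscreteTopology (range ((↑) : ℤ → ℝ)) :=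
    Int.isClosedEmbedding_coe_real.isEmbedding.toHomeomorph.symm.isEmbedding.discreteTopology
  have key : ∀ x ∈ s, ∃ n : ℤ, f x = g x + 2 * Real.pi * n := fun x hx => by
    obtain ⟨n, hn⟩ := Complex.exp_eq_exp_iff_exists_int.1 (h x hx)
    refine ⟨n, ?_⟩
    have h1 : ((f x : ℂ) - (g x + 2 * Real.pi * n)) * Complex.I = 0 := by
      rw [sub_mul, hn]; ring
    have h2 := (mul_eq_zero.1 h1).resolve_right Complex.I_ne_zero
    exact_mod_cast sub_eq_zero.1 h2
  obtain ⟨y, ⟨k, rfl⟩, hk⟩ := hs.eqOn_const_of_mapsTo (T := range ((↑) : ℤ → ℝ))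
    (f := fun x => (f x - g x) / (2 * Real.pi)) ⟨this⟩ ((hf.sub hg).div_const _)
    (fun x hx => by
      obtain ⟨n, hn⟩ := key x hx
      refine ⟨n, ?_⟩
      have := Real.pi_ne_zero
      simp only [hn]; field_simp; ring) ⟨0, 0, by simp⟩
  refine ⟨k, fun x hx => ?_⟩
  have h1 := hk hx
  have := Real.pi_ne_zero
  simp only [Function.const_apply] at h1
  field_simp at h1
  linarith

/-- On a small interval about `1/2` the values of `V` are pairwise at an acute angle. -/
lemma exists_half_plane (V : C(ℝ, ℂ)) (hne : ∀ u, V u ≠ 0) :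
    ∃ r > 0, ∀ δ < r, ∀ a b, |a - 1 / 2| ≤ 2 * δ → |b - 1 / 2| ≤ 2 * δ →
      0 < (V a * (starRingEnd ℂ) (V b)).re := by
  have hc : Continuous fun q : ℝ × ℝ => (V q.1 * (starRingEnd ℂ) (V q.2)).re := by fun_prop
  have h0 : 0 < (V (1 / 2) * (starRingEnd ℂ) (V (1 / 2))).re := by
    rw [Complex.mul_conj, Complex.ofReal_re]; exact Complex.normSq_pos.2 (hne _)
  obtain ⟨r, hr, h⟩ := Metric.mem_nhds_iff.1
    ((hc.tendsto (1 / 2, 1 / 2)).eventually (lt_mem_nhds h0))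
  refine ⟨r / 2, by positivity, fun δ hδ a b ha hb => @h (a, b) ?_⟩
  rw [mem_ball_iff_norm, Prod.norm_def]
  exact max_lt (lt_of_le_of_lt ha (by linarith)) (lt_of_le_of_lt hb (by linarith))

/-- Two arcs with the same displacement can be deformed to one another, keeping the displacement, if
the relation imposed on the end velocities holds during linear interpolation of the end angles. -/
theorem joinedIn_velocityFields_of_hasAngle {v : ℂ} {B : ℂ → ℂ → Prop} {V₁ V₂ : C(ℝ, ℂ)}
    {θ₁ θ₂ : C(ℝ, ℝ)} (hV₁ : V₁ ∈ velocityFields v B) (hV₂ : V₂ ∈ velocityFields v B)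
    (hθ₁ : HasAngle V₁ θ₁) (hθ₂ : HasAngle V₂ θ₂)
    (hB : ∀ t ∈ Icc (0 : ℝ) 1, ∀ r s : ℝ, 0 < r → 0 < s →
      B (r * Complex.exp (((1 - t) * θ₁ 0 + t * θ₂ 0 : ℝ) * Complex.I))
        (s * Complex.exp (((1 - t) * θ₁ 1 + t * θ₂ 1 : ℝ) * Complex.I))) :
    JoinedIn (velocityFields v B) V₁ V₂ := by
  obtain ⟨r₁, hr₁, h₁⟩ := exists_half_plane V₁ hV₁.1
  obtain ⟨r₂, hr₂, h₂⟩ := exists_half_plane V₂ hV₂.1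
  let δ := min (1 / 4) (min (r₁ / 2) (r₂ / 2))
  have hδ : 0 < δ := by positivity
  have hδ' : δ ≤ 1 / 4 := min_le_left _ _
  have hδ₁ : δ < r₁ := lt_of_le_of_lt ((min_le_right _ _).trans (min_le_left _ _)) (by linarith)
  have hδ₂ : δ < r₂ := lt_of_le_of_lt ((min_le_right _ _).trans (min_le_right _ _)) (by linarith)
  have main : ∀ {V : C(ℝ, ℂ)} {θ : C(ℝ, ℝ)}, V ∈ velocityFields v B → HasAngle V θ →
      (∀ a b, |a - 1 / 2| ≤ 2 * δ → |b - 1 / 2| ≤ 2 * δ →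
        0 < (V a * (starRingEnd ℂ) (V b)).re) →
      ∃ (W : C(ℝ, ℂ)) (η : C(ℝ, ℝ)) (ψ : ℝ), JoinedIn (velocityFields v B) V W ∧ HasAngle W η ∧
        η 0 = θ 0 ∧ η 1 = θ 1 ∧ ∀ u, |u - 1 / 2| ≤ δ → η u = ψ + wiggle δ u := by
    intro V θ hV hθ hJ
    obtain ⟨W, η, C, hVW, hη, h0, h1, hC⟩ := exists_joinedIn_straight hV hθ hδ hδ' hJ
    obtain ⟨X, ξ, hWX, hξ, hξη⟩ := exists_joinedIn_wiggle hVW.target_mem hη hδ hδ' hC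
    obtain ⟨k, hk⟩ := exists_int_of_exp_eq (s := Icc (1 / 2 - δ) (1 / 2 + δ)) isPreconnected_Icc
      (f := η) (g := fun _ => η (1 / 2)) (by fun_prop) (by fun_prop) (fun u hu => by
        have e1 := hη u
        have e2 := hη (1 / 2)
        have hW : W u = W (1 / 2) := by
          rw [hC u (abs_le.2 ⟨by linarith [hu.1], by linarith [hu.2]⟩),
            hC (1 / 2) (by simpa using hδ.le)]
        have hn : (‖W (1 / 2)‖ : ℂ) ≠ 0 := by
          exact_mod_cast (norm_pos_iff.2 (hVW.target_mem.1 _)).ne'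
        rw [hW] at e1
        exact (mul_left_cancel₀ hn (e2.symm.trans e1)).symm)
    refine ⟨X, ξ, η (1 / 2) + 2 * Real.pi * k, hVW.trans hWX, hξ, ?_, ?_, fun u hu => ?_⟩
    · rw [hξη, wiggle_eq_zero hδ, h0, add_zero]
      norm_num; linarith
    · rw [hξη, wiggle_eq_zero hδ, h1, add_zero]
      norm_num; linarith
    · rw [hξη, hk u ⟨by linarith [(abs_le.1 hu).1], by linarith [(abs_le.1 hu).2]⟩]
  obtain ⟨W₁, η₁, ψ₁, hj₁, ha₁, h01, h11, hw₁⟩ := main hV₁ hθ₁ (h₁ δ hδ₁)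
  obtain ⟨W₂, η₂, ψ₂, hj₂, ha₂, h02, h12, hw₂⟩ := main hV₂ hθ₂ (h₂ δ hδ₂)
  refine hj₁.trans (JoinedIn.trans ?_ hj₂.symm)
  refine joinedIn_of_wiggle hj₁.target_mem hj₂.target_mem ha₁ ha₂ hδ hδ' hw₁ hw₂ ?_
  rwa [h01, h11, h02, h12]

/-! ### Angle functions -/

lemma exists_continuous_angle {A : Type*} [TopologicalSpace A] [SimplyConnectedSpace A]
    [LocallyPathConnectedSpace A] (V : C(A, ℂ)) (hV : ∀ a, V a ≠ 0) :
    ∃ θ : C(A, ℝ), ∀ a, V a = ‖V a‖ * Complex.exp (θ a * Complex.I) := by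
  have hn : ∀ a, (‖V a‖ : ℂ) ≠ 0 := fun a => by exact_mod_cast (norm_pos_iff.2 (hV a)).ne'
  have hmem : ∀ a, V a / ‖V a‖ ∈ Submonoid.unitSphere ℂ := fun a => by
    show V a / ‖V a‖ ∈ Metric.sphere (0 : ℂ) 1
    rw [mem_sphere_zero_iff_norm, norm_div, Complex.norm_real, norm_norm,
      div_self (norm_ne_zero_iff.2 (hV a))]
  let f : C(A, Circle) := ⟨fun a => ⟨V a / ‖V a‖, hmem a⟩,
    Continuous.subtype_mk (V.continuous.div (by fun_prop) hn) hmem⟩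
  obtain ⟨a₀⟩ : Nonempty A := inferInstance
  obtain ⟨x₀, hx₀⟩ := Circle.exp_surjective (f a₀)
  obtain ⟨θ, ⟨-, hθ⟩, -⟩ := Circle.isCoveringMap_exp.existsUnique_continuousMap_lifts f a₀ x₀ hx₀
  refine ⟨θ, fun a => ?_⟩
  have h1 := congrArg (fun z : Circle => (z : ℂ)) (congrFun hθ a)
  simp only [Function.comp_apply, Circle.coe_exp] at h1
  rw [h1]
  exact (mul_div_cancel₀ (V a) (hn a)).symm

lemma div_norm_eq_exp_iff {z : ℂ} (hz : z ≠ 0) {t : ℝ} :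
    z / ‖z‖ = Complex.exp (t * Complex.I) ↔ z = ‖z‖ * Complex.exp (t * Complex.I) := by
  rw [div_eq_iff (by exact_mod_cast (norm_pos_iff.2 hz).ne'), mul_comm]

/-- The extension of a function on `[0,1]` to `ℝ` which is constant on both sides. -/
def extendUnit {E : Type*} (f : ℝ → E) (u : ℝ) : E := f (projIcc 0 1 zero_le_one u)

lemma extendUnit_eq {E : Type*} {f : ℝ → E} {u : ℝ} (hu : u ∈ Icc (0 : ℝ) 1) :
    extendUnit f u = f u := by
  rw [extendUnit, projIcc_of_mem _ hu]

lemma continuous_extendUnit {E : Type*} [TopologicalSpace E] {f : ℝ → E}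
    (hf : ContinuousOn f (Icc 0 1)) : Continuous (extendUnit f) :=
  hf.comp_continuous (continuous_subtype_val.comp continuous_projIcc) fun u =>
    (projIcc (0 : ℝ) 1 zero_le_one u).2

lemma exists_isAngleFunction {c : ℝ → ℂ} (hc : ContinuousOn (planeVelocity c) (Icc 0 1))
    (h0 : ∀ u ∈ Icc (0 : ℝ) 1, planeVelocity c u ≠ 0) : ∃ θ, IsAngleFunction c θ := by
  obtain ⟨θ, hθ⟩ := exists_continuous_angle ⟨_, continuous_extendUnit hc⟩
    (fun u => h0 _ (projIcc (0 : ℝ) 1 zero_le_one u).2)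
  refine ⟨θ, θ.continuous.continuousOn, fun u hu => ?_⟩
  have := hθ u
  simp only [ContinuousMap.coe_mk, extendUnit_eq hu] at this
  exact (div_norm_eq_exp_iff (h0 u hu)).2 this

lemma IsAngleFunction.exists_int {c c' : ℝ → ℂ} {θ θ' : ℝ → ℝ} (h : IsAngleFunction c θ)
    (h' : IsAngleFunction c' θ') (hcc : EqOn c c' (Icc 0 1)) :
    ∃ k : ℤ, ∀ u ∈ Icc (0 : ℝ) 1, θ u = θ' u + 2 * Real.pi * k := by
  refine exists_int_of_exp_eq isPreconnected_Icc h.1 h'.1 fun u hu => ?_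
  rw [← h.2 u hu, ← h'.2 u hu, planeDirection, planeDirection, planeVelocity, planeVelocity,
    derivWithin_congr hcc (hcc hu)]

lemma planeVelocity_congr {c c' : ℝ → ℂ} (hcc : EqOn c c' (Icc 0 1)) {u : ℝ}
    (hu : u ∈ Icc (0 : ℝ) 1) : planeVelocity c u = planeVelocity c' u :=
  derivWithin_congr hcc (hcc hu)

/-- An angle function of a curve gives the polar form of its velocity. In particular the velocity
does not vanish, as `planeDirection` would be zero there. -/
lemma IsAngleFunction.planeVelocity_eq {c : ℝ → ℂ} {θ : ℝ → ℝ} (h : IsAngleFunction c θ) {u : ℝ}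
    (hu : u ∈ Icc (0 : ℝ) 1) :
    ∃ r : ℝ, 0 < r ∧ planeVelocity c u = r * Complex.exp (θ u * Complex.I) := by
  have h1 := h.2 u hu
  have hv : planeVelocity c u ≠ 0 := fun h0 => by
    rw [planeDirection, h0, zero_div] at h1
    exact Complex.exp_ne_zero _ h1.symm
  exact ⟨_, norm_pos_iff.2 hv, (div_norm_eq_exp_iff hv).1 h1⟩

lemma exp_eq_of_pos_mul_eq {r s a b : ℝ} (hr : 0 < r) (hs : 0 < s)
    (h : (r : ℂ) * Complex.exp (a * Complex.I) = s * Complex.exp (b * Complex.I)) :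
    Complex.exp (a * Complex.I) = Complex.exp (b * Complex.I) := by
  have h1 := congrArg norm h
  rw [norm_mul, norm_mul, Complex.norm_exp_ofReal_mul_I, Complex.norm_exp_ofReal_mul_I,
    Complex.norm_real, Complex.norm_real, Real.norm_of_nonneg hr.le, Real.norm_of_nonneg hs.le,
    mul_one, mul_one] at h1
  rw [h1] at h
  exact mul_left_cancel₀ (by exact_mod_cast hs.ne') h

lemma exists_int_of_exp_eq' {a b : ℝ}
    (h : Complex.exp (a * Complex.I) = Complex.exp (b * Complex.I)) :
    ∃ k : ℤ, a = b + 2 * Real.pi * k := by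
  obtain ⟨k, hk⟩ := exists_int_of_exp_eq (X := Unit) isPreconnected_univ (f := fun _ => a)
    (g := fun _ => b) continuousOn_const continuousOn_const (fun _ _ => h)
  exact ⟨k, hk () trivial⟩

/-! ### The covering projection as a local diffeomorphism -/

lemma two_le_infty : (2 : WithTop ℕ∞) ≤ ∞ :=
  WithTop.coe_le_coe.2 (le_top : (2 : ℕ∞) ≤ ⊤)

lemma isManifold_two {M : Type*} [TopologicalSpace M] [ChartedSpace (EuclideanSpace ℝ (Fin 2)) M]
    [IsManifold (𝓡 2) ∞ M] : IsManifold (𝓡 2) 2 M := IsManifold.of_le (n := ∞) two_le_infty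

attribute [local instance] isManifold_two

section Projection

variable {M : Type*} [TopologicalSpace M] [ChartedSpace (EuclideanSpace ℝ (Fin 2)) M]
  [IsManifold (𝓡 2) ∞ M]
  {g : ContMDiffRiemannianMetric (𝓡 2) ∞ (EuclideanSpace ℝ (Fin 2))
    (fun x : M => TangentSpace (𝓡 2) x)}

namespace ConformallyEuclideanStructure

variable (S : ConformallyEuclideanStructure g)

lemma contMDiffAt_proj {z : ℂ} (hz : z ∈ S.cover) : ContMDiffAt 𝓘(ℝ, ℂ) (𝓡 2) ∞ S.proj z :=
  S.contMDiffOn_proj.contMDiffAt (S.isOpen_cover.mem_nhds hz)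

lemma mdifferentiableAt_proj {z : ℂ} (hz : z ∈ S.cover) :
    MDifferentiableAt 𝓘(ℝ, ℂ) (𝓡 2) S.proj z :=
  (S.contMDiffAt_proj hz).mdifferentiableAt (by simp)

lemma mfderiv_proj_injective {z : ℂ} (hz : z ∈ S.cover) :
    Function.Injective (mfderiv 𝓘(ℝ, ℂ) (𝓡 2) S.proj z) := by
  obtain ⟨k, hk, h⟩ := S.conformal z hz
  refine (injective_iff_map_eq_zero _).2 fun v hv => ?_
  have h1 := h v v
  rw [hv] at h1
  simp only [map_zero] at h1
  have h2 := (mul_eq_zero.1 h1.symm).resolve_left hk.ne'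
  exact inner_self_eq_zero.1 h2

/-- Near each point of the cover the projection has a left inverse of class `C²`. -/
lemma exists_local_left_inverse {z₀ : ℂ} (hz₀ : z₀ ∈ S.cover) :
    ∃ (q : M → ℂ) (N : Set M), IsOpen N ∧ S.proj z₀ ∈ N ∧ ContMDiffOn (𝓡 2) 𝓘(ℝ, ℂ) 2 q N ∧
      ∀ᶠ z in 𝓝 z₀, q (S.proj z) = z := by
  let φ := extChartAt (𝓡 2) (S.proj z₀)
  have hF : ContDiffAt ℝ 2 (φ ∘ S.proj) z₀ :=
    (contMDiffAt_extChartAt.comp z₀ ((S.contMDiffAt_proj hz₀).of_le two_le_infty)).contDiffAt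
  have hinj := S.mfderiv_proj_injective hz₀
  have hd := (S.mdifferentiableAt_proj hz₀).hasMFDerivAt.2
  let L₀ : ℂ →L[ℝ] EuclideanSpace ℝ (Fin 2) := mfderiv 𝓘(ℝ, ℂ) (𝓡 2) S.proj z₀
  have hd' : HasFDerivAt (φ ∘ S.proj) L₀ z₀ := by
    have h2 : HasFDerivWithinAt (writtenInExtChartAt 𝓘(ℝ, ℂ) (𝓡 2) z₀ S.proj) L₀
      (range 𝓘(ℝ, ℂ)) (extChartAt 𝓘(ℝ, ℂ) z₀ z₀) := hd
    simpa [writtenInExtChartAt, φ, Function.comp_def, chartAt_self_eq] using h2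
  let L : ℂ ≃L[ℝ] EuclideanSpace ℝ (Fin 2) :=
    (LinearEquiv.ofInjectiveOfFinrankEq L₀.toLinearMap hinj
      (by simp [Complex.finrank_real_complex])).toContinuousLinearEquiv
  have hL : HasFDerivAt (φ ∘ S.proj) (L : ℂ →L[ℝ] EuclideanSpace ℝ (Fin 2)) z₀ := by
    convert! hd'
  let q₀ := hF.localInverse hL (by simp)
  have hq₀ : ContDiffAt ℝ 2 q₀ (φ (S.proj z₀)) := hF.to_localInverse hL (by simp)
  have hq : ContMDiffAt (𝓡 2) 𝓘(ℝ, ℂ) 2 (q₀ ∘ φ) (S.proj z₀) :=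
    hq₀.contMDiffAt.comp _ contMDiffAt_extChartAt
  obtain ⟨N, hN, hqN⟩ := (contMDiffAt_iff_contMDiffOn_nhds (by simp)).1 hq
  obtain ⟨N', hN', hNo, hN0⟩ := mem_nhds_iff.1 hN
  exact ⟨q₀ ∘ φ, N', hNo, hN0, hqN.mono hN',
    (hF.hasStrictFDerivAt' hL (by simp)).eventually_left_inverse⟩

lemma metric_congr {a b : M} (hab : a = b) {v w v' w' : EuclideanSpace ℝ (Fin 2)} (hv : v = v')
    (hw : w = w') : g.inner a v w = g.inner b v' w' := by
  subst hab hv hw; rfl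

/-- The conformal factor of the induced metric with respect to the euclidean metric. -/
def conformalFactor (x : ℂ) : ℝ := S.metric x 1 1

lemma metric_eq {x : ℂ} (hx : x ∈ S.cover) (v w : ℂ) :
    S.metric x v w = S.conformalFactor x * inner ℝ v w := by
  obtain ⟨k, -, h⟩ := S.conformal x hx
  rw [conformalFactor, metric, metric, h, h]
  simp

lemma conformalFactor_pos {x : ℂ} (hx : x ∈ S.cover) : 0 < S.conformalFactor x := by
  obtain ⟨k, hk, h⟩ := S.conformal x hx
  rw [conformalFactor, metric, h]
  simpa using hk

lemma continuousOn_tangentMap_proj :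
    ContinuousOn (tangentMap 𝓘(ℝ, ℂ) (𝓡 2) S.proj) (TotalSpace.proj ⁻¹' S.cover) :=
  ((S.contMDiffOn_proj.continuousOn_tangentMapWithin (by simp)
    S.isOpen_cover.uniqueMDiffOn)).congr fun p hp => by
      rw [tangentMapWithin_eq_tangentMap (S.isOpen_cover.uniqueMDiffOn _ hp)
        (S.mdifferentiableAt_proj hp)]

lemma contDiffOn_conformalFactor : ContDiffOn ℝ 2 S.conformalFactor S.cover := by
  intro x hx
  refine ContDiffAt.contDiffWithinAt ?_
  have hT : ContMDiffAt 𝓘(ℝ, ℂ) (𝓡 2).tangent 2 (fun z : ℂ =>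
      (⟨S.proj z, mfderiv 𝓘(ℝ, ℂ) (𝓡 2) S.proj z (1 : ℂ)⟩ : TangentBundle (𝓡 2) M)) x := by
    have h1 := S.contMDiffOn_proj.contMDiffOn_tangentMapWithin (m := 2) (by norm_cast)
      S.isOpen_cover.uniqueMDiffOn
    have h2 : ContMDiffAt 𝓘(ℝ, ℂ) 𝓘(ℝ, ℂ).tangent 2
        (fun z : ℂ => (⟨z, (1 : ℂ)⟩ : TangentBundle 𝓘(ℝ, ℂ) ℂ)) x := by
      rw [contMDiffAt_totalSpace]
      refine ⟨contMDiffAt_id, ?_⟩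
      simpa using contMDiffAt_const
    have h3 := ContMDiffWithinAt.comp (f := fun z : ℂ => (⟨z, (1 : ℂ)⟩ : TangentBundle 𝓘(ℝ, ℂ) ℂ))
      (s := S.cover) x (h1 ⟨x, (1 : ℂ)⟩ hx) h2.contMDiffWithinAt (fun z hz => hz)
    refine (h3.congr (fun z hz => ?_) ?_).contMDiffAt (S.isOpen_cover.mem_nhds hx)
    · simp only [Function.comp, tangentMapWithin, mfderivWithin_of_isOpen S.isOpen_cover hz]
    · simp only [Function.comp, tangentMapWithin, mfderivWithin_of_isOpen S.isOpen_cover hx]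
  rw [← contMDiffAt_iff_contDiffAt]
  have : ContMDiffAt 𝓘(ℝ, ℂ) ((𝓡 2).prod 𝓘(ℝ)) 2
      (fun m ↦ TotalSpace.mk' ℝ (E := Bundle.Trivial M ℝ) (S.proj m) (g.inner (S.proj m)
        (mfderiv 𝓘(ℝ, ℂ) (𝓡 2) S.proj m (1 : ℂ)) (mfderiv 𝓘(ℝ, ℂ) (𝓡 2) S.proj m (1 : ℂ)))) x := by
    apply ContMDiffAt.clm_bundle_apply₂ (F₁ := EuclideanSpace ℝ (Fin 2))
      (F₂ := EuclideanSpace ℝ (Fin 2))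
    · exact ContMDiffAt.comp x (g.contMDiff.contMDiffAt.of_le two_le_infty)
        ((S.contMDiffAt_proj hx).of_le two_le_infty)
    · exact hT
    · exact hT
  rw [contMDiffAt_totalSpace] at this
  exact this.2

end ConformallyEuclideanStructure

end Projection

/-! ### Lifts of curves and deck transformations -/

section Lifts

variable {M : Type*} [TopologicalSpace M] [ChartedSpace (EuclideanSpace ℝ (Fin 2)) M]

lemma tangentBundle_mk_eq {a b : M} (hab : a = b) {v w : EuclideanSpace ℝ (Fin 2)} (hvw : v = w) :
    (⟨a, v⟩ : TangentBundle (𝓡 2) M) = ⟨b, w⟩ := by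
  subst hab hvw; rfl

lemma velocity_congr {γ γ' : ℝ → M} (h : EqOn γ γ' (Icc 0 1)) {u : ℝ} (hu : u ∈ Icc (0 : ℝ) 1) :
    (⟨γ u, velocity γ u⟩ : TangentBundle (𝓡 2) M) = ⟨γ' u, velocity γ' u⟩ :=
  tangentBundle_mk_eq (h hu) (by
    unfold velocity
    rw [mfderivWithin_congr (f₁ := γ) (f := γ') (fun x hx => h hx) (h hu)]
    rfl)

variable [IsManifold (𝓡 2) ∞ M]
  {g : ContMDiffRiemannianMetric (𝓡 2) ∞ (EuclideanSpace ℝ (Fin 2))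
    (fun x : M => TangentSpace (𝓡 2) x)}

namespace ConformallyEuclideanStructure

variable {S : ConformallyEuclideanStructure g}

/-- The image of a tangent vector of the cover in the tangent bundle of the surface. -/
def pushforward (S : ConformallyEuclideanStructure g) (z v : ℂ) : TangentBundle (𝓡 2) M :=
  ⟨S.proj z, mfderiv 𝓘(ℝ, ℂ) (𝓡 2) S.proj z v⟩

lemma velocity_proj_comp {c : ℝ → ℂ} {u : ℝ} (hu : u ∈ Icc (0 : ℝ) 1)
    (hc : DifferentiableWithinAt ℝ c (Icc 0 1) u) (hcu : c u ∈ S.cover) :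
    velocity (fun t => S.proj (c t)) u =
      mfderiv 𝓘(ℝ, ℂ) (𝓡 2) S.proj (c u) (planeVelocity c u) := by
  have h := mfderiv_comp_mfderivWithin (I := 𝓘(ℝ, ℝ)) (I' := 𝓘(ℝ, ℂ)) (I'' := 𝓡 2) (f := c)
    (g := S.proj) u (s := Icc 0 1) (S.mdifferentiableAt_proj hcu)
    hc.mdifferentiableWithinAt
    (uniqueMDiffWithinAt_iff_uniqueDiffWithinAt.2 (uniqueDiffOn_Icc one_pos u hu))
  rw [mfderivWithin_eq_fderivWithin] at h
  exact congrArg (fun L : ℝ →L[ℝ] EuclideanSpace ℝ (Fin 2) => L 1) h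

lemma pushforward_velocity {γ : ℝ → M} {c : ℝ → ℂ} (h : ∀ t ∈ Icc (0 : ℝ) 1, S.proj (c t) = γ t)
    {u : ℝ} (hu : u ∈ Icc (0 : ℝ) 1)
    (hc : DifferentiableWithinAt ℝ c (Icc 0 1) u) (hcu : c u ∈ S.cover) :
    S.pushforward (c u) (planeVelocity c u) = ⟨γ u, velocity γ u⟩ := by
  rw [← velocity_congr (γ := fun t => S.proj (c t)) h hu, velocity_proj_comp hu hc hcu]
  rfl

/-- The lift of a curve, as a map into the cover. -/
def IsLift.toMap {x : ℂ} {γ : ℝ → M} {c : ℝ → ℂ} (h : S.IsLift x γ c) : C(unitInterval, S.cover) :=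
  ⟨fun t => ⟨c t, h.2.1 t.2⟩,
    (h.1.comp_continuous continuous_subtype_val fun t => t.2).subtype_mk _⟩

lemma IsLift.eqOn {x : ℂ} {γ : ℝ → M} {c c' : ℝ → ℂ} (h : S.IsLift x γ c) (h' : S.IsLift x γ c') :
    EqOn c c' (Icc 0 1) := by
  have key := S.isCoveringMap_proj.eq_of_comp_eq h.toMap.continuous h'.toMap.continuous
    (by
      ext t
      exact (h.2.2.1 t t.2).trans (h'.2.2.1 t t.2).symm) 0
    (Subtype.ext (h.2.2.2.trans h'.2.2.2.symm))
  intro t ht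
  exact congrArg Subtype.val (congrFun key ⟨t, ht⟩)

lemma exists_isLift {x : ℂ} (hx : x ∈ S.cover) {γ : ℝ → M} (hγ : ContinuousOn γ (Icc 0 1))
    (h0 : γ 0 = S.proj x) : ∃ c, S.IsLift x γ c := by
  obtain ⟨Γ, hΓ, hΓ0⟩ := S.isCoveringMap_proj.exists_path_lifts
    ⟨fun t : unitInterval => γ t, hγ.comp_continuous continuous_subtype_val fun t => t.2⟩ ⟨x, hx⟩
    (by simpa using h0)
  refine ⟨fun u => Γ (projIcc 0 1 zero_le_one u), ?_, fun u _ => (Γ _).2, fun u hu => ?_, ?_⟩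
  · exact (continuous_subtype_val.comp (Γ.continuous.comp continuous_projIcc)).continuousOn
  · have := congrFun hΓ (projIcc 0 1 zero_le_one u)
    simp only [Function.comp_apply, domRestrict_apply, ContinuousMap.coe_mk] at this
    rw [this, projIcc_of_mem _ hu]
  · have : projIcc (0 : ℝ) 1 zero_le_one 0 = 0 := by simp [projIcc_left]
    simp only [this, hΓ0]

lemma IsLift.contDiffOn {x : ℂ} {γ : ℝ → M} {c : ℝ → ℂ} (h : S.IsLift x γ c)
    (hγ : ContMDiffOn 𝓘(ℝ, ℝ) (𝓡 2) 1 γ (Icc 0 1)) : ContDiffOn ℝ 1 c (Icc 0 1) := by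
  intro u hu
  obtain ⟨q, N, hN, hzN, hq, hqz⟩ := S.exists_local_left_inverse (h.2.1 hu)
  rw [h.2.2.1 u hu] at hzN
  have h1 : ContMDiffWithinAt 𝓘(ℝ, ℝ) 𝓘(ℝ, ℂ) 1 (q ∘ γ) (Icc 0 1) u :=
    ((hq.contMDiffAt (hN.mem_nhds hzN)).of_le (by norm_num)).comp_contMDiffWithinAt u (hγ u hu)
  refine (contMDiffWithinAt_iff_contDiffWithinAt.1 h1).congr_of_eventuallyEq ?_ ?_
  · filter_upwards [(h.1 u hu).eventually hqz, self_mem_nhdsWithin] with t ht htI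
    rw [Function.comp_apply, ← h.2.2.1 t htI, ht]
  · rw [Function.comp_apply, ← h.2.2.1 u hu, hqz.self_of_nhds]

lemma IsLift.pushforward {x : ℂ} {p : M} {γ : RegularClosedCurve p} {c : ℝ → ℂ}
    (h : S.IsLift x γ.toFun c) {u : ℝ} (hu : u ∈ Icc (0 : ℝ) 1) :
    S.pushforward (c u) (planeVelocity c u) = ⟨γ.toFun u, velocity γ.toFun u⟩ :=
  pushforward_velocity h.2.2.1 hu ((h.contDiffOn γ.contMDiffOn).differentiableOn (by simp) u hu)
    (h.2.1 hu)

lemma ne_zero_of_pushforward_eq {z v : ℂ} {q : M} {w : TangentSpace (𝓡 2) q}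
    (h : S.pushforward z v = ⟨q, w⟩) (hw : w ≠ 0) : v ≠ 0 := by
  rintro rfl
  obtain ⟨h1, h2⟩ := TotalSpace.mk.inj h
  subst h1
  exact hw ((eq_of_heq h2).symm.trans (map_zero (mfderiv 𝓘(ℝ, ℂ) (𝓡 2) S.proj z)))

lemma pushforward_injective {z v w : ℂ} (hz : z ∈ S.cover)
    (h : S.pushforward z v = S.pushforward z w) : v = w :=
  S.mfderiv_proj_injective hz (eq_of_heq (TotalSpace.mk.inj h).2)

lemma IsLift.planeVelocity_ne_zero {x : ℂ} {p : M} {γ : RegularClosedCurve p} {c : ℝ → ℂ}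
    (h : S.IsLift x γ.toFun c) {u : ℝ} (hu : u ∈ Icc (0 : ℝ) 1) : planeVelocity c u ≠ 0 :=
  ne_zero_of_pushforward_eq (h.pushforward hu) (γ.velocity_ne_zero u hu)

lemma ContDiffOn.continuousOn_planeVelocity {c : ℝ → ℂ} (h : ContDiffOn ℝ 1 c (Icc 0 1)) :
    ContinuousOn (planeVelocity c) (Icc 0 1) :=
  h.continuousOn_derivWithin (uniqueDiffOn_Icc one_pos) le_rfl

lemma IsLift.exists_isAngleFunction {x : ℂ} {p : M} {γ : RegularClosedCurve p} {c : ℝ → ℂ}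
    (h : S.IsLift x γ.toFun c) : ∃ θ, IsAngleFunction c θ :=
  BasedWinding.exists_isAngleFunction
    (ContDiffOn.continuousOn_planeVelocity (h.contDiffOn γ.contMDiffOn))
    fun _ hu => h.planeVelocity_ne_zero hu

lemma IsLift.eq_liftPath {x : ℂ} (hx : x ∈ S.cover) {p : M} {γ : Path p p} {c : ℝ → ℂ} {f : ℝ → M}
    (h : S.IsLift x f c) (hf : ∀ t : unitInterval, f t = γ t)
    (h0 : (γ : C(unitInterval, M)) 0 = S.cover.domRestrict S.proj ⟨x, hx⟩) :
    h.toMap = S.isCoveringMap_proj.liftPath γ ⟨x, hx⟩ h0 :=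
  (S.isCoveringMap_proj.eq_liftPath_iff' h0).2
    ⟨funext fun t => (h.2.2.1 t t.2).trans (hf t), Subtype.ext h.2.2.2⟩

/-- Two loops are homotopic if and only if their lifts have the same terminal point. -/
lemma homotopic_iff {x : ℂ} (hx : x ∈ S.cover) {p : M} {γ₁ γ₂ : Path p p} {c₁ c₂ : ℝ → ℂ}
    {f₁ f₂ : ℝ → M} (h₁ : S.IsLift x f₁ c₁) (h₂ : S.IsLift x f₂ c₂)
    (hf₁ : ∀ t : unitInterval, f₁ t = γ₁ t) (hf₂ : ∀ t : unitInterval, f₂ t = γ₂ t) :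
    γ₁.Homotopic γ₂ ↔ c₁ 1 = c₂ 1 := by
  have hp : p = S.proj x := by
    have := h₁.2.2.1 0 (by simp)
    rw [h₁.2.2.2] at this
    rw [this, ← γ₁.source]
    exact (hf₁ 0).symm
  have e₁ : (γ₁ : C(unitInterval, M)) 0 = S.cover.domRestrict S.proj ⟨x, hx⟩ := by
    simpa using hp
  have e₂ : (γ₂ : C(unitInterval, M)) 0 = S.cover.domRestrict S.proj ⟨x, hx⟩ := by
    simpa using hp
  constructor
  · intro h
    have := S.isCoveringMap_proj.liftPath_apply_one_eq_of_homotopicRel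
      (γ₀ := γ₁) (γ₁ := γ₂) h ⟨x, hx⟩ e₁ e₂
    rw [← h₁.eq_liftPath hx hf₁, ← h₂.eq_liftPath hx hf₂] at this
    exact congrArg Subtype.val this
  · intro h
    have := S.simplyConnected
    let P₁ : Path (⟨x, hx⟩ : S.cover) (h₁.toMap 1) := ⟨h₁.toMap, Subtype.ext h₁.2.2.2, rfl⟩
    let P₂ : Path (⟨x, hx⟩ : S.cover) (h₁.toMap 1) :=
      ⟨h₂.toMap, Subtype.ext h₂.2.2.2, Subtype.ext h.symm⟩
    obtain ⟨F⟩ := SimplyConnectedSpace.paths_homotopic P₁ P₂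
    have F' := F.map ⟨_, S.isCoveringMap_proj.continuous⟩
    refine ⟨ContinuousMap.HomotopyRel.cast F' ?_ ?_⟩
    · ext t; exact (h₁.2.2.1 t t.2).trans (hf₁ t)
    · ext t; exact (h₂.2.2.1 t t.2).trans (hf₂ t)

lemma homotopyClass_eq_iff {x : ℂ} (hx : x ∈ S.cover) {p : M} {γ₁ γ₂ : RegularClosedCurve p}
    {c₁ c₂ : ℝ → ℂ} (h₁ : S.IsLift x γ₁.toFun c₁) (h₂ : S.IsLift x γ₂.toFun c₂) :
    γ₁.homotopyClass = γ₂.homotopyClass ↔ c₁ 1 = c₂ 1 := by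
  rw [← homotopic_iff hx h₁ h₂ (γ₁ := γ₁.toPath) (γ₂ := γ₂.toPath) (fun _ => rfl) (fun _ => rfl),
    ← Path.Homotopic.Quotient.eq]
  exact ⟨fun h => congrArg FundamentalGroup.toPath h, fun h => congrArg FundamentalGroup.fromPath h⟩

lemma homotopyClass_eq_one_iff {x : ℂ} (hx : x ∈ S.cover) {p : M} {γ : RegularClosedCurve p}
    {c : ℝ → ℂ} (h : S.IsLift x γ.toFun c) : γ.homotopyClass = 1 ↔ c 1 = x := by
  have hp : S.proj x = p := by
    have := h.2.2.1 0 (by simp)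
    rwa [h.2.2.2, γ.source] at this
  rw [← homotopic_iff hx h (c₂ := fun _ => x) (f₂ := fun _ => p) (γ₁ := γ.toPath)
    (γ₂ := Path.refl p) ⟨continuousOn_const, fun _ _ => hx, fun _ _ => hp, rfl⟩ (fun _ => rfl)
    (fun _ => rfl), ← Path.Homotopic.Quotient.eq]
  exact ⟨fun h => congrArg FundamentalGroup.toPath h, fun h => congrArg FundamentalGroup.fromPath h⟩

/-! ### Deck transformations -/

lemma exists_continuousMap_deck {x y : S.cover} (h : S.proj x = S.proj y) :
    ∃ F : C(S.cover, S.cover), F x = y ∧ ∀ z, S.proj (F z) = S.proj z := by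
  have := S.simplyConnected
  have := S.isOpen_cover.locallyPathConnectedSpace
  obtain ⟨F, ⟨h1, h2⟩, -⟩ := S.isCoveringMap_proj.existsUnique_continuousMap_lifts
    ⟨_, S.isCoveringMap_proj.continuous⟩ x y h.symm
  exact ⟨F, h1, fun z => congrFun h2 z⟩

lemma continuousMap_deck_eq {F G : C(S.cover, S.cover)} (hF : ∀ z, S.proj (F z) = S.proj z)
    (hG : ∀ z, S.proj (G z) = S.proj z) {x : S.cover} (h : F x = G x) (z : S.cover) :
    F z = G z := by
  have := S.simplyConnected
  exact congrFun (S.isCoveringMap_proj.eq_of_comp_eq F.continuous G.continuous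
    (funext fun w => (hF w).trans (hG w).symm) x h) z

lemma exists_isDeckTransformation {x y : ℂ} (hx : x ∈ S.cover) (hy : y ∈ S.cover)
    (h : S.proj x = S.proj y) : ∃ T, S.IsDeckTransformation T ∧ T x = y := by
  classical
  obtain ⟨F, hF, hFp⟩ := exists_continuousMap_deck (S := S) (x := ⟨x, hx⟩) (y := ⟨y, hy⟩) h
  obtain ⟨G, hG, hGp⟩ := exists_continuousMap_deck (S := S) (x := ⟨y, hy⟩) (y := ⟨x, hx⟩) h.symm
  have hGF : ∀ z, G (F z) = z := continuousMap_deck_eq (F := G.comp F) (G := .id _)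
    (fun z => (hGp _).trans (hFp z)) (fun _ => rfl) (x := ⟨x, hx⟩) (by simp [hF, hG])
  have hFG : ∀ z, F (G z) = z := continuousMap_deck_eq (F := F.comp G) (G := .id _)
    (fun z => (hFp _).trans (hGp z)) (fun _ => rfl) (x := ⟨y, hy⟩) (by simp [hF, hG])
  let T : ℂ → ℂ := fun z => if hz : z ∈ S.cover then F ⟨z, hz⟩ else z
  have hT : ∀ z (hz : z ∈ S.cover), T z = F ⟨z, hz⟩ := fun z hz => dif_pos hz
  refine ⟨T, ⟨⟨fun z hz => ?_, fun z hz w hw hzw => ?_, fun z hz => ?_⟩, ?_, fun z hz => ?_⟩, ?_⟩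
  · rw [hT z hz]; exact (F _).2
  · rw [hT z hz, hT w hw] at hzw
    have := congrArg G (Subtype.ext hzw)
    rw [hGF, hGF] at this
    exact congrArg Subtype.val this
  · refine ⟨G ⟨z, hz⟩, (G _).2, ?_⟩
    rw [hT _ (G _).2]
    exact congrArg Subtype.val (hFG ⟨z, hz⟩)
  · rw [continuousOn_iff_continuous_domRestrict]
    refine (continuous_subtype_val.comp F.continuous).congr fun z => ?_
    exact (hT z z.2).symm
  · rw [hT z hz]; exact hFp _
  · rw [hT x hx, hF]

lemma IsDeckTransformation.eqOn {T T' : ℂ → ℂ} (h : S.IsDeckTransformation T)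
    (h' : S.IsDeckTransformation T') {x : ℂ} (hx : x ∈ S.cover) (hT : T x = T' x) :
    EqOn T T' S.cover := by
  intro z hz
  let F : C(S.cover, S.cover) := ⟨fun w => ⟨T w, h.1.mapsTo w.2⟩,
    ((continuousOn_iff_continuous_domRestrict.1 h.2.1)).subtype_mk _⟩
  let G : C(S.cover, S.cover) := ⟨fun w => ⟨T' w, h'.1.mapsTo w.2⟩,
    ((continuousOn_iff_continuous_domRestrict.1 h'.2.1)).subtype_mk _⟩
  exact congrArg Subtype.val (continuousMap_deck_eq (F := F) (G := G) (fun w => h.2.2 w w.2)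
    (fun w => h'.2.2 w w.2) (x := ⟨x, hx⟩) (Subtype.ext hT) ⟨z, hz⟩)

lemma isDeckTransformation_id : S.IsDeckTransformation id :=
  ⟨bijOn_id _, continuousOn_id, fun _ _ => rfl⟩

lemma IsDeckTransformation.contDiffAt {T : ℂ → ℂ} (h : S.IsDeckTransformation T) {z : ℂ}
    (hz : z ∈ S.cover) : ContDiffAt ℝ 2 T z := by
  have hTz := h.1.mapsTo hz
  obtain ⟨q, N, hN, hzN, hq, hqz⟩ := S.exists_local_left_inverse hTz
  rw [h.2.2 z hz] at hzN
  have h1 : ContMDiffAt 𝓘(ℝ, ℂ) 𝓘(ℝ, ℂ) 2 (q ∘ S.proj) z :=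
    (hq.contMDiffAt (hN.mem_nhds hzN)).comp z ((S.contMDiffAt_proj hz).of_le two_le_infty)
  refine (contMDiffAt_iff_contDiffAt.1 h1).congr_of_eventuallyEq ?_
  have hcont := (h.2.1 z hz).continuousAt (S.isOpen_cover.mem_nhds hz)
  filter_upwards [hcont.eventually hqz, S.isOpen_cover.mem_nhds hz] with w hw hwU
  rw [Function.comp_apply, ← h.2.2 w hwU, hw]

lemma IsDeckTransformation.differentiableAt {T : ℂ → ℂ} (h : S.IsDeckTransformation T) {z : ℂ}
    (hz : z ∈ S.cover) : DifferentiableAt ℝ T z :=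
  (h.contDiffAt hz).differentiableAt (by simp)

lemma IsDeckTransformation.pushforward {T : ℂ → ℂ} (h : S.IsDeckTransformation T) {z : ℂ}
    (hz : z ∈ S.cover) (v : ℂ) : S.pushforward (T z) (fderiv ℝ T z v) = S.pushforward z v := by
  have h1 : S.proj ∘ T =ᶠ[𝓝 z] S.proj := by
    filter_upwards [S.isOpen_cover.mem_nhds hz] with w hw using h.2.2 w hw
  have h2 := h1.mfderiv_eq (I := 𝓘(ℝ, ℂ)) (I' := 𝓡 2)
  have h3 := mfderiv_comp (I := 𝓘(ℝ, ℂ)) (I' := 𝓘(ℝ, ℂ)) (I'' := 𝓡 2) z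
    (S.mdifferentiableAt_proj (h.1.mapsTo hz)) (h.differentiableAt hz).mdifferentiableAt
  rw [h3, mfderiv_eq_fderiv] at h2
  exact tangentBundle_mk_eq (h.2.2 z hz)
    (congrArg (fun L : ℂ →L[ℝ] EuclideanSpace ℝ (Fin 2) => L v) h2)

lemma metric_eq_of_pushforward {z w v v' u u' : ℂ}
    (h : S.pushforward z v = S.pushforward w v') (h' : S.pushforward z u = S.pushforward w u') :
    S.metric z v u = S.metric w v' u' := by
  have e1 : S.proj z = S.proj w := congrArg TotalSpace.proj h
  refine metric_congr e1 ?_ ?_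
  · exact congrArg (fun q : TangentBundle (𝓡 2) M => (q.snd : EuclideanSpace ℝ (Fin 2))) h
  · exact congrArg (fun q : TangentBundle (𝓡 2) M => (q.snd : EuclideanSpace ℝ (Fin 2))) h'

lemma IsDeckTransformation.metric_map {T : ℂ → ℂ} (h : S.IsDeckTransformation T) {z : ℂ}
    (hz : z ∈ S.cover) (v w : ℂ) :
    S.metric (T z) (fderiv ℝ T z v) (fderiv ℝ T z w) = S.metric z v w :=
  metric_eq_of_pushforward (h.pushforward hz v) (h.pushforward hz w)

end ConformallyEuclideanStructure

lemma det_eq (A : ℂ →L[ℝ] ℂ) : A.det = (A 1).re * (A Complex.I).im - (A 1).im * (A Complex.I).re := by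
  rw [ContinuousLinearMap.det, ← LinearMap.det_toMatrix Complex.basisOneI, Matrix.det_fin_two]
  simp [LinearMap.toMatrix_apply, Complex.basisOneI, Module.Basis.ofEquivFun, mul_comm]

/-- A conformal linear map of the plane is `v ↦ a v` or `v ↦ a v̄`, according to the sign of its
determinant. -/
lemma exists_mul_of_conformal (A : ℂ →L[ℝ] ℂ) {μ : ℝ} (hμ : 0 < μ)
    (h : ∀ v w : ℂ, inner ℝ (A v) (A w) = μ * inner ℝ v w) :
    ∃ a : ℂ, a ≠ 0 ∧ ((0 < A.det ∧ ∀ v, A v = a * v) ∨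
      (A.det < 0 ∧ ∀ v, A v = a * (starRingEnd ℂ) v)) := by
  have h11 := h 1 1
  have h1I := h 1 Complex.I
  have hII := h Complex.I Complex.I
  have hA : ∀ v : ℂ, A v = v.re * A 1 + v.im * A Complex.I := fun v => by
    conv_lhs => rw [← Complex.re_add_im v, ← mul_one (v.re : ℂ), ← Complex.real_smul,
      ← Complex.real_smul, map_add, map_smul, map_smul]
    simp only [Complex.real_smul]
  rw [det_eq]
  set a := A 1
  set b := A Complex.I
  simp only [Complex.inner, Complex.mul_re, Complex.conj_re, Complex.conj_im, map_one,
    Complex.one_re, Complex.one_im, Complex.I_re, Complex.I_im] at h11 h1I hII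
  ring_nf at h11 h1I hII
  have ha : a ≠ 0 := by
    intro h0; rw [h0] at h11; simp at h11; exact hμ.ne h11
  have hD : (a.re * b.im - a.im * b.re - μ) * (a.re * b.im - a.im * b.re + μ) = 0 := by
    have : (a.re * b.im - a.im * b.re) ^ 2 + (a.re * b.re + a.im * b.im) ^ 2 =
      (a.re ^ 2 + a.im ^ 2) * (b.re ^ 2 + b.im ^ 2) := by ring
    rw [h11, hII, show a.re * b.re + a.im * b.im = 0 by linarith] at this
    nlinarith
  refine ⟨a, ha, ?_⟩
  rcases mul_eq_zero.1 hD with hD | hD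
  · left
    refine ⟨by linarith, fun v => ?_⟩
    have hz : (b.re + a.im) ^ 2 + (b.im - a.re) ^ 2 = 0 := by nlinarith
    have e1 : b.re + a.im = 0 := by nlinarith [sq_nonneg (b.re + a.im), sq_nonneg (b.im - a.re)]
    have e2 : b.im - a.re = 0 := by nlinarith [sq_nonneg (b.re + a.im), sq_nonneg (b.im - a.re)]
    rw [hA v]
    apply Complex.ext <;> simp
    · linear_combination v.im * e1
    · linear_combination v.im * e2
  · right
    refine ⟨by linarith, fun v => ?_⟩
    have hz : (b.re - a.im) ^ 2 + (b.im + a.re) ^ 2 = 0 := by nlinarith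
    have e1 : b.re - a.im = 0 := by nlinarith [sq_nonneg (b.re - a.im), sq_nonneg (b.im + a.re)]
    have e2 : b.im + a.re = 0 := by nlinarith [sq_nonneg (b.re - a.im), sq_nonneg (b.im + a.re)]
    rw [hA v]
    apply Complex.ext <;> simp
    · linear_combination v.im * e1
    · linear_combination v.im * e2

namespace ConformallyEuclideanStructure

variable {S : ConformallyEuclideanStructure g}

lemma IsDeckTransformation.exists_mul {T : ℂ → ℂ} (h : S.IsDeckTransformation T) {z : ℂ}
    (hz : z ∈ S.cover) :
    ∃ a : ℂ, a ≠ 0 ∧ ((0 < (fderiv ℝ T z).det ∧ ∀ v, fderiv ℝ T z v = a * v) ∨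
      ((fderiv ℝ T z).det < 0 ∧ ∀ v, fderiv ℝ T z v = a * (starRingEnd ℂ) v)) := by
  have hTz := h.1.mapsTo hz
  refine exists_mul_of_conformal _
    (div_pos (S.conformalFactor_pos hz) (S.conformalFactor_pos hTz)) fun v w => ?_
  have h1 := h.metric_map hz v w
  rw [S.metric_eq hz, S.metric_eq hTz] at h1
  have := S.conformalFactor_pos hTz
  field_simp
  linarith

/-- A deck transformation preserves the orientation everywhere or reverses it everywhere. -/
lemma IsDeckTransformation.det_pos_or_neg {T : ℂ → ℂ} (h : S.IsDeckTransformation T) :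
    (∀ z ∈ S.cover, 0 < (fderiv ℝ T z).det) ∨ (∀ z ∈ S.cover, (fderiv ℝ T z).det < 0) := by
  have hc : ContinuousOn (fun z => (fderiv ℝ T z).det) S.cover := by
    intro z hz
    have h1 : ContinuousAt (fderiv ℝ T) z :=
      ((h.contDiffAt hz).fderiv_right (m := 1) (by norm_num)).continuousAt
    exact (ContinuousLinearMap.continuous_det.continuousAt.comp h1).continuousWithinAt
  have hne : ∀ z ∈ S.cover, (fderiv ℝ T z).det ≠ 0 := fun z hz => by
    obtain ⟨a, -, h | h⟩ := h.exists_mul hz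
    · exact h.1.ne'
    · exact h.1.ne
  have hconn : IsPreconnected S.cover := by
    have := S.simplyConnected
    exact isPreconnected_iff_preconnectedSpace.2 inferInstance
  by_contra hcon
  push Not at hcon
  obtain ⟨⟨z, hz, hz0⟩, w, hw, hw0⟩ := hcon
  obtain ⟨y, hy, hy0⟩ := hconn.intermediate_value hz hw hc ⟨hz0, hw0⟩
  exact hne y hy hy0

end ConformallyEuclideanStructure

end Lifts

/-! ### Geodesics of the conformal metric -/

section Geodesics

variable {M : Type*} [TopologicalSpace M] [ChartedSpace (EuclideanSpace ℝ (Fin 2)) M]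
  [IsManifold (𝓡 2) ∞ M]
  {g : ContMDiffRiemannianMetric (𝓡 2) ∞ (EuclideanSpace ℝ (Fin 2))
    (fun x : M => TangentSpace (𝓡 2) x)}

/-- Integral curves over `[0,1]` of a `C¹` vector field on a neighbourhood of both curves are
determined by their initial points. -/
lemma eqOn_of_contDiff_vectorField {E : Type*} [NormedAddCommGroup E] [NormedSpace ℝ E] {F : E → E}
    {O : Set E} (hF : ∀ x ∈ O, ContDiffAt ℝ 1 F x) {f₁ f₂ : ℝ → E}
    (h₁ : ∀ t ∈ Icc (0 : ℝ) 1, f₁ t ∈ O ∧ HasDerivWithinAt f₁ (F (f₁ t)) (Icc 0 1) t)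
    (h₂ : ∀ t ∈ Icc (0 : ℝ) 1, f₂ t ∈ O ∧ HasDerivWithinAt f₂ (F (f₂ t)) (Icc 0 1) t)
    (h0 : f₁ 0 = f₂ 0) : EqOn f₁ f₂ (Icc 0 1) := by
  have c₁ : ContinuousOn f₁ (Icc 0 1) := fun t ht => (h₁ t ht).2.continuousWithinAt
  have c₂ : ContinuousOn f₂ (Icc 0 1) := fun t ht => (h₂ t ht).2.continuousWithinAt
  let C := f₁ '' Icc 0 1 ∪ f₂ '' Icc 0 1
  have hC : IsCompact C := (isCompact_Icc.image_of_continuousOn c₁).union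
    (isCompact_Icc.image_of_continuousOn c₂)
  have hCO : C ⊆ O := by
    rintro _ (⟨t, ht, rfl⟩ | ⟨t, ht, rfl⟩)
    · exact (h₁ t ht).1
    · exact (h₂ t ht).1
  have hloc : LocallyLipschitzOn C F := fun x hx => by
    obtain ⟨K, t, ht, hK⟩ := (hF x (hCO hx)).exists_lipschitzOnWith
    exact ⟨K, t, mem_nhdsWithin_of_mem_nhds ht, hK⟩
  obtain ⟨K, hK⟩ := hloc.exists_lipschitzOnWith_of_compact hC
  have hsub : ∀ t ∈ Ico (0 : ℝ) 1, t ∈ Icc (0 : ℝ) 1 := fun t ht => Ico_subset_Icc_self ht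
  have hder : ∀ {f : ℝ → E} {v : E} {t : ℝ}, t ∈ Ico (0 : ℝ) 1 → HasDerivWithinAt f v (Icc 0 1) t →
      HasDerivWithinAt f v (Ici t) t := fun ht h =>
    h.mono_of_mem_nhdsWithin (Icc_mem_nhdsGE_of_mem ht)
  exact ODE_solution_unique_of_mem_Icc_right (v := fun _ => F) (s := fun _ => C)
    (fun _ _ => hK) c₁ (fun t ht => hder ht (h₁ t (hsub t ht)).2)
    (fun t ht => Or.inl ⟨t, hsub t ht, rfl⟩) c₂ (fun t ht => hder ht (h₂ t (hsub t ht)).2)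
    (fun t ht => Or.inr ⟨t, hsub t ht, rfl⟩) h0

namespace ConformallyEuclideanStructure

variable {S : ConformallyEuclideanStructure g}

/-- The euclidean gradient of the conformal factor. -/
def gradFactor (S : ConformallyEuclideanStructure g) (z : ℂ) : ℂ :=
  fderiv ℝ S.conformalFactor z 1 + fderiv ℝ S.conformalFactor z Complex.I * Complex.I

lemma inner_gradFactor (z w : ℂ) :
    inner ℝ (S.gradFactor z) w = fderiv ℝ S.conformalFactor z w := by
  have : fderiv ℝ S.conformalFactor z w = w.re * fderiv ℝ S.conformalFactor z 1 +
      w.im * fderiv ℝ S.conformalFactor z Complex.I := by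
    conv_lhs => rw [← Complex.re_add_im w, ← mul_one (w.re : ℂ), ← Complex.real_smul,
      ← Complex.real_smul, map_add, map_smul, map_smul]
    simp
  rw [this, gradFactor]
  simp [Complex.inner]

/-- `c` solves the geodesic equation of the conformal metric, in Hamiltonian form: with velocity
`V`, conformal factor `k` and momentum `k V`, one has `(k V)' = (|V|² / 2) ∇k`. -/
def IsGeodesicFlow (S : ConformallyEuclideanStructure g) (c V : ℝ → ℂ) : Prop :=
  ∀ t ∈ Icc (0 : ℝ) 1, c t ∈ S.cover ∧ HasDerivWithinAt c (V t) (Icc 0 1) t ∧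
    HasDerivWithinAt (fun s => (S.conformalFactor (c s) : ℂ) * V s)
      (((‖V t‖ ^ 2 / 2 : ℝ) : ℂ) * S.gradFactor (c t)) (Icc 0 1) t

lemma contDiffAt_conformalFactor {z : ℂ} (hz : z ∈ S.cover) :
    ContDiffAt ℝ 2 S.conformalFactor z :=
  (S.contDiffOn_conformalFactor z hz).contDiffAt (S.isOpen_cover.mem_nhds hz)

lemma hasFDerivAt_conformalFactor {z : ℂ} (hz : z ∈ S.cover) :
    HasFDerivAt S.conformalFactor (fderiv ℝ S.conformalFactor z) z :=
  ((contDiffAt_conformalFactor hz).differentiableAt (by simp)).hasFDerivAt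

/-- Geodesics are determined by their initial position and velocity. -/
lemma IsGeodesicFlow.eqOn {c₁ V₁ c₂ V₂ : ℝ → ℂ} (h₁ : S.IsGeodesicFlow c₁ V₁)
    (h₂ : S.IsGeodesicFlow c₂ V₂) (hc : c₁ 0 = c₂ 0) (hV : V₁ 0 = V₂ 0) :
    EqOn c₁ c₂ (Icc 0 1) := by
  let F : ℂ × ℂ → ℂ × ℂ := fun q => ((S.conformalFactor q.1)⁻¹ • q.2,
    (‖(S.conformalFactor q.1)⁻¹ • q.2‖ ^ 2 / 2) • S.gradFactor q.1)
  have hF : ∀ q ∈ {q : ℂ × ℂ | q.1 ∈ S.cover}, ContDiffAt ℝ 1 F q := by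
    intro q hq
    have hk : ContDiffAt ℝ 2 S.conformalFactor q.1 := contDiffAt_conformalFactor hq
    have h1 : ContDiffAt ℝ 1 (fun q : ℂ × ℂ => S.conformalFactor q.1) q :=
      (hk.of_le (by norm_num)).comp (f := fun q : ℂ × ℂ => q.1) q contDiffAt_fst
    have h2 : ContDiffAt ℝ 1 (fun q : ℂ × ℂ => (S.conformalFactor q.1)⁻¹ • q.2) q :=
      (h1.inv (S.conformalFactor_pos hq).ne').smul contDiffAt_snd
    have h3 : ContDiffAt ℝ 1 (fderiv ℝ S.conformalFactor) q.1 := hk.fderiv_right (by norm_num)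
    have h4 : ContDiffAt ℝ 1 S.gradFactor q.1 := by
      unfold gradFactor
      exact (Complex.ofRealCLM.contDiff.contDiffAt.comp _ (h3.clm_apply contDiffAt_const)).add
        ((Complex.ofRealCLM.contDiff.contDiffAt.comp _ (h3.clm_apply contDiffAt_const)).mul
          contDiffAt_const)
    exact h2.prodMk (((h2.norm_sq ℝ).div_const 2).smul
      (h4.comp (f := fun q : ℂ × ℂ => q.1) q contDiffAt_fst))
  have key : ∀ {c V : ℝ → ℂ}, S.IsGeodesicFlow c V → ∀ t ∈ Icc (0 : ℝ) 1,
      (c t, (S.conformalFactor (c t) : ℂ) * V t) ∈ {q : ℂ × ℂ | q.1 ∈ S.cover} ∧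
      HasDerivWithinAt (fun s => (c s, (S.conformalFactor (c s) : ℂ) * V s))
        (F (c t, (S.conformalFactor (c t) : ℂ) * V t)) (Icc 0 1) t := by
    intro c V h t ht
    obtain ⟨hU, hc, hm⟩ := h t ht
    refine ⟨hU, ?_⟩
    have hk : (S.conformalFactor (c t) : ℂ) ≠ 0 := by
      exact_mod_cast (S.conformalFactor_pos hU).ne'
    have e : (S.conformalFactor (c t))⁻¹ • ((S.conformalFactor (c t) : ℂ) * V t) = V t := by
      rw [Complex.real_smul, Complex.ofReal_inv, inv_mul_cancel_left₀ hk]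
    convert! hc.prodMk hm using 1
    simp only [F, e]
    rw [Complex.real_smul]
  have := eqOn_of_contDiff_vectorField hF (key h₁) (key h₂) (by rw [hc, hV])
  intro t ht
  exact congrArg Prod.fst (this ht)

/-- Geodesics have constant speed. -/
lemma IsGeodesicFlow.speed {c V : ℝ → ℂ} (h : S.IsGeodesicFlow c V) {t : ℝ}
    (ht : t ∈ Icc (0 : ℝ) 1) : S.conformalFactor (c t) * ‖V t‖ ^ 2 =
      S.conformalFactor (c 0) * ‖V 0‖ ^ 2 := by
  let m : ℝ → ℂ := fun s => (S.conformalFactor (c s) : ℂ) * V s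
  have hE : ∀ s ∈ Icc (0 : ℝ) 1, S.conformalFactor (c s) * ‖V s‖ ^ 2 =
      inner ℝ (m s) (m s) / S.conformalFactor (c s) := fun s hs => by
    have := S.conformalFactor_pos (h s hs).1
    simp only [m]
    rw [real_inner_self_eq_norm_sq, norm_mul, Complex.norm_real, Real.norm_of_nonneg this.le]
    field_simp
  have hd : ∀ s ∈ Icc (0 : ℝ) 1, HasDerivWithinAt
      (fun s => inner ℝ (m s) (m s) / S.conformalFactor (c s)) 0 (Icc 0 1) s := fun s hs => by
    obtain ⟨hU, hc, hm⟩ := h s hs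
    have hkpos := S.conformalFactor_pos hU
    have h1 := (HasDerivWithinAt.inner ℝ hm hm).div
      ((hasFDerivAt_conformalFactor hU).comp_hasDerivWithinAt s hc) hkpos.ne'
    convert! h1 using 1
    rw [← inner_gradFactor, ← Complex.real_smul, ← Complex.real_smul]
    simp only [real_inner_smul_left, real_inner_smul_right, Function.comp]
    rw [real_inner_self_eq_norm_sq, real_inner_comm (V s) (S.gradFactor (c s))]
    field_simp
    ring
  rw [hE t ht, hE 0 (by simp)]
  exact constant_of_derivWithin_zero (fun s hs => (hd s hs).differentiableWithinAt)
    (fun s hs => (hd s (Ico_subset_Icc_self hs)).derivWithin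
      (uniqueDiffOn_Icc one_pos s (Ico_subset_Icc_self hs))) t ht

lemma IsGeodesicFlow.reverse {c V : ℝ → ℂ} (h : S.IsGeodesicFlow c V) :
    S.IsGeodesicFlow (fun t => c (1 - t)) (fun t => -V (1 - t)) := by
  intro t ht
  have ht' : 1 - t ∈ Icc (0 : ℝ) 1 := ⟨by linarith [ht.2], by linarith [ht.1]⟩
  have hmaps : MapsTo (fun s : ℝ => 1 - s) (Icc 0 1) (Icc 0 1) := fun s hs =>
    ⟨by linarith [hs.2], by linarith [hs.1]⟩
  have hr : HasDerivWithinAt (fun s : ℝ => 1 - s) (-1) (Icc 0 1) t :=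
    (hasDerivAt_id t).const_sub 1 |>.hasDerivWithinAt
  obtain ⟨hU, hc, hm⟩ := h _ ht'
  refine ⟨hU, ?_, ?_⟩
  · convert! hc.scomp (h := fun s : ℝ => 1 - s) t hr hmaps using 1
    simp
  · convert! (hm.scomp (h := fun s : ℝ => 1 - s) t hr hmaps).neg using 1
    · ext s; simp
    · simp

/-- Deck transformations map geodesics to geodesics. -/
lemma IsGeodesicFlow.map {c V : ℝ → ℂ} (h : S.IsGeodesicFlow c V) {T : ℂ → ℂ}
    (hT : S.IsDeckTransformation T) :
    S.IsGeodesicFlow (fun t => T (c t)) (fun t => fderiv ℝ T (c t) (V t)) := by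
  intro t ht
  obtain ⟨hU, hc, hm⟩ := h t ht
  have hTU := hT.1.mapsTo hU
  have hTc : HasDerivWithinAt (fun s => T (c s)) (fderiv ℝ T (c t) (V t)) (Icc 0 1) t :=
    (hT.differentiableAt hU).hasFDerivAt.comp_hasDerivWithinAt t hc
  refine ⟨hTU, hTc, ?_⟩
  -- `A` is the differential of `T`, and `A'` that of `A`
  let A := fderiv ℝ T
  let A' := fderiv ℝ A (c t)
  have hT2 := hT.contDiffAt hU
  have hA : HasFDerivAt A A' (c t) :=
    ((hT2.fderiv_right (m := 1) (by norm_num)).differentiableAt (by simp)).hasFDerivAt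
  have hAc : HasDerivWithinAt (fun s => A (c s)) (A' (V t)) (Icc 0 1) t :=
    hA.comp_hasDerivWithinAt t hc
  have hsymm : ∀ v w, A' v w = A' w v := fun v w =>
    (hT2.isSymmSndFDerivAt (by simp)) v w
  have hiso : ∀ z ∈ S.cover, ∀ v w, S.conformalFactor (T z) * inner ℝ (A z v) (A z w) =
      S.conformalFactor z * inner ℝ v w := fun z hz v w => by
    rw [← S.metric_eq hz, ← S.metric_eq (hT.1.mapsTo hz)]
    exact hT.metric_map hz v w
  set k := S.conformalFactor with hk_def
  let m : ℝ → ℂ := fun s => (k (c s) : ℂ) * V s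
  let n : ℝ → ℂ := fun s => (k (T (c s)) : ℂ) * A (c s) (V s)
  have hkpos : ∀ s ∈ Icc (0 : ℝ) 1, k (c s) ≠ 0 := fun s hs => (S.conformalFactor_pos (h s hs).1).ne'
  have hkc : HasDerivWithinAt (fun s => k (c s)) (fderiv ℝ k (c t) (V t)) (Icc 0 1) t :=
    (hasFDerivAt_conformalFactor hU).comp_hasDerivWithinAt t hc
  have hkTc : HasDerivWithinAt (fun s => k (T (c s))) (fderiv ℝ k (T (c t)) (A (c t) (V t)))
      (Icc 0 1) t := HasFDerivAt.comp_hasDerivWithinAt (f := fun s => T (c s)) t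
        (hasFDerivAt_conformalFactor hTU) hTc
  have hn_eq : ∀ s ∈ Icc (0 : ℝ) 1, n s = (k (T (c s)) / k (c s)) • A (c s) (m s) := fun s hs => by
    have := hkpos s hs
    simp only [n, m]
    rw [← Complex.real_smul, ← Complex.real_smul, map_smul, smul_smul, div_mul_cancel₀ _ this]
  obtain ⟨n', hn⟩ : ∃ n', HasDerivWithinAt n n' (Icc 0 1) t :=
    ⟨_, ((hkTc.div hkc (hkpos t ht)).smul (hAc.clm_apply hm)).congr hn_eq (hn_eq t ht)⟩
  -- differentiate the relation `⟨n, A u⟩ = ⟨m, u⟩` along the curve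
  have e1 : ∀ u, inner ℝ n' (A (c t) u) + inner ℝ (n t) (A' (V t) u) =
      inner ℝ (((‖V t‖ ^ 2 / 2 : ℝ) : ℂ) * S.gradFactor (c t)) u := fun u => by
    have d1 : HasDerivWithinAt (fun s => inner ℝ (n s) (A (c s) u))
        (inner ℝ (n t) (A' (V t) u) + inner ℝ n' (A (c t) u)) (Icc 0 1) t := by
      have hAu : HasDerivWithinAt (fun s => A (c s) u) (A' (V t) u) (Icc 0 1) t := by
        simpa using hAc.clm_apply (hasDerivWithinAt_const t (Icc 0 1) u)
      exact HasDerivWithinAt.inner ℝ hn hAu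
    have d2 : HasDerivWithinAt (fun s => inner ℝ (m s) u)
        (inner ℝ (((‖V t‖ ^ 2 / 2 : ℝ) : ℂ) * S.gradFactor (c t)) u) (Icc 0 1) t := by
      have := HasDerivWithinAt.inner ℝ hm (hasDerivWithinAt_const t (Icc 0 1) u)
      rwa [inner_zero_right, zero_add] at this
    have heq : EqOn (fun s => inner ℝ (n s) (A (c s) u)) (fun s => inner ℝ (m s) u) (Icc 0 1) :=
      fun s hs => by
        simp only [n, m]
        rw [← Complex.real_smul, ← Complex.real_smul, real_inner_smul_left, real_inner_smul_left]
        exact hiso _ (h s hs).1 _ _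
    have := (uniqueDiffOn_Icc one_pos t ht).eq_deriv _ (d1.congr heq.symm (heq ht).symm) d2
    rw [add_comm]; exact this
  -- differentiate the relation `k(T z) |A v|² = k(z) |v|²`, with `v` the velocity, at the point
  have e2 : ∀ u, fderiv ℝ k (T (c t)) (A (c t) u) * ‖A (c t) (V t)‖ ^ 2 +
      k (T (c t)) * (2 * inner ℝ (A (c t) (V t)) (A' u (V t))) =
      fderiv ℝ k (c t) u * ‖V t‖ ^ 2 := fun u => by
    have d1 : HasFDerivAt (fun z => k (T z)) ((fderiv ℝ k (T (c t))).comp (A (c t))) (c t) :=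
      (hasFDerivAt_conformalFactor hTU).comp (c t) (hT.differentiableAt hU).hasFDerivAt
    have d2 : HasFDerivAt (fun z => A z (V t)) (A'.flip (V t)) (c t) := by
      simpa using hA.clm_apply (hasFDerivAt_const (V t) (c t))
    have d3 := d1.mul d2.norm_sq
    have d4 : HasFDerivAt (fun z => k z * ‖V t‖ ^ 2) (‖V t‖ ^ 2 • fderiv ℝ k (c t)) (c t) :=
      (hasFDerivAt_conformalFactor hU).mul_const _
    have heq : (fun z => k z * ‖V t‖ ^ 2) =ᶠ[𝓝 (c t)] (fun z => k (T z) * ‖A z (V t)‖ ^ 2) := by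
      filter_upwards [S.isOpen_cover.mem_nhds hU] with z hz
      rw [← real_inner_self_eq_norm_sq, ← real_inner_self_eq_norm_sq, hiso z hz]
    have := congrArg (fun L : ℂ →L[ℝ] ℝ => L u) (HasFDerivAt.unique (d3.congr_of_eventuallyEq heq) d4)
    simp at this
    have hin : inner ℝ (A (c t) (V t)) (A' u (V t)) = (A' u (V t)).re * (A (c t) (V t)).re +
      (A' u (V t)).im * (A (c t) (V t)).im := by simp [Complex.inner]
    rw [hin]
    linarith
  have e3 : n' = ((‖A (c t) (V t)‖ ^ 2 / 2 : ℝ) : ℂ) * S.gradFactor (T (c t)) := by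
    refine ext_inner_right ℝ fun w => ?_
    obtain ⟨u, rfl⟩ : ∃ u, A (c t) u = w := by
      obtain ⟨a, ha, h1 | h1⟩ := hT.exists_mul hU
      · exact ⟨a⁻¹ * w, by rw [h1.2, mul_inv_cancel_left₀ ha]⟩
      · exact ⟨(starRingEnd ℂ) (a⁻¹ * w), by rw [h1.2, Complex.conj_conj, mul_inv_cancel_left₀ ha]⟩
    have h1 := e1 u
    have h2 := e2 u
    have h3 : inner ℝ (n t) (A' (V t) u) =
        k (T (c t)) * inner ℝ (A (c t) (V t)) (A' u (V t)) := by
      simp only [n]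
      rw [← Complex.real_smul, real_inner_smul_left, hsymm]
    rw [← Complex.real_smul, real_inner_smul_left, inner_gradFactor] at h1 ⊢
    rw [h3] at h1
    linarith
  rw [← e3]
  exact hn

lemma IsGeodesic.isGeodesicFlow {c : ℝ → ℂ} (h : IsGeodesic S.cover S.metric c) :
    S.IsGeodesicFlow c (planeVelocity c) := by
  obtain ⟨hc2, hU, hgeo⟩ := h
  intro t ht
  have hud := uniqueDiffOn_Icc (zero_lt_one' ℝ)
  have hV : ContDiffOn ℝ 1 (planeVelocity c) (Icc 0 1) := hc2.derivWithin hud (by norm_num)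
  have hVd := (hV.differentiableOn (by simp) t ht)
  have hcd : HasDerivWithinAt c (planeVelocity c t) (Icc 0 1) t :=
    (hc2.differentiableOn (by simp) t ht).hasDerivWithinAt
  refine ⟨hU ht, hcd, ?_⟩
  have hkc := (hasFDerivAt_conformalFactor (hU ht)).comp_hasDerivWithinAt t hcd
  have hm := hkc.ofReal_comp.mul hVd.hasDerivWithinAt
  convert! hm using 1
  refine ext_inner_right ℝ fun w => ?_
  have h1 := hgeo t ht w
  have h2 : HasDerivWithinAt (fun s => S.metric (c s) (planeVelocity c s) w) _ (Icc 0 1) t :=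
    (HasDerivWithinAt.inner ℝ hm (hasDerivWithinAt_const t (Icc 0 1) w)).congr
      (fun s hs => by
        rw [S.metric_eq (hU hs)]
        simp only [Pi.mul_apply, Function.comp]
        rw [← Complex.real_smul, real_inner_smul_left])
      (by
        rw [S.metric_eq (hU ht)]
        simp only [Pi.mul_apply, Function.comp]
        rw [← Complex.real_smul, real_inner_smul_left])
  rw [h2.derivWithin (hud t ht)] at h1
  have h3 : fderiv ℝ (fun x => S.metric x (planeVelocity c t) (planeVelocity c t)) (c t) w =
      fderiv ℝ S.conformalFactor (c t) w * ‖planeVelocity c t‖ ^ 2 := by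
    have heq : (fun x => S.metric x (planeVelocity c t) (planeVelocity c t)) =ᶠ[𝓝 (c t)]
        fun x => S.conformalFactor x * ‖planeVelocity c t‖ ^ 2 := by
      filter_upwards [S.isOpen_cover.mem_nhds (hU ht)] with z hz
      rw [S.metric_eq hz, real_inner_self_eq_norm_sq]
    rw [heq.fderiv_eq, ((hasFDerivAt_conformalFactor (hU ht)).mul_const _).fderiv]
    simp [mul_comm]
  rw [h3] at h1
  simp only [inner_zero_right, zero_add] at h1
  rw [h1, ← Complex.real_smul, real_inner_smul_left, inner_gradFactor]
  ring

/-- A nonconstant geodesic is regular. -/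
lemma IsGeodesic.planeVelocity_ne_zero {c : ℝ → ℂ} (h : IsGeodesic S.cover S.metric c)
    (hne : c 0 ≠ c 1) {t : ℝ} (ht : t ∈ Icc (0 : ℝ) 1) : planeVelocity c t ≠ 0 := by
  intro h0
  have hf := IsGeodesic.isGeodesicFlow h
  have hs := hf.speed ht
  rw [h0, norm_zero] at hs
  have hV : ∀ s ∈ Icc (0 : ℝ) 1, planeVelocity c s = 0 := fun s hs' => by
    have h1 := hf.speed hs'
    rw [← hs] at h1
    have h2 := S.conformalFactor_pos (hf s hs').1
    simpa [h2.ne'] using h1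
  refine hne (constant_of_derivWithin_zero (fun s hs => (hf s hs).2.1.differentiableWithinAt)
    (fun s hs => ?_) 1 (by simp)).symm
  exact hV s (Ico_subset_Icc_self hs)

/-- A geodesic arc `c` from `x` to `T x ≠ x` is not continued by its translate `T ∘ c` in the
opposite direction: otherwise `T ∘ c` would be `c` reversed, and the midpoint of `c` would be fixed
by `T`. -/
lemma IsGeodesic.deck_velocity_ne {c : ℝ → ℂ} (h : IsGeodesic S.cover S.metric c) {T : ℂ → ℂ}
    (hT : S.IsDeckTransformation T) (hTc : T (c 0) = c 1) (hne : c 0 ≠ c 1) {r : ℝ} (hr : 0 < r) :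
    fderiv ℝ T (c 0) (planeVelocity c 0) ≠ -(r * planeVelocity c 1) := by
  intro hcon
  have hf := IsGeodesic.isGeodesicFlow h
  have h0 : (0 : ℝ) ∈ Icc (0 : ℝ) 1 := by simp
  have h1 : (1 : ℝ) ∈ Icc (0 : ℝ) 1 := by simp
  have hV1 := IsGeodesic.planeVelocity_ne_zero h hne h1
  have e1 := hT.metric_map (hf 0 h0).1 (planeVelocity c 0) (planeVelocity c 0)
  rw [S.metric_eq (hf 0 h0).1, S.metric_eq (hT.1.mapsTo (hf 0 h0).1), hcon, hTc,
    real_inner_self_eq_norm_sq, real_inner_self_eq_norm_sq, ← hf.speed h1, norm_neg, norm_mul,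
    Complex.norm_real, Real.norm_of_nonneg hr.le] at e1
  have e2 := mul_left_cancel₀ (S.conformalFactor_pos (hf 1 h1).1).ne' e1
  have e3 : 0 < ‖planeVelocity c 1‖ := norm_pos_iff.2 hV1
  have e4 : r = 1 := by
    have : r * ‖planeVelocity c 1‖ = ‖planeVelocity c 1‖ := by
      rwa [sq_eq_sq₀ (by positivity) e3.le] at e2
    exact mul_right_cancel₀ e3.ne' (this.trans (one_mul _).symm)
  have key := (hf.map hT).eqOn hf.reverse (by simpa using hTc)
    (by simp only [hcon, e4]; simp)
  have hfix := key (x := 1 / 2) ⟨by norm_num, by norm_num⟩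
  simp only at hfix
  norm_num at hfix
  have hid := hT.eqOn isDeckTransformation_id (hf (1 / 2) ⟨by norm_num, by norm_num⟩).1
    (by norm_num; exact hfix)
  exact hne ((hid (hf 0 h0).1).symm.trans hTc)

end ConformallyEuclideanStructure

end Geodesics

/-! ### Existence and uniqueness of the based winding number -/

section WindingNumber

variable {M : Type*} [TopologicalSpace M] [ChartedSpace (EuclideanSpace ℝ (Fin 2)) M]
  [IsManifold (𝓡 2) ∞ M]
  {g : ContMDiffRiemannianMetric (𝓡 2) ∞ (EuclideanSpace ℝ (Fin 2))
    (fun x : M => TangentSpace (𝓡 2) x)}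

namespace ConformallyEuclideanStructure

variable {S : ConformallyEuclideanStructure g}

/-- The differential of a deck transformation acts on directions by `t ↦ t + α` or `t ↦ α - t`,
according to the sign of its determinant. -/
lemma IsDeckTransformation.exists_angle {T : ℂ → ℂ} (h : S.IsDeckTransformation T) {z : ℂ}
    (hz : z ∈ S.cover) : ∃ μ α : ℝ, 0 < μ ∧
      (0 < (fderiv ℝ T z).det → ∀ r t : ℝ, fderiv ℝ T z (r * Complex.exp (t * Complex.I)) =
        (μ * r : ℝ) * Complex.exp ((t + α : ℝ) * Complex.I)) ∧
      ((fderiv ℝ T z).det < 0 → ∀ r t : ℝ, fderiv ℝ T z (r * Complex.exp (t * Complex.I)) =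
        (μ * r : ℝ) * Complex.exp ((α - t : ℝ) * Complex.I)) := by
  obtain ⟨a, ha, hA⟩ := h.exists_mul hz
  have ha' : a = ‖a‖ * Complex.exp (a.arg * Complex.I) := (Complex.norm_mul_exp_arg_mul_I a).symm
  refine ⟨‖a‖, a.arg, norm_pos_iff.2 ha, fun hd r t => ?_, fun hd r t => ?_⟩
  · rcases hA with hA | hA
    · rw [hA.2]
      conv_lhs => rw [ha']
      push_cast
      rw [add_mul, Complex.exp_add]; ring
    · exact absurd hd hA.1.le.not_gt
  · rcases hA with hA | hA
    · exact absurd hd hA.1.le.not_gt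
    · rw [hA.2, map_mul, Complex.conj_ofReal, ← Complex.exp_conj, map_mul, Complex.conj_I,
        Complex.conj_ofReal]
      conv_lhs => rw [ha']
      push_cast
      rw [sub_mul, sub_eq_add_neg, Complex.exp_add, mul_neg]; ring

lemma pushforward_smul_congr {z v : ℂ} {q : M} {w : TangentSpace (𝓡 2) q}
    (h : S.pushforward z v = ⟨q, w⟩) (r : ℝ) : S.pushforward z (r * v) = ⟨q, r • w⟩ := by
  obtain ⟨h1, h2⟩ := TotalSpace.mk.inj h
  subst h1
  rw [← eq_of_heq h2]
  let L : ℂ →L[ℝ] EuclideanSpace ℝ (Fin 2) := mfderiv 𝓘(ℝ, ℂ) (𝓡 2) S.proj z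
  exact tangentBundle_mk_eq rfl
    (show L (r * v) = r • L v by rw [← Complex.real_smul, map_smul])

/-- The closing condition of a regular closed curve, in terms of its lift. -/
lemma IsLift.planeVelocity_one {x : ℂ} {p : M} {γ : RegularClosedCurve p} {c : ℝ → ℂ}
    (h : S.IsLift x γ.toFun c) {T : ℂ → ℂ} (hT : S.IsDeckTransformation T) (hTx : T x = c 1) :
    ∃ r : ℝ, 0 < r ∧ planeVelocity c 1 = fderiv ℝ T x (r * planeVelocity c 0) := by
  have h0 : (0 : ℝ) ∈ Icc (0 : ℝ) 1 := by simp
  have h1 : (1 : ℝ) ∈ Icc (0 : ℝ) 1 := by simp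
  obtain ⟨r, hr, hdir⟩ := γ.direction_eq
  have hx : x ∈ S.cover := h.2.2.2 ▸ h.2.1 h0
  refine ⟨r, hr, pushforward_injective (h.2.1 h1) ?_⟩
  have e0 := pushforward_smul_congr (h.pushforward h0) r
  rw [h.2.2.2] at e0
  rw [h.pushforward h1, hdir, ← hTx, hT.pushforward hx, e0]

/-- The closing condition of a regular closed curve on the end angles of its lift, where `f` is the
action on angles of the differential of the deck transformation. -/
lemma IsLift.exp_angle_one {x : ℂ} {p : M} {γ : RegularClosedCurve p} {c : ℝ → ℂ} {θ : ℝ → ℝ}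
    (h : S.IsLift x γ.toFun c) (hθ : IsAngleFunction c θ) {T : ℂ → ℂ}
    (hT : S.IsDeckTransformation T) (hTx : T x = c 1) {μ : ℝ} (hμ : 0 < μ) {f : ℝ → ℝ}
    (hf : ∀ r t : ℝ, fderiv ℝ T x (r * Complex.exp (t * Complex.I)) =
        (μ * r : ℝ) * Complex.exp (f t * Complex.I)) :
    Complex.exp (θ 1 * Complex.I) = Complex.exp (f (θ 0) * Complex.I) := by
  obtain ⟨r, hr, hV⟩ := h.planeVelocity_one hT hTx
  obtain ⟨r₀, hr₀, h0⟩ := hθ.planeVelocity_eq (u := 0) (by simp)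
  obtain ⟨r₁, hr₁, h1⟩ := hθ.planeVelocity_eq (u := 1) (by simp)
  rw [h1, h0, ← mul_assoc, ← Complex.ofReal_mul, hf] at hV
  exact exp_eq_of_pos_mul_eq hr₁ (by positivity) hV

/-- The translate of an arc by a deck transformation is a lift of its projection. -/
lemma IsGeodesicFlow.isLift {d V : ℝ → ℂ} (h : S.IsGeodesicFlow d V) {T : ℂ → ℂ}
    (hT : S.IsDeckTransformation T) (hTd : T (d 0) = d 1) :
    S.IsLift (d 1) (fun t => S.proj (d t)) (fun t => T (d t)) :=
  ⟨fun t ht => (h.map hT t ht).2.1.continuousWithinAt, fun t ht => (h.map hT t ht).1,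
    fun t ht => hT.2.2 _ (h t ht).1, hTd⟩

/-- The external angle `χ` is determined modulo `2π` by the end directions of the geodesic. -/
lemma IsExternalAngle.exp_eq {d : ℝ → ℂ} {η : ℝ → ℝ} {χ : ℝ} (hχ : S.IsExternalAngle d η χ)
    (hd : IsGeodesic S.cover S.metric d) (hη : IsAngleFunction d η) {T : ℂ → ℂ}
    (hT : S.IsDeckTransformation T) (hTd : T (d 0) = d 1) {μ : ℝ} (hμ : 0 < μ) {f : ℝ → ℝ}
    (hf : ∀ r t : ℝ, fderiv ℝ T (d 0) (r * Complex.exp (t * Complex.I)) =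
        (μ * r : ℝ) * Complex.exp (f t * Complex.I)) :
    Complex.exp ((χ + η 1 : ℝ) * Complex.I) = Complex.exp (f (η 0) * Complex.I) := by
  obtain ⟨d', η', hd', hη', ⟨k, hk⟩, -, -⟩ := hχ
  have hflow := IsGeodesic.isGeodesicFlow hd
  have h0 : (0 : ℝ) ∈ Icc (0 : ℝ) 1 := by simp
  have e1 : planeVelocity d' 0 = fderiv ℝ T (d 0) (planeVelocity d 0) := by
    rw [planeVelocity_congr (hd'.eqOn (hflow.isLift hT hTd)) h0]
    exact (hflow.map hT 0 h0).2.1.derivWithin (uniqueDiffOn_Icc one_pos 0 h0)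
  obtain ⟨r, hr, hr'⟩ := hη.planeVelocity_eq h0
  obtain ⟨s, hs, hs'⟩ := hη'.planeVelocity_eq h0
  rw [hr', hs', hf] at e1
  rw [← exp_eq_of_pos_mul_eq hs (by positivity) e1, hk]
  rw [show ((η' 0 - η 1 + 2 * Real.pi * k + η 1 : ℝ) : ℂ) * Complex.I =
    η' 0 * Complex.I + k * (2 * Real.pi * Complex.I) by push_cast; ring,
    Complex.exp_add, Complex.exp_int_mul_two_pi_mul_I, mul_one]

/-- The external angle of a nonconstant geodesic exists: the value `π` is excluded by
`IsGeodesic.deck_velocity_ne`. -/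
lemma exists_isExternalAngle {d : ℝ → ℂ} (hd : IsGeodesic S.cover S.metric d) (hne : d 0 ≠ d 1)
    {T : ℂ → ℂ} (hT : S.IsDeckTransformation T) (hTd : T (d 0) = d 1) :
    ∃ η χ, IsAngleFunction d η ∧ S.IsExternalAngle d η χ := by
  have hflow := IsGeodesic.isGeodesicFlow hd
  have h0 : (0 : ℝ) ∈ Icc (0 : ℝ) 1 := by simp
  have h1 : (1 : ℝ) ∈ Icc (0 : ℝ) 1 := by simp
  have hd1 : ContDiffOn ℝ 1 d (Icc 0 1) := hd.1.of_le (by norm_num)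
  obtain ⟨η, hη⟩ := exists_isAngleFunction (ContDiffOn.continuousOn_planeVelocity hd1)
    (fun u hu => IsGeodesic.planeVelocity_ne_zero hd hne hu)
  have hv : ∀ u ∈ Icc (0 : ℝ) 1, planeVelocity (fun t => T (d t)) u =
      fderiv ℝ T (d u) (planeVelocity d u) := fun u hu =>
    (hflow.map hT u hu).2.1.derivWithin (uniqueDiffOn_Icc one_pos u hu)
  have hTd1 : ContDiffOn ℝ 1 (fun t => T (d t)) (Icc 0 1) := fun t ht =>
    (((hT.contDiffAt (hflow t ht).1).of_le (by norm_num)).comp_contDiffWithinAt t (hd1 t ht))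
  have hinj : ∀ z ∈ S.cover, ∀ v, fderiv ℝ T z v = 0 → v = 0 := fun z hz v hv => by
    obtain ⟨a, ha, h | h⟩ := hT.exists_mul hz
    · rw [h.2] at hv; exact (mul_eq_zero.1 hv).resolve_left ha
    · rw [h.2] at hv
      exact (map_eq_zero (starRingEnd ℂ)).1 ((mul_eq_zero.1 hv).resolve_left ha)
  obtain ⟨η', hη'⟩ := exists_isAngleFunction (ContDiffOn.continuousOn_planeVelocity hTd1)
    (fun u hu h => IsGeodesic.planeVelocity_ne_zero hd hne hu
      (hinj _ (hflow u hu).1 _ ((hv u hu).symm.trans h)))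
  have hmem := toIocMod_mem_Ioc Real.two_pi_pos (-Real.pi) (η' 0 - η 1)
  have hmod := self_sub_toIocDiv_zsmul Real.two_pi_pos (-Real.pi) (η' 0 - η 1)
  set χ := toIocMod Real.two_pi_pos (-Real.pi) (η' 0 - η 1)
  set k := toIocDiv Real.two_pi_pos (-Real.pi) (η' 0 - η 1)
  rw [zsmul_eq_mul] at hmod
  refine ⟨η, χ, hη, fun t => T (d t), η', hflow.isLift hT hTd, hη', ⟨-k, ?_⟩, hmem.1, ?_⟩
  · push_cast; linarith
  · refine lt_of_le_of_ne (by linarith [hmem.2]) fun hpi => ?_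
    obtain ⟨r, hr, hr'⟩ := hη.planeVelocity_eq h1
    obtain ⟨s, hs, hs'⟩ := hη'.planeVelocity_eq h0
    refine IsGeodesic.deck_velocity_ne hd hT hTd hne (r := s / r) (by positivity) ?_
    rw [← hv 0 h0, hs', hr', show η' 0 = η 1 + Real.pi + k * (2 * Real.pi) by linarith]
    have hr0 : (r : ℂ) ≠ 0 := by exact_mod_cast hr.ne'
    rw [show ((η 1 + Real.pi + k * (2 * Real.pi) : ℝ) : ℂ) * Complex.I =
      η 1 * Complex.I + Real.pi * Complex.I + k * (2 * Real.pi * Complex.I) by push_cast; ring,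
      Complex.exp_add, Complex.exp_add, Complex.exp_int_mul_two_pi_mul_I, Complex.exp_pi_mul_I]
    push_cast
    field_simp

lemma IsDeckTransformation.fderiv_eq {T T' : ℂ → ℂ} (h : S.IsDeckTransformation T)
    (h' : S.IsDeckTransformation T') {x : ℂ} (hx : x ∈ S.cover) (hT : T x = T' x) :
    fderiv ℝ T x = fderiv ℝ T' x :=
  Filter.EventuallyEq.fderiv_eq (Filter.eventuallyEq_of_mem (S.isOpen_cover.mem_nhds hx)
    (h.eqOn h' hx hT))

/-- The external angle does not depend on the parametrized geodesic outside `[0,1]` nor on its angle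
function: it is determined modulo `2π`, and lies in an interval of length `2π`. -/
lemma IsExternalAngle.eq_of_eqOn {d d' : ℝ → ℂ} {η η' : ℝ → ℝ} {χ χ' : ℝ}
    (hdd : EqOn d' d (Icc 0 1)) (hd : IsGeodesic S.cover S.metric d) (hη : IsAngleFunction d η)
    (hχ : S.IsExternalAngle d η χ) (hd' : IsGeodesic S.cover S.metric d')
    (hη' : IsAngleFunction d' η') (hχ' : S.IsExternalAngle d' η' χ') {T : ℂ → ℂ}
    (hT : S.IsDeckTransformation T) (hTd : T (d 0) = d 1) :
    χ' = χ := by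
  have h0 : (0 : ℝ) ∈ Icc (0 : ℝ) 1 := by simp
  have h1 : (1 : ℝ) ∈ Icc (0 : ℝ) 1 := by simp
  have hU : d 0 ∈ S.cover := hd.2.1 h0
  obtain ⟨k, hk⟩ := hη'.exists_int hη hdd
  obtain ⟨μ, α, hμ, hpos, hneg⟩ := hT.exists_angle hU
  have key : ∀ f : ℝ → ℝ, (∀ r t : ℝ, fderiv ℝ T (d 0) (r * Complex.exp (t * Complex.I)) =
      (μ * r : ℝ) * Complex.exp (f t * Complex.I)) →
      (∃ m : ℤ, f (η' 0) = f (η 0) + 2 * Real.pi * m) → χ' = χ := by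
    rintro f hf ⟨m, hm⟩
    obtain ⟨a, ha⟩ := exists_int_of_exp_eq' (hχ.exp_eq hd hη hT hTd hμ hf)
    obtain ⟨b, hb⟩ := exists_int_of_exp_eq' (hχ'.exp_eq hd' hη' hT
      (by rw [hdd h0, hdd h1]; exact hTd) hμ (by rw [hdd h0]; exact hf))
    rw [hk 1 h1, hm] at hb
    obtain ⟨-, -, -, -, -, l1, l2⟩ := hχ
    obtain ⟨-, -, -, -, -, l3, l4⟩ := hχ'
    have e : χ' - χ = 2 * Real.pi * ((b + m - k - a : ℤ) : ℝ) := by push_cast; linarith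
    have hz : (b + m - k - a : ℤ) = 0 := by
      have hp := Real.pi_pos
      have g1 : ((b + m - k - a : ℤ) : ℝ) < 1 := by
        by_contra hcon; push Not at hcon; nlinarith
      have g2 : (-1 : ℝ) < ((b + m - k - a : ℤ) : ℝ) := by
        by_contra hcon; push Not at hcon; nlinarith
      have g3 : (b + m - k - a : ℤ) < 1 := by exact_mod_cast g1
      have g4 : -1 < (b + m - k - a : ℤ) := by exact_mod_cast g2
      omega
    rw [hz] at e
    simp at e
    linarith
  rcases lt_or_gt_of_ne (show (fderiv ℝ T (d 0)).det ≠ 0 by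
    obtain ⟨a, -, h | h⟩ := hT.exists_mul hU
    exacts [h.1.ne', h.1.ne]) with hdet | hdet
  · exact key (fun t => α - t) (hneg hdet) ⟨-k, by rw [hk 0 h0]; push_cast; ring⟩
  · exact key (fun t => t + α) (hpos hdet) ⟨k, by rw [hk 0 h0]; ring⟩

variable {p : M}

/-- The based winding number of a curve whose lift ends at the image of `x` under an orientation
preserving deck transformation is the `i`-index of the lift, up to a constant depending only on the
end point. -/
lemma exists_isBasedWindingNumber_iff_of_pos (hS : S.IsTame) {x : ℂ} (hx : x ∈ S.cover) {T : ℂ → ℂ}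
    (hT : S.IsDeckTransformation T) (hdet : ∀ z ∈ S.cover, 0 < (fderiv ℝ T z).det) :
    ∃ b : ℝ, ∀ (γ : RegularClosedCurve p) (c : ℝ → ℂ) (θ : ℝ → ℝ), S.IsLift x γ.toFun c →
      c 1 = T x → IsAngleFunction c θ →
      ∃ n : ℤ, iIndex θ - b = n ∧ ∀ w, S.IsBasedWindingNumber x γ w ↔ w = Sum.inl n := by
  have h0 : (0 : ℝ) ∈ Icc (0 : ℝ) 1 := by simp
  have h1 : (1 : ℝ) ∈ Icc (0 : ℝ) 1 := by simp
  have hpi := Real.pi_ne_zero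
  obtain ⟨μ, α, hμ, hf, -⟩ := hT.exists_angle hx
  replace hf := hf (hdet x hx)
  have hopp : ∀ y, y = T x → ¬ S.OppositeOrientation x y := by
    rintro y rfl ⟨T', hT', hT'x, hdet'⟩
    have := hdet' x hx
    rw [hT'.fderiv_eq hT hx hT'x] at this
    exact lt_asymm this (hdet x hx)
  have hi : ∀ {c c' : ℝ → ℂ} {θ θ' : ℝ → ℝ}, IsAngleFunction c θ → IsAngleFunction c' θ' →
      EqOn c' c (Icc 0 1) → iIndex θ' = iIndex θ := by
    intro c c' θ θ' h h' hcc
    obtain ⟨k, hk⟩ := h'.exists_int h hcc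
    rw [iIndex, iIndex, hk 0 h0, hk 1 h1]; ring
  by_cases hxy : T x = x
  · refine ⟨0, fun γ c θ hc hc1 hθ => ?_⟩
    have hclass : γ.homotopyClass = 1 := (homotopyClass_eq_one_iff hx hc).2 (hc1.trans hxy)
    have hid := hT.fderiv_eq isDeckTransformation_id hx hxy
    obtain ⟨k, hk⟩ := exists_int_of_exp_eq' (hc.exp_angle_one hθ isDeckTransformation_id
      (hxy.symm.trans hc1.symm) (f := fun t => t) one_pos (fun r t => by simp))
    refine ⟨k, by rw [iIndex, hk]; field_simp; ring, fun w => ⟨fun hw => ?_, ?_⟩⟩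
    · have hik : iIndex θ = k := by rw [iIndex, hk]; field_simp; ring
      cases hw with
      | nullHomotopic n c' θ' hγ hc' hθ' hn =>
        rw [hi hθ hθ' (hc'.eqOn hc), hik] at hn
        rw [Int.cast_injective hn]
      | orientationPreserving n c' d θ' η χ hγ => exact absurd hclass hγ
      | orientationReversing n c' d θ' η χ hc' hθ' hε =>
        exact absurd hε (hopp _ ((hc'.eqOn hc h1).trans hc1))
    · rintro rfl
      exact .nullHomotopic k c θ hclass hc hθ (by rw [iIndex, hk]; field_simp; ring)
  · obtain ⟨d, hd, hduniq⟩ := hS.existsUnique_shortest x hx (T x) (hT.1.mapsTo hx)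
    have hd0 := hd.1.2.1
    have hd1 := hd.1.2.2
    have hTd : T (d 0) = d 1 := by rw [hd0, hd1]
    obtain ⟨η, χ, hη, hχ⟩ := exists_isExternalAngle hd.1.1
      (by rw [hd0, hd1]; exact fun h => hxy h.symm) hT hTd
    obtain ⟨l, hl⟩ := exists_int_of_exp_eq' (hχ.exp_eq hd.1.1 hη hT hTd hμ (f := fun t => t + α)
      (by rw [hd0]; exact hf))
    refine ⟨iIndex η + χ / (2 * Real.pi), fun γ c θ hc hc1 hθ => ?_⟩
    have hclass : γ.homotopyClass ≠ 1 := fun h =>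
      hxy (hc1.symm.trans ((homotopyClass_eq_one_iff hx hc).1 h))
    obtain ⟨k, hk⟩ := exists_int_of_exp_eq' (hc.exp_angle_one hθ hT hc1.symm
      (f := fun t => t + α) hμ hf)
    have hn : iIndex θ - iIndex η - χ / (2 * Real.pi) = ((k - l : ℤ) : ℝ) := by
      rw [iIndex, iIndex, hk, show χ = η 0 + α + 2 * Real.pi * l - η 1 by linarith]
      push_cast
      field_simp; ring
    refine ⟨k - l, by linarith, fun w => ⟨fun hw => ?_, ?_⟩⟩
    · cases hw with
      | nullHomotopic n c' θ' hγ => exact absurd hγ hclass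
      | orientationPreserving n c' d' θ' η' χ' _ hc' hθ' _ hd' hη' hχ' hn' =>
        rw [(hc'.eqOn hc h1).trans hc1] at hd'
        have hdd := hduniq d' hd'
        rw [hi hθ hθ' (hc'.eqOn hc), hi hη hη' hdd,
          hχ.eq_of_eqOn hdd hd.1.1 hη hd'.1.1 hη' hχ' hT hTd, hn] at hn'
        rw [Int.cast_injective hn']
      | orientationReversing n c' d θ' η χ hc' hθ' hε =>
        exact absurd hε (hopp _ ((hc'.eqOn hc h1).trans hc1))
    · rintro rfl
      exact .orientationPreserving _ c d θ η χ hclass hc hθ ⟨T, hT, hc1.symm, hdet⟩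
        (by rw [hc1]; exact hd) hη hχ hn

/-- The based winding number of a curve whose lift ends at the image of `x` under an orientation
reversing deck transformation is the `j`-index of the lift modulo `2`, up to a constant depending
only on the end point. -/
lemma exists_isBasedWindingNumber_iff_of_neg (hS : S.IsTame) {x : ℂ} (hx : x ∈ S.cover) {T : ℂ → ℂ}
    (hT : S.IsDeckTransformation T) (hdet : ∀ z ∈ S.cover, (fderiv ℝ T z).det < 0) :
    ∃ b : ℝ, ∀ (γ : RegularClosedCurve p) (c : ℝ → ℂ) (θ : ℝ → ℝ), S.IsLift x γ.toFun c →
      c 1 = T x → IsAngleFunction c θ →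
      ∃ n : ℤ, jIndex θ - b = n ∧ ∀ w, S.IsBasedWindingNumber x γ w ↔ w = Sum.inr (n : ZMod 2) := by
  have h0 : (0 : ℝ) ∈ Icc (0 : ℝ) 1 := by simp
  have h1 : (1 : ℝ) ∈ Icc (0 : ℝ) 1 := by simp
  have hpi := Real.pi_ne_zero
  obtain ⟨μ, α, hμ, -, hf⟩ := hT.exists_angle hx
  replace hf := hf (hdet x hx)
  have hsame : ∀ y, y = T x → ¬ S.SameOrientation x y := by
    rintro y rfl ⟨T', hT', hT'x, hdet'⟩
    have := hdet' x hx
    rw [hT'.fderiv_eq hT hx hT'x] at this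
    exact lt_asymm this (hdet x hx)
  have hj : ∀ {c c' : ℝ → ℂ} {θ θ' : ℝ → ℝ}, IsAngleFunction c θ → IsAngleFunction c' θ' →
      EqOn c' c (Icc 0 1) → ∃ k : ℤ, jIndex θ' = jIndex θ + 2 * k := by
    intro c c' θ θ' h h' hcc
    obtain ⟨k, hk⟩ := h'.exists_int h hcc
    refine ⟨k, ?_⟩
    rw [jIndex, jIndex, hk 0 h0, hk 1 h1]; field_simp; ring
  have hxy : T x ≠ x := fun hxy => hsame x hxy.symm
    ⟨id, isDeckTransformation_id, rfl, fun z _ => by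
      rw [fderiv_id, det_eq]; simp⟩
  obtain ⟨d, hd, hduniq⟩ := hS.existsUnique_shortest x hx (T x) (hT.1.mapsTo hx)
  have hd0 := hd.1.2.1
  have hd1 := hd.1.2.2
  have hTd : T (d 0) = d 1 := by rw [hd0, hd1]
  obtain ⟨η, χ, hη, hχ⟩ := exists_isExternalAngle hd.1.1
    (by rw [hd0, hd1]; exact fun h => hxy h.symm) hT hTd
  obtain ⟨l, hl⟩ := exists_int_of_exp_eq' (hχ.exp_eq hd.1.1 hη hT hTd hμ (f := fun t => α - t)
    (by rw [hd0]; exact hf))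
  refine ⟨jIndex η + χ / (2 * Real.pi), fun γ c θ hc hc1 hθ => ?_⟩
  have hclass : γ.homotopyClass ≠ 1 := fun h =>
    hxy (hc1.symm.trans ((homotopyClass_eq_one_iff hx hc).1 h))
  obtain ⟨k, hk⟩ := exists_int_of_exp_eq' (hc.exp_angle_one hθ hT hc1.symm
    (f := fun t => α - t) hμ hf)
  have hn : jIndex θ - jIndex η - χ / (2 * Real.pi) = ((k - l : ℤ) : ℝ) := by
    rw [jIndex, jIndex, hk, show χ = α - η 0 + 2 * Real.pi * l - η 1 by linarith]
    push_cast
    field_simp; ring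
  refine ⟨k - l, by linarith, fun w => ⟨fun hw => ?_, ?_⟩⟩
  · cases hw with
    | nullHomotopic n c' θ' hγ => exact absurd hγ hclass
    | orientationPreserving n c' d θ' η χ _ hc' hθ' hε =>
      exact absurd hε (hsame _ ((hc'.eqOn hc h1).trans hc1))
    | orientationReversing n c' d' θ' η' χ' hc' hθ' _ hd' hη' hχ' hn' =>
      rw [(hc'.eqOn hc h1).trans hc1] at hd'
      have hdd := hduniq d' hd'
      obtain ⟨a, ha⟩ := hj hθ hθ' (hc'.eqOn hc)
      obtain ⟨b, hb⟩ := hj hη hη' hdd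
      rw [ha, hb, hχ.eq_of_eqOn hdd hd.1.1 hη hd'.1.1 hη' hχ' hT hTd] at hn'
      have e : (n : ℝ) = ((k - l + 2 * (a - b) : ℤ) : ℝ) := by
        push_cast at hn ⊢; linarith
      rw [Int.cast_injective e]
      have h2 : (2 : ZMod 2) = 0 := rfl
      push_cast
      rw [h2, zero_mul, add_zero]
  · rintro rfl
    exact .orientationReversing _ c d θ η χ hc hθ ⟨T, hT, hc1.symm, hdet⟩
      (by rw [hc1]; exact hd) hη hχ hn

theorem existsUnique_isBasedWindingNumber (hS : S.IsTame) {x : ℂ} (hx : x ∈ S.cover)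
    (hp : S.proj x = p) (γ : RegularClosedCurve p) : ∃! w, S.IsBasedWindingNumber x γ w := by
  obtain ⟨c, hc⟩ := exists_isLift hx γ.contMDiffOn.continuousOn (γ.source.trans hp.symm)
  obtain ⟨θ, hθ⟩ := hc.exists_isAngleFunction
  have h1 : (1 : ℝ) ∈ Icc (0 : ℝ) 1 := by simp
  obtain ⟨T, hT, hTx⟩ := exists_isDeckTransformation hx (hc.2.1 h1)
    (by rw [hp, hc.2.2.1 1 h1, γ.target])
  rcases hT.det_pos_or_neg with hdet | hdet
  · obtain ⟨b, hb⟩ := exists_isBasedWindingNumber_iff_of_pos (p := p) hS hx hT hdet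
    obtain ⟨n, -, hn⟩ := hb γ c θ hc hTx.symm hθ
    exact ⟨_, (hn _).2 rfl, fun w hw => (hn w).1 hw⟩
  · obtain ⟨b, hb⟩ := exists_isBasedWindingNumber_iff_of_neg (p := p) hS hx hT hdet
    obtain ⟨n, -, hn⟩ := hb γ c θ hc hTx.symm hθ
    exact ⟨_, (hn _).2 rfl, fun w hw => (hn w).1 hw⟩

lemma basedWindingNumber_eq {x : ℂ} {γ : RegularClosedCurve p} {w₀ : ℤ ⊕ ZMod 2}
    (h : ∀ w, S.IsBasedWindingNumber x γ w ↔ w = w₀) : S.basedWindingNumber x γ = w₀ :=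
  (h _).1 (Classical.epsilon_spec ⟨w₀, (h w₀).2 rfl⟩)

lemma basedWindingNumber_eq_iff_of_pos (hS : S.IsTame) {x : ℂ} (hx : x ∈ S.cover) {T : ℂ → ℂ}
    (hT : S.IsDeckTransformation T) (hdet : ∀ z ∈ S.cover, 0 < (fderiv ℝ T z).det)
    {γ₁ γ₂ : RegularClosedCurve p} {c₁ c₂ : ℝ → ℂ} {θ₁ θ₂ : ℝ → ℝ} (hc₁ : S.IsLift x γ₁.toFun c₁)
    (hc₂ : S.IsLift x γ₂.toFun c₂) (h₁ : c₁ 1 = T x) (h₂ : c₂ 1 = T x)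
    (hθ₁ : IsAngleFunction c₁ θ₁) (hθ₂ : IsAngleFunction c₂ θ₂) :
    S.basedWindingNumber x γ₁ = S.basedWindingNumber x γ₂ ↔
      θ₁ 1 - θ₁ 0 = θ₂ 1 - θ₂ 0 := by
  obtain ⟨b, hb⟩ := exists_isBasedWindingNumber_iff_of_pos (p := p) hS hx hT hdet
  obtain ⟨n₁, e₁, hn₁⟩ := hb γ₁ c₁ θ₁ hc₁ h₁ hθ₁
  obtain ⟨n₂, e₂, hn₂⟩ := hb γ₂ c₂ θ₂ hc₂ h₂ hθ₂
  rw [basedWindingNumber_eq hn₁, basedWindingNumber_eq hn₂, Sum.inl.injEq,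
    ← Int.cast_inj (α := ℝ), ← e₁, ← e₂, sub_left_inj, iIndex, iIndex,
    div_left_inj' (by positivity)]

lemma basedWindingNumber_eq_iff_of_neg (hS : S.IsTame) {x : ℂ} (hx : x ∈ S.cover) {T : ℂ → ℂ}
    (hT : S.IsDeckTransformation T) (hdet : ∀ z ∈ S.cover, (fderiv ℝ T z).det < 0)
    {γ₁ γ₂ : RegularClosedCurve p} {c₁ c₂ : ℝ → ℂ} {θ₁ θ₂ : ℝ → ℝ} (hc₁ : S.IsLift x γ₁.toFun c₁)
    (hc₂ : S.IsLift x γ₂.toFun c₂) (h₁ : c₁ 1 = T x) (h₂ : c₂ 1 = T x)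
    (hθ₁ : IsAngleFunction c₁ θ₁) (hθ₂ : IsAngleFunction c₂ θ₂) :
    S.basedWindingNumber x γ₁ = S.basedWindingNumber x γ₂ ↔
      ∃ k : ℤ, θ₁ 1 + θ₁ 0 = θ₂ 1 + θ₂ 0 + 4 * Real.pi * k := by
  obtain ⟨b, hb⟩ := exists_isBasedWindingNumber_iff_of_neg (p := p) hS hx hT hdet
  obtain ⟨n₁, e₁, hn₁⟩ := hb γ₁ c₁ θ₁ hc₁ h₁ hθ₁
  obtain ⟨n₂, e₂, hn₂⟩ := hb γ₂ c₂ θ₂ hc₂ h₂ hθ₂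
  have hpi := Real.pi_ne_zero
  rw [basedWindingNumber_eq hn₁, basedWindingNumber_eq hn₂, Sum.inr.injEq,
    eq_comm, ZMod.intCast_eq_intCast_iff_dvd_sub]
  have e : (θ₁ 1 + θ₁ 0) - (θ₂ 1 + θ₂ 0) = 2 * Real.pi * (n₁ - n₂) := by
    rw [← e₁, ← e₂, jIndex, jIndex]; field_simp; ring
  constructor
  · rintro ⟨k, hk⟩
    refine ⟨k, ?_⟩
    have : (n₁ - n₂ : ℝ) = 2 * k := by exact_mod_cast hk
    rw [this] at e
    linarith
  · rintro ⟨k, hk⟩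
    refine ⟨k, ?_⟩
    have : (n₁ - n₂ : ℝ) = 2 * k := by
      have : 2 * Real.pi * (n₁ - n₂ : ℝ) = 2 * Real.pi * (2 * k) := by linarith
      exact mul_left_cancel₀ (by positivity) this
    exact_mod_cast this

end ConformallyEuclideanStructure

end WindingNumber

/-! ### Invariance under regular homotopy -/

section Invariance

variable {M : Type*} [TopologicalSpace M] [ChartedSpace (EuclideanSpace ℝ (Fin 2)) M]
  [IsManifold (𝓡 2) ∞ M]
  {g : ContMDiffRiemannianMetric (𝓡 2) ∞ (EuclideanSpace ℝ (Fin 2))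
    (fun x : M => TangentSpace (𝓡 2) x)}

namespace ConformallyEuclideanStructure

variable {S : ConformallyEuclideanStructure g}

/-- The differential of the projection has a continuous local left inverse. -/
lemma exists_pushforward_left_inverse {z₀ : ℂ} (hz₀ : z₀ ∈ S.cover) :
    ∃ Q : TangentBundle (𝓡 2) M → ℂ, (∀ v, ContinuousAt Q (S.pushforward z₀ v)) ∧
      ∀ᶠ z in 𝓝 z₀, ∀ v, Q (S.pushforward z v) = v := by
  obtain ⟨q, N, hN, hzN, hq, hqz⟩ := S.exists_local_left_inverse hz₀
  refine ⟨fun ξ => tangentBundleModelSpaceHomeomorph 𝓘(ℝ, ℂ)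
    (tangentMapWithin (𝓡 2) 𝓘(ℝ, ℂ) q N ξ) |>.2, fun v => ?_, ?_⟩
  · have h1 := hq.continuousOn_tangentMapWithin (by norm_num) hN.uniqueMDiffOn
    have h2 : IsOpen (TotalSpace.proj ⁻¹' N : Set (TangentBundle (𝓡 2) M)) :=
      hN.preimage (FiberBundle.continuous_proj (EuclideanSpace ℝ (Fin 2)) (TangentSpace (𝓡 2)))
    have h3 := h1.continuousAt (h2.mem_nhds (x := S.pushforward z₀ v) hzN)
    exact continuous_snd.continuousAt.comp
      ((tangentBundleModelSpaceHomeomorph 𝓘(ℝ, ℂ)).continuous.continuousAt.comp h3)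
  · have hcont : ContinuousAt S.proj z₀ := (S.contMDiffAt_proj hz₀).continuousAt
    filter_upwards [hqz.eventually_nhds, S.isOpen_cover.mem_nhds hz₀, hcont (hN.mem_nhds hzN)]
      with z hz hzU hzN' v
    have e1 : mfderivWithin (𝓡 2) 𝓘(ℝ, ℂ) q N (S.proj z) = mfderiv (𝓡 2) 𝓘(ℝ, ℂ) q (S.proj z) :=
      mfderivWithin_of_isOpen hN hzN'
    have e2 := mfderiv_comp (I := 𝓘(ℝ, ℂ)) (I' := 𝓡 2) (I'' := 𝓘(ℝ, ℂ)) z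
      ((hq.contMDiffAt (hN.mem_nhds hzN')).mdifferentiableAt (by norm_num))
      (S.mdifferentiableAt_proj hzU)
    have e3 : q ∘ S.proj =ᶠ[𝓝 z] id := hz
    rw [mfderiv_eq_fderiv, e3.fderiv_eq, fderiv_id] at e2
    have e4 : v = mfderiv (𝓡 2) 𝓘(ℝ, ℂ) q (S.proj z) (mfderiv 𝓘(ℝ, ℂ) (𝓡 2) S.proj z v) :=
      congrArg (fun L : ℂ →L[ℝ] ℂ => L v) e2
    change mfderivWithin (𝓡 2) 𝓘(ℝ, ℂ) q N (S.proj z) (mfderiv 𝓘(ℝ, ℂ) (𝓡 2) S.proj z v) = v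
    rw [e1]
    exact e4.symm

lemma IsLift.congr {x : ℂ} {γ γ' : ℝ → M} {c : ℝ → ℂ} (h : S.IsLift x γ c)
    (hγ : EqOn γ γ' (Icc 0 1)) : S.IsLift x γ' c :=
  ⟨h.1, h.2.1, fun t ht => (h.2.2.1 t ht).trans (hγ ht), h.2.2.2⟩

variable {p : M}

/-- A regular homotopy lifts to the cover, with fixed end points and continuous velocities. -/
lemma exists_lift_homotopy {x : ℂ} (hx : x ∈ S.cover) (hp : S.proj x = p)
    (σ : unitInterval → RegularClosedCurve p)
    (hσ : ContinuousOn (fun q : unitInterval × ℝ =>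
      (⟨(σ q.1).toFun q.2, velocity (σ q.1).toFun q.2⟩ : TangentBundle (𝓡 2) M))
      (univ ×ˢ Icc (0 : ℝ) 1)) :
    ∃ c : unitInterval → ℝ → ℂ, (∀ t, S.IsLift x (σ t).toFun (c t)) ∧ (∀ t, c t 1 = c 0 1) ∧
      ContinuousOn (fun q : unitInterval × ℝ => planeVelocity (c q.1) q.2)
        (univ ×ˢ Icc (0 : ℝ) 1) := by
  have hpos : ContinuousOn (fun q : unitInterval × ℝ => (σ q.1).toFun q.2)
      (univ ×ˢ Icc (0 : ℝ) 1) :=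
    (FiberBundle.continuous_proj (EuclideanSpace ℝ (Fin 2)) (TangentSpace (𝓡 2))).comp_continuousOn hσ
  -- in the lifted homotopy the parameter of the curves comes first
  let H : C(unitInterval × unitInterval, M) := ⟨fun q => (σ q.2).toFun q.1,
    hpos.comp_continuous (f := fun q : unitInterval × unitInterval => (q.2, (q.1 : ℝ)))
      (by fun_prop) fun q => ⟨trivial, q.1.2⟩⟩
  let x₀ : S.cover := ⟨x, hx⟩
  have H0 : ∀ t, H (0, t) = S.cover.domRestrict S.proj ((ContinuousMap.const unitInterval x₀) t) :=
    fun t => ((σ t).source).trans hp.symm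
  let L := S.isCoveringMap_proj.liftHomotopy H (ContinuousMap.const _ x₀) H0
  have hL : ∀ q, S.proj (L q) = H q := fun q =>
    congrFun (S.isCoveringMap_proj.liftHomotopy_lifts H (ContinuousMap.const _ x₀) H0) q
  have hL0 : ∀ t, L (0, t) = x₀ := fun t =>
    S.isCoveringMap_proj.liftHomotopy_zero H (ContinuousMap.const _ x₀) H0 t
  have hL1 : ∀ t, L (1, t) = L (1, 0) := fun t =>
    S.isCoveringMap_proj.const_of_comp (g := fun t => L (1, t))
      (L.continuous.comp (by fun_prop)) (fun a a' => by
        have h : ∀ a, S.proj (L (1, a)) = p := fun a => (hL _).trans (σ a).target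
        exact (h a).trans (h a').symm) t 0
  let c : unitInterval → ℝ → ℂ := fun t u => L (projIcc 0 1 zero_le_one u, t)
  have hcc : Continuous fun q : unitInterval × ℝ => c q.1 q.2 :=
    continuous_subtype_val.comp (L.continuous.comp
      ((continuous_projIcc.comp continuous_snd).prodMk continuous_fst))
  have hlift : ∀ t, S.IsLift x (σ t).toFun (c t) := fun t =>
    ⟨(hcc.comp (by fun_prop : Continuous fun u : ℝ => (t, u))).continuousOn, fun u _ => (L _).2,
      fun u hu => by
        simp only [c]
        rw [hL]
        simp only [H, ContinuousMap.coe_mk, projIcc_of_mem _ hu], by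
      have : projIcc (0 : ℝ) 1 zero_le_one 0 = 0 := projIcc_left _
      simp only [c, this, hL0]; rfl⟩
  refine ⟨c, hlift, fun t => ?_, ?_⟩
  · have : projIcc (0 : ℝ) 1 zero_le_one 1 = 1 := projIcc_right _
    simp only [c, this, hL1 t]
  · rintro ⟨t, u⟩ ⟨-, hu⟩
    obtain ⟨Q, hQ, hQz⟩ := exists_pushforward_left_inverse ((hlift t).2.1 hu)
    have e := (hlift t).pushforward hu
    have h1 := hQ (planeVelocity (c t) u)
    rw [e] at h1
    have h2 := ContinuousAt.comp_continuousWithinAt (f := fun q : unitInterval × ℝ =>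
      (⟨(σ q.1).toFun q.2, velocity (σ q.1).toFun q.2⟩ : TangentBundle (𝓡 2) M)) h1
      (hσ (t, u) ⟨trivial, hu⟩)
    have h3 : ∀ᶠ q : unitInterval × ℝ in 𝓝[univ ×ˢ Icc (0 : ℝ) 1] (t, u),
        planeVelocity (c q.1) q.2 =
          Q ⟨(σ q.1).toFun q.2, velocity (σ q.1).toFun q.2⟩ := by
      filter_upwards [nhdsWithin_le_nhds ((hcc.tendsto (t, u)).eventually hQz),
        self_mem_nhdsWithin] with q hq hq'
      rw [← (hlift q.1).pushforward hq'.2, hq]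
    exact h2.congr_of_eventuallyEq h3 (h3.self_of_nhdsWithin ⟨trivial, hu⟩)

/-- A continuous family of regular curves has a continuous family of angle functions. -/
lemma exists_angle_family {c : unitInterval → ℝ → ℂ}
    (hc : ContinuousOn (fun q : unitInterval × ℝ => planeVelocity (c q.1) q.2)
        (univ ×ˢ Icc (0 : ℝ) 1))
    (hne : ∀ t, ∀ u ∈ Icc (0 : ℝ) 1, planeVelocity (c t) u ≠ 0) :
    ∃ θ : unitInterval → ℝ → ℝ, (∀ t, IsAngleFunction (c t) (θ t)) ∧
      ∀ u, Continuous fun t => θ t u := by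
  let V : C(ℝ × ℝ, ℂ) := ⟨fun q => planeVelocity (c (projIcc 0 1 zero_le_one q.1))
      (projIcc (0 : ℝ) 1 zero_le_one q.2),
    hc.comp_continuous (f := fun q : ℝ × ℝ => ((projIcc 0 1 zero_le_one q.1 : unitInterval),
      ((projIcc (0 : ℝ) 1 zero_le_one q.2 : Icc (0 : ℝ) 1) : ℝ)))
      ((continuous_projIcc.comp continuous_fst).prodMk
        (continuous_subtype_val.comp (continuous_projIcc.comp continuous_snd)))
      fun q => ⟨trivial, (projIcc (0 : ℝ) 1 zero_le_one q.2).2⟩⟩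
  obtain ⟨Θ, hΘ⟩ := exists_continuous_angle V fun q => hne _ _ (projIcc (0 : ℝ) 1 zero_le_one q.2).2
  refine ⟨fun t u => Θ (t, u), fun t => ⟨by fun_prop, fun u hu => ?_⟩, fun u => by fun_prop⟩
  have := hΘ (t, u)
  simp only [V, ContinuousMap.coe_mk, projIcc_of_mem _ hu, projIcc_val] at this
  exact (div_norm_eq_exp_iff (hne t u hu)).2 this

lemma RegularlyHomotopicFixingBasePoint.invariants (hS : S.IsTame) {x : ℂ} (hx : x ∈ S.cover)
    (hp : S.proj x = p) {γ₁ γ₂ : RegularClosedCurve p}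
    (h : RegularlyHomotopicFixingBasePoint γ₁ γ₂) :
    γ₁.homotopyClass = γ₂.homotopyClass ∧
      S.basedWindingNumber x γ₁ = S.basedWindingNumber x γ₂ := by
  obtain ⟨σ, hσ, hσ₁, hσ₂⟩ := h
  obtain ⟨c, hlift, hc1, hvel⟩ := exists_lift_homotopy hx hp σ hσ
  obtain ⟨θ, hθ, hθc⟩ := exists_angle_family hvel fun t u hu => (hlift t).planeVelocity_ne_zero hu
  have h1 : (1 : ℝ) ∈ Icc (0 : ℝ) 1 := by simp
  obtain ⟨T, hT, hTx⟩ := exists_isDeckTransformation hx ((hlift 0).2.1 h1)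
    (by rw [hp, (hlift 0).2.2.1 1 h1, (σ 0).target])
  have hl₁ := (hlift 0).congr hσ₁
  have hl₂ := (hlift 1).congr hσ₂
  refine ⟨(homotopyClass_eq_iff hx hl₁ hl₂).2 (hc1 1).symm, ?_⟩
  obtain ⟨μ, α, hμ, hpos, hneg⟩ := hT.exists_angle hx
  rcases hT.det_pos_or_neg with hdet | hdet
  · rw [basedWindingNumber_eq_iff_of_pos hS hx hT hdet hl₁ hl₂ hTx.symm ((hc1 1).trans hTx.symm)
      (hθ 0) (hθ 1)]
    obtain ⟨k, hk⟩ := exists_int_of_exp_eq (s := univ) isPreconnected_univ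
      (f := fun t => θ t 1) (g := fun t => θ t 0 + α) (hθc 1).continuousOn
      ((hθc 0).add continuous_const).continuousOn
      (fun t _ => (hlift t).exp_angle_one (hθ t) hT (hTx.trans (hc1 t).symm) hμ
        (f := fun s => s + α) (hpos (hdet x hx)))
    have e0 := hk 0 trivial
    have e1 := hk 1 trivial
    linarith
  · rw [basedWindingNumber_eq_iff_of_neg hS hx hT hdet hl₁ hl₂ hTx.symm ((hc1 1).trans hTx.symm)
      (hθ 0) (hθ 1)]
    obtain ⟨k, hk⟩ := exists_int_of_exp_eq (s := univ) isPreconnected_univ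
      (f := fun t => θ t 1) (g := fun t => α - θ t 0) (hθc 1).continuousOn
      (continuous_const.sub (hθc 0)).continuousOn
      (fun t _ => (hlift t).exp_angle_one (hθ t) hT (hTx.trans (hc1 t).symm) hμ
        (f := fun s => α - s) (hneg (hdet x hx)))
    have e0 := hk 0 trivial
    have e1 := hk 1 trivial
    exact ⟨0, by push_cast; linarith⟩

end ConformallyEuclideanStructure

end Invariance

/-! ### Construction of regular homotopies -/

section Construction

variable {M : Type*} [TopologicalSpace M] [ChartedSpace (EuclideanSpace ℝ (Fin 2)) M]
  [IsManifold (𝓡 2) ∞ M]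
  {g : ContMDiffRiemannianMetric (𝓡 2) ∞ (EuclideanSpace ℝ (Fin 2))
    (fun x : M => TangentSpace (𝓡 2) x)}

lemma integral_extendUnit_planeVelocity {c : ℝ → ℂ} (hc : ContDiffOn ℝ 1 c (Icc 0 1)) {u : ℝ}
    (hu : u ∈ Icc (0 : ℝ) 1) :
    ∫ s in (0 : ℝ)..u, extendUnit (planeVelocity c) s = c u - c 0 := by
  have hcont : ContinuousOn (planeVelocity c) (Icc 0 1) :=
    hc.continuousOn_derivWithin (uniqueDiffOn_Icc one_pos) le_rfl
  refine intervalIntegral.integral_eq_sub_of_hasDerivAt_of_le hu.1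
    (hc.continuousOn.mono (Icc_subset_Icc_right hu.2)) (fun s hs => ?_)
    ((continuous_extendUnit hcont).intervalIntegrable _ _)
  have hs' : s ∈ Ioo (0 : ℝ) 1 := ⟨hs.1, hs.2.trans_le hu.2⟩
  rw [extendUnit_eq (Ioo_subset_Icc_self hs')]
  exact ((hc.differentiableOn (by simp) s (Ioo_subset_Icc_self hs')).hasDerivWithinAt).hasDerivAt
    (Icc_mem_nhds hs'.1 hs'.2)

namespace ConformallyEuclideanStructure

variable {S : ConformallyEuclideanStructure g} {p : M}

/-- Velocity fields which can be deformed to one another in the plane, with the closing condition of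
regular closed curves at the ends, come from regularly homotopic curves: a regular map of the plane
into the cover, which is the identity near the ends, moves the homotopy into the cover. -/
lemma regularlyHomotopic_of_joinedIn (hS : S.IsTame) {x : ℂ} (hx : x ∈ S.cover) {T : ℂ → ℂ}
    (hT : S.IsDeckTransformation T) {γ₁ γ₂ : RegularClosedCurve p} {c₁ c₂ : ℝ → ℂ}
    (hc₁ : S.IsLift x γ₁.toFun c₁) (hc₂ : S.IsLift x γ₂.toFun c₂) (hp : S.proj x = p)
    {V₁ V₂ : C(ℝ, ℂ)} (hV₁ : ⇑V₁ = extendUnit (planeVelocity c₁))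
    (hV₂ : ⇑V₂ = extendUnit (planeVelocity c₂))
    (hJ : JoinedIn (velocityFields (T x - x) fun a b => ∃ r : ℝ, 0 < r ∧ b = fderiv ℝ T x (r * a))
      V₁ V₂) :
    RegularlyHomotopicFixingBasePoint γ₁ γ₂ := by
  have h0 : (0 : ℝ) ∈ Icc (0 : ℝ) 1 := by simp
  have h1 : (1 : ℝ) ∈ Icc (0 : ℝ) 1 := by simp
  have hTx := hT.1.mapsTo hx
  obtain ⟨P, hP⟩ := hJ
  -- the homotopy in the plane
  let V : unitInterval → ℝ → ℂ := fun t u => P t u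
  have hVc : Continuous fun q : unitInterval × ℝ => V q.1 q.2 :=
    continuous_eval.comp ((P.continuous.comp continuous_fst).prodMk continuous_snd)
  have hVc' : ∀ t, Continuous (V t) := fun t => (P t).continuous
  let C : unitInterval → ℝ → ℂ := fun t u => x + ∫ s in (0 : ℝ)..u, V t s
  have hCc : Continuous fun q : unitInterval × ℝ => C q.1 q.2 := by
    refine continuous_const.add ?_
    exact intervalIntegral.continuous_parametric_intervalIntegral_of_continuous
      (f := fun (q : unitInterval × ℝ) s => V q.1 s)
      (hVc.comp (by fun_prop : Continuous fun q : (unitInterval × ℝ) × ℝ => (q.1.1, q.2)))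
      continuous_snd
  have hCd : ∀ t u, HasDerivAt (C t) (V t u) u := fun t u =>
    (intervalIntegral.integral_hasDerivAt_right ((hVc' t).intervalIntegrable _ _)
      ((hVc' t).stronglyMeasurableAtFilter _ _) (hVc' t).continuousAt).const_add x
  have hC0 : ∀ t, C t 0 = x := fun t => by simp [C]
  have hC1 : ∀ t, C t 1 = T x := fun t => by
    have := (hP t).2.1
    simp only [C, V, this]; ring
  have hCfirst : EqOn (C 0) c₁ (Icc 0 1) := fun u hu => by
    simp only [C, V, P.source, hV₁]
    rw [integral_extendUnit_planeVelocity (hc₁.contDiffOn γ₁.contMDiffOn) hu, hc₁.2.2.2]; ring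
  have hClast : EqOn (C 1) c₂ (Icc 0 1) := fun u hu => by
    simp only [C, V, P.target, hV₂]
    rw [integral_extendUnit_planeVelocity (hc₂.contDiffOn γ₂.contMDiffOn) hu, hc₂.2.2.2]; ring
  -- the regular map into the cover
  obtain ⟨r₁, hr₁, hb₁⟩ := Metric.nhds_basis_closedBall.mem_iff.1 (S.isOpen_cover.mem_nhds hx)
  obtain ⟨r₂, hr₂, hb₂⟩ := Metric.nhds_basis_closedBall.mem_iff.1 (S.isOpen_cover.mem_nhds hTx)
  let K : Set ℂ := (c₁ '' Icc 0 1 ∪ c₂ '' Icc 0 1) ∪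
    (Metric.closedBall x r₁ ∪ Metric.closedBall (T x) r₂)
  obtain ⟨f, hf1, hfinj, hfU, hfK⟩ := hS.exists_regularMap K
    (((isCompact_Icc.image_of_continuousOn hc₁.1).union
      (isCompact_Icc.image_of_continuousOn hc₂.1)).union
      ((isCompact_closedBall _ _).union (isCompact_closedBall _ _)))
    (union_subset (union_subset hc₁.2.1.image_subset hc₂.2.1.image_subset) (union_subset hb₁ hb₂))
  have hfx : f x = x := hfK (Or.inr (Or.inl (Metric.mem_closedBall_self hr₁.le)))
  have hfTx : f (T x) = T x := hfK (Or.inr (Or.inr (Metric.mem_closedBall_self hr₂.le)))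
  have hdfx : fderiv ℝ f x = ContinuousLinearMap.id ℝ ℂ := by
    rw [Filter.EventuallyEq.fderiv_eq (f := id) (Filter.eventuallyEq_of_mem
      (Metric.closedBall_mem_nhds x hr₁) fun z hz => hfK (Or.inr (Or.inl hz))), fderiv_id]
  have hdfTx : fderiv ℝ f (T x) = ContinuousLinearMap.id ℝ ℂ := by
    rw [Filter.EventuallyEq.fderiv_eq (f := id) (Filter.eventuallyEq_of_mem
      (Metric.closedBall_mem_nhds (T x) hr₂) fun z hz => hfK (Or.inr (Or.inr hz))), fderiv_id]
  -- the homotopy in the cover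
  let D : unitInterval → ℝ → ℂ := fun t u => f (C t u)
  let W : unitInterval → ℝ → ℂ := fun t u => fderiv ℝ f (C t u) (V t u)
  have hDd : ∀ t u, HasDerivAt (D t) (W t u) u := fun t u =>
    ((hf1.differentiable (by simp)) (C t u)).hasFDerivAt.comp_hasDerivAt u (hCd t u)
  have hWc : Continuous fun q : unitInterval × ℝ => W q.1 q.2 :=
    ((hf1.continuous_fderiv (by simp)).comp hCc).clm_apply hVc
  have hDc : Continuous fun q : unitInterval × ℝ => D q.1 q.2 := hf1.continuous.comp hCc
  have hDU : ∀ t u, D t u ∈ S.cover := fun t u => hfU _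
  have hD1 : ∀ t, ContDiff ℝ 1 (D t) := fun t => by
    rw [contDiff_one_iff_deriv]
    refine ⟨fun u => (hDd t u).differentiableAt, ?_⟩
    rw [show deriv (D t) = W t from funext fun u => (hDd t u).deriv]
    exact hWc.comp (by fun_prop : Continuous fun u : ℝ => (t, u))
  have hvel : ∀ t, ∀ u ∈ Icc (0 : ℝ) 1, planeVelocity (D t) u = W t u := fun t u hu =>
    (hDd t u).hasDerivWithinAt.derivWithin (uniqueDiffOn_Icc one_pos u hu)
  have hpush : ∀ t, ∀ u ∈ Icc (0 : ℝ) 1, S.pushforward (D t u) (W t u) =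
      ⟨S.proj (D t u), velocity (fun s => S.proj (D t s)) u⟩ := fun t u hu => by
    rw [← hvel t u hu]
    exact pushforward_velocity (fun _ _ => rfl) hu (hDd t u).differentiableAt.differentiableWithinAt
      (hDU t u)
  have hD0 : ∀ t, D t 0 = x := fun t => by simp only [D, hC0, hfx]
  have hD1' : ∀ t, D t 1 = T x := fun t => by simp only [D, hC1, hfTx]
  let σ : unitInterval → RegularClosedCurve p := fun t =>
    { toFun := fun u => S.proj (D t u)
      contMDiffOn := fun u hu => (((S.contMDiffAt_proj (hDU t u)).of_le (by simp)).comp u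
        (hD1 t).contMDiff.contMDiffAt).contMDiffWithinAt
      velocity_ne_zero := fun u hu h => by
        rw [velocity_proj_comp hu (hDd t u).differentiableAt.differentiableWithinAt (hDU t u),
          hvel t u hu] at h
        have h2 : W t u = 0 := S.mfderiv_proj_injective (hDU t u)
          (h.trans (map_zero (mfderiv 𝓘(ℝ, ℂ) (𝓡 2) S.proj (D t u))).symm)
        exact (hP t).1 u (hfinj (C t u) (h2.trans (map_zero (fderiv ℝ f (C t u))).symm))
      source := by rw [hD0, hp]
      target := by rw [hD1', hT.2.2 x hx, hp]
      direction_eq := by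
        obtain ⟨r, hr, hrV⟩ := (hP t).2.2
        refine ⟨r, hr, ?_⟩
        have e0 := pushforward_smul_congr (hpush t 0 h0) r
        have e1 := hpush t 1 h1
        have w0 : W t 0 = V t 0 := by simp only [W, hC0, hdfx]; rfl
        have w1 : W t 1 = V t 1 := by simp only [W, hC1, hdfTx]; rfl
        rw [w0, hD0] at e0
        rw [w1, hD1'] at e1
        have e2 : V t 1 = fderiv ℝ T x (r * V t 0) := hrV
        rw [e2, hT.pushforward hx, e0] at e1
        exact (tangentBundle_mk_eq (by rw [hD1']) rfl).trans (e1.symm.trans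
          (tangentBundle_mk_eq (by rw [hD0]) rfl)) }
  refine ⟨σ, ?_, fun u hu => ?_, fun u hu => ?_⟩
  · have hcont : Continuous fun q : unitInterval × ℝ =>
        (⟨D q.1 q.2, W q.1 q.2⟩ : TangentBundle 𝓘(ℝ, ℂ) ℂ) :=
      (tangentBundleModelSpaceHomeomorph 𝓘(ℝ, ℂ)).symm.continuous.comp (hDc.prodMk hWc)
    refine (S.continuousOn_tangentMap_proj.comp_continuous hcont
      (fun q => hDU q.1 q.2)).continuousOn.congr fun q hq => ?_
    exact (hpush q.1 q.2 hq.2).symm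
  · show S.proj (f (C 0 u)) = γ₁.toFun u
    rw [hCfirst hu, hfK (Or.inl (Or.inl ⟨u, hu, rfl⟩)), id, hc₁.2.2.1 u hu]
  · show S.proj (f (C 1 u)) = γ₂.toFun u
    rw [hClast hu, hfK (Or.inl (Or.inr ⟨u, hu, rfl⟩)), id, hc₂.2.2.1 u hu]

lemma IsAngleFunction.hasAngle {c : ℝ → ℂ} {θ : ℝ → ℝ} (h : IsAngleFunction c θ) {V : C(ℝ, ℂ)}
    (hV : ⇑V = extendUnit (planeVelocity c)) :
    HasAngle V ⟨extendUnit θ, continuous_extendUnit h.1⟩ := fun u => by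
  rw [hV]
  obtain ⟨r, hr, hr'⟩ := h.planeVelocity_eq (projIcc (0 : ℝ) 1 zero_le_one u).2
  show planeVelocity c (projIcc (0 : ℝ) 1 zero_le_one u) =
    ‖planeVelocity c (projIcc (0 : ℝ) 1 zero_le_one u)‖ *
      Complex.exp (θ (projIcc (0 : ℝ) 1 zero_le_one u) * Complex.I)
  rw [hr', norm_mul, Complex.norm_exp_ofReal_mul_I, Complex.norm_real, Real.norm_of_nonneg hr.le,
    mul_one]

/-- The closing condition on velocities follows from that on angles. -/
lemma closing_of_angle {A : ℂ →L[ℝ] ℂ} {μ : ℝ} (hμ : 0 < μ) {f : ℝ → ℝ}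
    (hf : ∀ r t : ℝ, A (r * Complex.exp (t * Complex.I)) =
        (μ * r : ℝ) * Complex.exp (f t * Complex.I)) {a b r s : ℝ} (hr : 0 < r) (hs : 0 < s)
    {k : ℤ} (hab : b = f a + 2 * Real.pi * k) :
    ∃ l : ℝ, 0 < l ∧ (s * Complex.exp (b * Complex.I) : ℂ) =
      A (l * (r * Complex.exp (a * Complex.I))) := by
  refine ⟨s / (μ * r), by positivity, ?_⟩
  rw [← mul_assoc, ← Complex.ofReal_mul, hf, hab]
  rw [show ((f a + 2 * Real.pi * k : ℝ) : ℂ) * Complex.I =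
    f a * Complex.I + k * (2 * Real.pi * Complex.I) by push_cast; ring, Complex.exp_add,
    Complex.exp_int_mul_two_pi_mul_I, mul_one]
  congr 2
  field_simp

lemma regularlyHomotopic_of_invariants (hS : S.IsTame) {x : ℂ} (hx : x ∈ S.cover)
    (hp : S.proj x = p) {γ₁ γ₂ : RegularClosedCurve p}
    (hclass : γ₁.homotopyClass = γ₂.homotopyClass)
    (hw : S.basedWindingNumber x γ₁ = S.basedWindingNumber x γ₂) :
    RegularlyHomotopicFixingBasePoint γ₁ γ₂ := by
  have h0 : (0 : ℝ) ∈ Icc (0 : ℝ) 1 := by simp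
  have h1 : (1 : ℝ) ∈ Icc (0 : ℝ) 1 := by simp
  obtain ⟨c₁, hc₁⟩ := exists_isLift hx γ₁.contMDiffOn.continuousOn (γ₁.source.trans hp.symm)
  obtain ⟨c₂, hc₂⟩ := exists_isLift hx γ₂.contMDiffOn.continuousOn (γ₂.source.trans hp.symm)
  obtain ⟨θ₁, hθ₁⟩ := hc₁.exists_isAngleFunction
  obtain ⟨θ₂, hθ₂⟩ := hc₂.exists_isAngleFunction
  have hend := (homotopyClass_eq_iff hx hc₁ hc₂).1 hclass
  obtain ⟨T, hT, hTx⟩ := exists_isDeckTransformation hx (hc₁.2.1 h1)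
    (by rw [hp, hc₁.2.2.1 1 h1, γ₁.target])
  have hTx₂ := hTx.trans hend
  have cv₁ := ContDiffOn.continuousOn_planeVelocity (hc₁.contDiffOn γ₁.contMDiffOn)
  have cv₂ := ContDiffOn.continuousOn_planeVelocity (hc₂.contDiffOn γ₂.contMDiffOn)
  let V₁ : C(ℝ, ℂ) := ⟨_, continuous_extendUnit cv₁⟩
  let V₂ : C(ℝ, ℂ) := ⟨_, continuous_extendUnit cv₂⟩
  let B : ℂ → ℂ → Prop := fun a b => ∃ r : ℝ, 0 < r ∧ b = fderiv ℝ T x (r * a)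
  have hmem : ∀ {γ : RegularClosedCurve p} {c : ℝ → ℂ} (hc : S.IsLift x γ.toFun c) {V : C(ℝ, ℂ)},
      ⇑V = extendUnit (planeVelocity c) → T x = c 1 → V ∈ velocityFields (T x - x) B := by
    intro γ c hc V hV hTc
    refine ⟨fun u => ?_, ?_, ?_⟩
    · rw [hV]
      exact hc.planeVelocity_ne_zero (projIcc (0 : ℝ) 1 zero_le_one u).2
    · rw [hV, integral_extendUnit_planeVelocity (hc.contDiffOn γ.contMDiffOn) h1, hc.2.2.2, hTc]
    · rw [hV, extendUnit_eq h0, extendUnit_eq h1]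
      exact hc.planeVelocity_one hT hTc
  have hm₁ := hmem hc₁ (V := V₁) rfl hTx
  have hm₂ := hmem hc₂ (V := V₂) rfl hTx₂
  refine regularlyHomotopic_of_joinedIn hS hx hT hc₁ hc₂ hp (V₁ := V₁) (V₂ := V₂) rfl rfl ?_
  obtain ⟨μ, α, hμ, hpos, hneg⟩ := hT.exists_angle hx
  rcases hT.det_pos_or_neg with hdet | hdet
  · have hf := hpos (hdet x hx)
    rw [basedWindingNumber_eq_iff_of_pos hS hx hT hdet hc₁ hc₂ hTx.symm hTx₂.symm hθ₁ hθ₂] at hw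
    obtain ⟨k, hk⟩ := exists_int_of_exp_eq' (hc₁.exp_angle_one hθ₁ hT hTx (f := fun t => t + α)
      hμ hf)
    refine joinedIn_velocityFields_of_hasAngle hm₁ hm₂ (IsAngleFunction.hasAngle hθ₁ rfl)
      (IsAngleFunction.hasAngle hθ₂ rfl) fun t _ r s hr hs =>
      closing_of_angle hμ (f := fun t => t + α) hf hr hs (k := k) ?_
    simp only [ContinuousMap.coe_mk, extendUnit_eq h0, extendUnit_eq h1]
    rw [show θ₂ 1 = θ₁ 1 - θ₁ 0 + θ₂ 0 by linarith, hk]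
    ring
  · have hf := hneg (hdet x hx)
    rw [basedWindingNumber_eq_iff_of_neg hS hx hT hdet hc₁ hc₂ hTx.symm hTx₂.symm hθ₁ hθ₂] at hw
    obtain ⟨m, hm⟩ := hw
    -- shifting the second angle function makes the sums of the end angles equal
    have hθ₂' : IsAngleFunction c₂ (fun u => θ₂ u + 2 * Real.pi * m) :=
      ⟨hθ₂.1.add continuousOn_const, fun u hu => by
        rw [hθ₂.2 u hu, show ((θ₂ u + 2 * Real.pi * m : ℝ) : ℂ) * Complex.I =
          θ₂ u * Complex.I + m * (2 * Real.pi * Complex.I) by push_cast; ring, Complex.exp_add,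
          Complex.exp_int_mul_two_pi_mul_I, mul_one]⟩
    obtain ⟨k, hk⟩ := exists_int_of_exp_eq' (hc₁.exp_angle_one hθ₁ hT hTx (f := fun t => α - t)
      hμ hf)
    refine joinedIn_velocityFields_of_hasAngle hm₁ hm₂ (IsAngleFunction.hasAngle hθ₁ rfl)
      (IsAngleFunction.hasAngle hθ₂' rfl) fun t _ r s hr hs =>
      closing_of_angle hμ (f := fun t => α - t) hf hr hs (k := k) ?_
    simp only [ContinuousMap.coe_mk, extendUnit_eq h0, extendUnit_eq h1]
    rw [show θ₂ 1 = θ₁ 1 + θ₁ 0 - θ₂ 0 - 4 * Real.pi * m by linarith, hk]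
    ring

end ConformallyEuclideanStructure

end Construction

end BasedWinding

end

open BasedWinding in
theorem theorem1p1 {M : Type*} [TopologicalSpace M] [T2Space M] [SecondCountableTopology M]
    [ConnectedSpace M] [ChartedSpace (EuclideanSpace ℝ (Fin 2)) M] [IsManifold (𝓡 2) ∞ M]
    (g : ContMDiffRiemannianMetric (𝓡 2) ∞ (EuclideanSpace ℝ (Fin 2))
      (fun x : M => TangentSpace (𝓡 2) x))
    (S : ConformallyEuclideanStructure g) (hS : S.IsTame)
    (p : M) (pLift : ℂ) (hpLift : pLift ∈ S.cover) (hp : S.proj pLift = p) :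
    (∀ γ : RegularClosedCurve p, ∃! w, S.IsBasedWindingNumber pLift γ w) ∧
    ∀ γ₁ γ₂ : RegularClosedCurve p,
      RegularlyHomotopicFixingBasePoint γ₁ γ₂ ↔
        γ₁.homotopyClass = γ₂.homotopyClass ∧
          S.basedWindingNumber pLift γ₁ = S.basedWindingNumber pLift γ₂ :=
  ⟨fun γ => ConformallyEuclideanStructure.existsUnique_isBasedWindingNumber hS hpLift hp γ,
    fun _ _ =>
      ⟨fun h => ConformallyEuclideanStructure.RegularlyHomotopicFixingBasePoint.invariants
        hS hpLift hp h,
      fun h => ConformallyEuclideanStructure.regularlyHomotopic_of_invariants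
        hS hpLift hp h.1 h.2⟩⟩
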